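/- **Definitions.** Let $G$ be a finite directed graph on $n$ vertices and let $D$ be a non-empty finite set of demands $(u,v,t)$, where $(u,v)\in E(G)$ and $t\ge 1$ is an integer. Put $\Lambda(D)=\max_{(u,v,t)\in D}t$. A *temporal walk* is a sequence $(v_0,t_0),\dots,(v_\ell,t_\ell)$ with integers $t_0<t_1<\dots<t_\ell$ such that $(v_{i-1},v_i)\in E(G)$ and $1\le t_{i-1}\le\Lambda(D)$ for $1\le i\le\ell$; its time-edges are the triples $(v_{i-1},v_i,t_{i-1})$, and its lifespan is $t_\ell-t_0$. The problem $\tau$-TEDSC asks, for given $G$, $D$ and integers $k,h\ge 0$, whether there is a set $S$ of at most $k$ temporal walks, each of lifespan at most $h$, such that no two distinct walks of $S$ share a time-edge and every demand in $D$ is a time-edge of some walk in $S$. A *bidirected star* is a directed graph with a vertex $c$ whose edges are exactly the pairs $(c,v)$ and $(v,c)$ for all vertices $v\ne c$. **Theorem.** There is an algorithm that solves $\tau$-TEDSC on bidirected stars in time $3^k\cdot(n\cdot|D|)^{O(n)}$. Precisely, there are a word RAM program and a constant $C$ such that, for every instance $(G,D,k,h)$ in which $G$ is a bidirected star on $n$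 vertices, the program, given $n,k,h$ and lists of the edges and of the demands in any order, halts with the correct answer after at most $T=3^k\,(n\,|D|)^{Cn}$ steps, where additions, subtractions, tests and memory accesses cost one step each and all numbers computed are at most $T\cdot(\Lambda(D)+h+1)$. In particular, the problem is fixed-parameter tractable in $k$ for every fixed $n$. -/

import Mathlib

/-! ## Temporal graphs and temporal walks -/

/-- A directed temporal graph: a static digraph together with a nonempty set of positive time
steps for every edge.  The value of `label` outside the edges is irrelevant. -/
structure TemporalGraph (V : Type*) where
  G : Digraph V
  label : V → V → Set ℕ
  label_nonempty : ∀ u v, G.Adj u v → (label u v).Nonempty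
  label_pos : ∀ u v, G.Adj u v → ∀ t ∈ label u v, 1 ≤ t

/-- The time-edges `((u, v), t)`: the edge `(u, v)` is available at time step `t`. -/
def TemporalGraph.timeEdges {V : Type*} (𝒢 : TemporalGraph V) : Set ((V × V) × ℕ) :=
  {e | 𝒢.G.Adj e.1.1 e.1.2 ∧ e.2 ∈ 𝒢.label e.1.1 e.1.2}

/-- A (strict) temporal walk `(v₀, t₀), …, (v_ℓ, t_ℓ)`: the times are strictly increasing, and the
edge from `vᵢ` to `vᵢ₊₁` is traversed at time step `tᵢ`. -/
structure TemporalWalk {V : Type*} (𝒢 : TemporalGraph V) where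
  length : ℕ
  vertex : Fin (length + 1) → V
  time : Fin (length + 1) → ℕ
  time_strictMono : StrictMono time
  edge_mem : ∀ i : Fin length,
    ((vertex i.castSucc, vertex i.succ), time i.castSucc) ∈ 𝒢.timeEdges

namespace TemporalWalk

variable {V : Type*} {𝒢 : TemporalGraph V}

/-- The set of time-edges traversed by a walk. -/
def timeEdges (p : TemporalWalk 𝒢) : Set ((V × V) × ℕ) :=
  {e | ∃ i : Fin p.length,
    e = ((p.vertex i.castSucc, p.vertex i.succ), p.time i.castSucc)}

/-- The lifespan `τ(p) = t_ℓ - t₀`. -/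
def lifespan (p : TemporalWalk 𝒢) : ℕ :=
  p.time (Fin.last p.length) - p.time 0

/-- Temporal edge disjointness of two walks. -/
def TED (p q : TemporalWalk 𝒢) : Prop :=
  Disjoint p.timeEdges q.timeEdges

end TemporalWalk

/-! ## The lifespan-constrained schedule completion problem -/

/-- An instance `(G, D, k, h)`.  The draft schedule `D` is a finite nonempty set of demands
`((u, v), t)` with `(u, v)` an edge and `t` a positive time step. -/
structure LifeTEDSC (V : Type*) where
  G : Digraph V
  D : Finset ((V × V) × ℕ)
  k : ℕ
  h : ℕ
  demands_nonempty : D.Nonempty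
  demand_edge : ∀ d ∈ D, G.Adj d.1.1 d.1.2
  demand_pos : ∀ d ∈ D, 1 ≤ d.2

namespace LifeTEDSC

variable {V : Type*}

/-- The lifetime `Λ(D)`, the largest time step of a demand. -/
def lifetime (I : LifeTEDSC V) : ℕ :=
  I.D.sup Prod.snd

theorem one_le_lifetime (I : LifeTEDSC V) : 1 ≤ I.lifetime := by
  obtain ⟨d, hd⟩ := I.demands_nonempty
  exact (I.demand_pos d hd).trans (Finset.le_sup (f := Prod.snd) hd)

/-- The temporal graph in which every edge of `G` is available at the time steps
`1, …, Λ(D)`. -/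
def temporalGraph (I : LifeTEDSC V) : TemporalGraph V where
  G := I.G
  label := fun _ _ => Set.Icc 1 I.lifetime
  label_nonempty := fun _ _ _ => ⟨1, le_refl 1, I.one_le_lifetime⟩
  label_pos := fun _ _ _ _ ht => ht.1

/-- A schedule is a set of pairwise temporally edge disjoint temporal walks. -/
def IsSchedule (I : LifeTEDSC V) (S : Set (TemporalWalk I.temporalGraph)) : Prop :=
  S.Pairwise TemporalWalk.TED

/-- `S` extends the draft schedule: every demand is a time-edge of some walk in `S`. -/
def Extends (I : LifeTEDSC V) (S : Set (TemporalWalk I.temporalGraph)) : Prop :=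
  ∀ d ∈ I.D, ∃ p ∈ S, d ∈ p.timeEdges

/-- The instance is a yes-instance. -/
def IsFeasible (I : LifeTEDSC V) : Prop :=
  ∃ S : Set (TemporalWalk I.temporalGraph),
    I.IsSchedule S ∧ I.Extends S ∧ S.encard ≤ I.k ∧ ∀ p ∈ S, p.lifespan ≤ I.h

end LifeTEDSC

/-- Bidirected stars: for some center `c`, the edges are exactly the pairs `(c, v)` and `(v, c)`
with `v ≠ c`. -/
def IsBidirectedStar {V : Type*} (G : Digraph V) : Prop :=
  ∃ c : V, ∀ u v : V, G.Adj u v ↔ (u = c ∧ v ≠ c) ∨ (u ≠ c ∧ v = c)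

/-! ## Word RAM programs with a step count -/

/-- Programs of a random access machine, with structured control flow (every construct is a
bounded number of machine instructions and conditional jumps).  Arguments `x y z` are register
names; a program mentions finitely many registers.  The only arithmetic is addition and
truncated subtraction. -/
inductive RamProg where
  | const (x a : ℕ)
  | add (x y z : ℕ)
  | sub (x y z : ℕ)
  | load (x y : ℕ)
  | store (x y : ℕ)
  | seq (p q : RamProg)
  | ite (x : ℕ) (p q : RamProg)
  | loop (x : ℕ) (p : RamProg)

/-- Contents of the registers and of the addressable memory. -/
structure RamState where
  reg : ℕ → ℕ
  mem : ℕ → ℕ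

/-- Write `a` into register `x`. -/
def RamState.setReg (s : RamState) (x a : ℕ) : RamState :=
  { s with reg := Function.update s.reg x a }

/-- Write `a` into the memory cell with address `i`. -/
def RamState.setMem (s : RamState) (i a : ℕ) : RamState :=
  { s with mem := Function.update s.mem i a }

/-- `RamExec W p s t s'`: started in state `s`, the program `p` halts in state `s'` after exactly
`t` unit-cost steps, and no computed value exceeds the largest machine word `W`.  A computation
that would exceed `W` has no result.  Elementary instructions and tests cost one step each.
* `const x a`: `x := a`
* `add x y z`: `x := y + z`
* `sub x y z`: `x := y - z` (truncated at zero)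
* `load x y`: `x := mem[y]`
* `store x y`: `mem[x] := y`
* `ite x p q`: run `p` if register `x` is nonzero, else `q`
* `loop x p`: while register `x` is nonzero, run `p` -/
inductive RamExec (W : ℕ) : RamProg → RamState → ℕ → RamState → Prop
  | const (x a : ℕ) (s : RamState) (hW : a ≤ W) :
      RamExec W (.const x a) s 1 (s.setReg x a)
  | add (x y z : ℕ) (s : RamState) (hW : s.reg y + s.reg z ≤ W) :
      RamExec W (.add x y z) s 1 (s.setReg x (s.reg y + s.reg z))
  | sub (x y z : ℕ) (s : RamState) :
      RamExec W (.sub x y z) s 1 (s.setReg x (s.reg y - s.reg z))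
  | load (x y : ℕ) (s : RamState) :
      RamExec W (.load x y) s 1 (s.setReg x (s.mem (s.reg y)))
  | store (x y : ℕ) (s : RamState) :
      RamExec W (.store x y) s 1 (s.setMem (s.reg x) (s.reg y))
  | seq {p q : RamProg} {s₁ s₂ s₃ : RamState} {t₁ t₂ : ℕ}
      (h₁ : RamExec W p s₁ t₁ s₂) (h₂ : RamExec W q s₂ t₂ s₃) :
      RamExec W (.seq p q) s₁ (t₁ + t₂) s₃
  | ite_true {x : ℕ} {p : RamProg} (q : RamProg) {s s' : RamState} {t : ℕ}
      (hx : s.reg x ≠ 0) (h₁ : RamExec W p s t s') :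
      RamExec W (.ite x p q) s (t + 1) s'
  | ite_false {x : ℕ} (p : RamProg) {q : RamProg} {s s' : RamState} {t : ℕ}
      (hx : s.reg x = 0) (h₁ : RamExec W q s t s') :
      RamExec W (.ite x p q) s (t + 1) s'
  | loop_done {x : ℕ} (p : RamProg) {s : RamState} (hx : s.reg x = 0) :
      RamExec W (.loop x p) s 1 s
  | loop_step {x : ℕ} {p : RamProg} {s₁ s₂ s₃ : RamState} {t₁ t₂ : ℕ}
      (hx : s₁.reg x ≠ 0) (h₁ : RamExec W p s₁ t₁ s₂)
      (h₂ : RamExec W (.loop x p) s₂ t₂ s₃) :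
      RamExec W (.loop x p) s₁ (t₁ + t₂ + 1) s₃

/-- The initial state: registers are zero, the input occupies the first memory cells, and all
other memory cells are zero. -/
def RamState.init (w : List ℕ) : RamState where
  reg := fun _ => 0
  mem := fun i => w.getD i 0

/-! ## Instances as inputs -/

/-- `w` is a description of the instance `I` on the vertex set `{0, …, n-1}`: the numbers
`n, |E|, |D|, k, h`, then the edges `u, v`, then the demands `u, v, t`, where edges and demands
are listed without repetition in an arbitrary order. -/
def LifeTEDSC.IsEncoding {n : ℕ} (I : LifeTEDSC (Fin n)) (w : List ℕ) : Prop :=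
  ∃ (es : List (Fin n × Fin n)) (ds : List ((Fin n × Fin n) × ℕ)),
    es.Nodup ∧ (∀ e, e ∈ es ↔ I.G.Adj e.1 e.2) ∧
    ds.Nodup ∧ (∀ d, d ∈ ds ↔ d ∈ I.D) ∧
    w = [n, es.length, ds.length, I.k, I.h]
      ++ es.flatMap (fun e => [(e.1 : ℕ), (e.2 : ℕ)])
      ++ ds.flatMap (fun d => [(d.1.1 : ℕ), (d.1.2 : ℕ), d.2])

/-- With words up to `W`, the program `P` decides `I` from each of its descriptions in at most `T`
steps.  The answer, `1` for yes and `0` for no, is left in register `0`. -/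
def RamProg.Decides {n : ℕ} (P : RamProg) (I : LifeTEDSC (Fin n)) (W T : ℕ) : Prop :=
  ∀ w : List ℕ, I.IsEncoding w → ∃ (t : ℕ) (s : RamState),
    RamExec W P (RamState.init w) t s ∧ t ≤ T ∧
    (I.IsFeasible → s.reg 0 = 1) ∧ (¬ I.IsFeasible → s.reg 0 = 0)

/-!
The instance is decided by a dynamic program over time whose states describe only a bounded number
of walks per vertex.

*Few walks at a time.*  Consider a solution with as few walks as possible.  At no time `t` are more
than `4 n` of its walks under way.  For a leaf `v`, the two walks that alternate between the center
and `v` at every step, one for each parity, together traverse both edges of this leg at every time.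
Hence `2 n` such shuttles serve all edges during `h` consecutive time steps, and `4 n` of them serve
all edges in the window from `t + 1 - h` to `t + h`.  This window contains all walks that are under
way at time `t`, and every other walk meets its complement in one piece, so more than `4 n` walks
under way at time `t` could be replaced by `4 n` shuttles (`LifeTEDSC.HasPlan.exists_crowd_le`).

*Slots.*  Every walk may start with a demand.  By a greedy colouring of the intervals of time, the
walks can then be distributed over `4 n` slots, each of which holds one walk at a time
(`exists_interval_coloring`, `LifeTEDSC.IsPlan.exists_isRun`).  A configuration lists, for every
slot, the current vertex and the demand with which the current walk started; the latter determines
the deadline of the walk.  Deadlines have to be checked only when a demand is served, because a walk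
can be cut off after its last demand (`LifeTEDSC.IsRun.hasPlan`).

*Few relevant times.*  On a star, any rearrangement of `M` slots without new walks takes `2 M` time
steps: one slot after the other moves to the center and on to its new vertex.  Therefore walks need
to move only in the `8 n` time steps before a demand and at the times of the demands
(`LifeTEDSC.IsRun.reach`, `LifeTEDSC.isFeasible_iff_reach`), and the dynamic program has
`|D| (8 n + 1)` rounds at most (`Tables.exists_rounds`), however large the times are.

*The program.*  There are `(n + |D| + 1) ^ (8 n)` codes of configurations.  The table of the dynamic
program stores for every code how many of the `k` walks are left, plus one, or `0` if the
configuration cannot be reached.  The program is assembled from expressions with bounded loops.  If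
all loops make at most `K` rounds, the running time is at most `K` to an exponent that depends
on the program alone (`RamProg.deg`, `Runs`), and `K = (n |D|) ^ (20 n)` suffices
(`LifeTEDSC.bounded_tables`).  The number of steps is thus `(n |D|) ^ (O(n))`; the factor `3 ^ k`
gives room for the numbers up to `k + 1` in the table.
-/

/-! ### Running programs within a polynomial time bound -/

namespace RamProg

/-- A syntactic exponent: a program whose loops all make at most `K` rounds takes at most
`K ^ deg` steps. -/
def deg : RamProg → ℕ
  | const _ _ => 0
  | add _ _ _ => 0
  | sub _ _ _ => 0
  | load _ _ => 0
  | store _ _ => 0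
  | seq p q => deg p + deg q + 1
  | ite _ p q => deg p + deg q + 1
  | loop _ p => deg p + 2

end RamProg

namespace RamState

@[simp] theorem reg_setReg (s : RamState) (x a y : ℕ) :
    (s.setReg x a).reg y = if y = x then a else s.reg y := by
  simp [setReg, Function.update_apply]

@[simp] theorem reg_setMem (s : RamState) (i a : ℕ) : (s.setMem i a).reg = s.reg := rfl

@[simp] theorem mem_setMem (s : RamState) (i a j : ℕ) :
    (s.setMem i a).mem j = if j = i then a else s.mem j := by
  simp [setMem, Function.update_apply]

/-- The states have the same memory and the same registers below `l`. -/
def Agree (l : ℕ) (s s' : RamState) : Prop :=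
  (∀ r < l, s'.reg r = s.reg r) ∧ s'.mem = s.mem

theorem Agree.refl (l : ℕ) (s : RamState) : Agree l s s := ⟨fun _ _ => rfl, rfl⟩

theorem Agree.trans {l m : ℕ} {s s' s'' : RamState} (h : Agree l s s') (hlm : l ≤ m)
    (h' : Agree m s' s'') : Agree l s s'' :=
  ⟨fun r hr => (h'.1 r (hr.trans_le hlm)).trans (h.1 r hr), h'.2.trans h.2⟩

theorem Agree.setReg {l x a : ℕ} {s s' : RamState} (h : Agree l s s') (hx : l ≤ x) :
    Agree l s (s'.setReg x a) :=
  ⟨fun r hr => by rw [reg_setReg, if_neg (by omega), h.1 r hr], h.2⟩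

end RamState

open RamState RamProg

/-- The program takes `s` to `s'` with words up to `W` in at most `K ^ p.deg` steps. -/
def Runs (W K : ℕ) (p : RamProg) (s s' : RamState) : Prop :=
  ∃ t ≤ K ^ p.deg, RamExec W p s t s'

section Rules

variable {W K : ℕ}

theorem Runs.const {x a : ℕ} {s : RamState} (h : a ≤ W) :
    Runs W K (.const x a) s (s.setReg x a) := ⟨1, by simp [deg], .const _ _ _ h⟩

theorem Runs.add {x y z : ℕ} {s : RamState} (h : s.reg y + s.reg z ≤ W) :
    Runs W K (.add x y z) s (s.setReg x (s.reg y + s.reg z)) := ⟨1, by simp [deg], .add _ _ _ _ h⟩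

theorem Runs.sub {x y z : ℕ} {s : RamState} :
    Runs W K (.sub x y z) s (s.setReg x (s.reg y - s.reg z)) := ⟨1, by simp [deg], .sub _ _ _ _⟩

theorem Runs.load {x y : ℕ} {s : RamState} :
    Runs W K (.load x y) s (s.setReg x (s.mem (s.reg y))) := ⟨1, by simp [deg], .load _ _ _⟩

theorem Runs.store {x y : ℕ} {s : RamState} :
    Runs W K (.store x y) s (s.setMem (s.reg x) (s.reg y)) := ⟨1, by simp [deg], .store _ _ _⟩

theorem Runs.seq (hK : 8 ≤ K) {p q : RamProg} {s s' s'' : RamState} (h : Runs W K p s s')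
    (h' : Runs W K q s' s'') : Runs W K (.seq p q) s s'' := by
  obtain ⟨t, ht, h⟩ := h
  obtain ⟨t', ht', h'⟩ := h'
  refine ⟨t + t', ?_, .seq h h'⟩
  have h1 : K ^ p.deg ≤ K ^ (p.deg + q.deg) := Nat.pow_le_pow_right (by omega) (by omega)
  have h2 : K ^ q.deg ≤ K ^ (p.deg + q.deg) := Nat.pow_le_pow_right (by omega) (by omega)
  have h3 : 8 * K ^ (p.deg + q.deg) ≤ K ^ (p.deg + q.deg + 1) := by
    rw [pow_succ, mul_comm]; exact Nat.mul_le_mul_left _ hK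
  simp only [deg]
  omega

theorem Runs.ite (hK : 8 ≤ K) {x : ℕ} {p q : RamProg} {s s' : RamState}
    (h : Runs W K (if s.reg x ≠ 0 then p else q) s s') : Runs W K (.ite x p q) s s' := by
  obtain ⟨t, ht, h⟩ := h
  have h1 : K ^ p.deg ≤ K ^ (p.deg + q.deg) := Nat.pow_le_pow_right (by omega) (by omega)
  have h2 : K ^ q.deg ≤ K ^ (p.deg + q.deg) := Nat.pow_le_pow_right (by omega) (by omega)
  have h3 : 8 * K ^ (p.deg + q.deg) ≤ K ^ (p.deg + q.deg + 1) := by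
    rw [pow_succ, mul_comm]; exact Nat.mul_le_mul_left _ hK
  have h4 : 1 ≤ K ^ (p.deg + q.deg) := Nat.one_le_pow _ _ (by omega)
  split_ifs at h ht with hx
  · exact ⟨t + 1, by simp only [deg]; omega, .ite_true _ hx h⟩
  · exact ⟨t + 1, by simp only [deg]; omega, .ite_false _ (not_not.1 hx) h⟩

/-- Loop rule: the invariant is indexed by the number of completed rounds, of which there are
`J ≤ K`. -/
theorem Runs.loop (hK : 8 ≤ K) {x J : ℕ} {p : RamProg} (hJ : J ≤ K) (Inv : ℕ → RamState → Prop)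
    (hstep : ∀ i < J, ∀ s, Inv i s → s.reg x ≠ 0 ∧ ∃ s', Runs W K p s s' ∧ Inv (i + 1) s')
    (hend : ∀ s, Inv J s → s.reg x = 0) {s : RamState} (h0 : Inv 0 s) :
    ∃ s', Runs W K (.loop x p) s s' ∧ Inv J s' := by
  have key : ∀ j ≤ J, ∀ s, Inv (J - j) s →
      ∃ t s', t ≤ j * (K ^ p.deg + 1) + 1 ∧ RamExec W (.loop x p) s t s' ∧ Inv J s' := by
    intro j
    induction j with
    | zero => exact fun _ s hs =>
        ⟨1, s, by simp, .loop_done _ (hend s (by simpa using hs)), by simpa using hs⟩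
    | succ j ih =>
      intro hj s hs
      obtain ⟨hx, s', ⟨t, ht, hr⟩, hs'⟩ := hstep _ (by omega) s hs
      rw [show J - (j + 1) + 1 = J - j by omega] at hs'
      obtain ⟨t', s'', ht', hr', hs''⟩ := ih (by omega) s' hs'
      refine ⟨t + t' + 1, s'', ?_, .loop_step hx hr hr', hs''⟩
      rw [add_mul]
      omega
  obtain ⟨t, s', ht, hr, hs'⟩ := key J le_rfl s (by simpa using h0)
  refine ⟨s', ⟨t, ht.trans ?_, hr⟩, hs'⟩
  have h1 : 1 ≤ K ^ p.deg := Nat.one_le_pow _ _ (by omega)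
  have h2 : J * (K ^ p.deg + 1) ≤ K * (K ^ p.deg + 1) := Nat.mul_le_mul_right _ hJ
  have h3 : K * 8 * K ^ p.deg ≤ K * K * K ^ p.deg :=
    Nat.mul_le_mul_right _ (Nat.mul_le_mul_left _ hK)
  have h4 : K * 1 ≤ K * K ^ p.deg := Nat.mul_le_mul_left _ h1
  have h5 : K ^ (deg (.loop x p)) = K * K * K ^ p.deg := by simp only [deg]; ring
  rw [h5]
  nlinarith

end Rules

/-! ### Expressions -/

/-- An expression is compiled relative to a register `l`: the program leaves the value in
register `l`, and it does not change the registers below `l` or the memory. -/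
abbrev RamExpr := ℕ → RamProg

/-- The expression has the value `v` in the state `s`, and it reads no registers from `l` on.
The statement is about all states that agree with `s` below `l`, so it survives the binding of
further registers (`Ev.mono`). -/
def Ev (W K l : ℕ) (s : RamState) (e : RamExpr) (v : ℕ) : Prop :=
  ∀ l' s', l ≤ l' → Agree l s s' →
    ∃ s'', Runs W K (e l') s' s'' ∧ Agree l' s' s'' ∧ s''.reg l' = v

namespace RamExpr

/-- The constant `a`. -/
def cst (a : ℕ) : RamExpr := fun l => .const l a

/-- The content of register `x`, copied by subtracting zero. -/
def var (x : ℕ) : RamExpr := fun l => .seq (.const l 0) (.sub l x l)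

/-- The sum. -/
def plus (a b : RamExpr) : RamExpr := fun l => .seq (a l) (.seq (b (l + 1)) (.add l l (l + 1)))

/-- The truncated difference. -/
def minus (a b : RamExpr) : RamExpr := fun l => .seq (a l) (.seq (b (l + 1)) (.sub l l (l + 1)))

/-- The content of the memory cell with address `a`. -/
def ld (a : RamExpr) : RamExpr := fun l => .seq (a l) (.load l l)

/-- The value of `a` if `c` is nonzero, and the value of `b` otherwise. -/
def cond (c a b : RamExpr) : RamExpr := fun l => .seq (c l) (.ite l (a l) (b l))

/-- Bounded iteration.  The body is given the registers of the accumulator and of the round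
number.  Register `l + 2` counts the remaining rounds, register `l + 3` receives the value of the
body, and register `l + 4` holds the constants needed for copying and counting. -/
def fold (init bnd : RamExpr) (f : ℕ → ℕ → RamExpr) : RamExpr := fun l =>
  .seq (init l) <| .seq (.const (l + 1) 0) <| .seq (bnd (l + 2)) <| .loop (l + 2) <|
    .seq (f l (l + 1) (l + 3)) <| .seq (.const (l + 4) 0) <| .seq (.sub l (l + 3) (l + 4)) <|
    .seq (.const (l + 4) 1) <| .seq (.add (l + 1) (l + 1) (l + 4)) (.sub (l + 2) (l + 2) (l + 4))

end RamExpr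

open RamExpr

namespace Ev

variable {W K l : ℕ} {s : RamState}

theorem mono {e : RamExpr} {v m : ℕ} {s' : RamState} (h : Ev W K l s e v) (hlm : l ≤ m)
    (hs : Agree l s s') : Ev W K m s' e v :=
  fun l' s'' hl hs'' => h l' s'' (hlm.trans hl) (hs.trans hlm hs'')

theorem cst {a : ℕ} (ha : a ≤ W) : Ev W K l s (cst a) a :=
  fun l' s' _ _ => ⟨_, Runs.const ha, (Agree.refl _ _).setReg le_rfl, by simp⟩

theorem var (hK : 8 ≤ K) {x v : ℕ} (hx : x < l) (hv : s.reg x = v) : Ev W K l s (var x) v := by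
  intro l' s' hl hs
  refine ⟨_, Runs.seq hK (Runs.const (Nat.zero_le _)) Runs.sub,
    ((Agree.refl _ _).setReg le_rfl).setReg le_rfl, ?_⟩
  have : x ≠ l' := by omega
  simp [this, hs.1 x hx, hv]

theorem plus (hK : 8 ≤ K) {a b : RamExpr} {u v : ℕ} (ha : Ev W K l s a u) (hb : Ev W K l s b v)
    (h : u + v ≤ W) : Ev W K l s (plus a b) (u + v) := by
  intro l' s' hl hs
  obtain ⟨s1, r1, a1, v1⟩ := ha l' s' hl hs
  obtain ⟨s2, r2, a2, v2⟩ := hb (l' + 1) s1 (by omega) (hs.trans hl a1)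
  have e1 : s2.reg l' = u := (a2.1 l' (by omega)).trans v1
  refine ⟨_, Runs.seq hK r1 (Runs.seq hK r2 (Runs.add (by rw [e1, v2]; exact h))),
    (a1.trans (Nat.le_succ _) a2).setReg le_rfl, by simp [e1, v2]⟩

theorem minus (hK : 8 ≤ K) {a b : RamExpr} {u v : ℕ} (ha : Ev W K l s a u)
    (hb : Ev W K l s b v) : Ev W K l s (minus a b) (u - v) := by
  intro l' s' hl hs
  obtain ⟨s1, r1, a1, v1⟩ := ha l' s' hl hs
  obtain ⟨s2, r2, a2, v2⟩ := hb (l' + 1) s1 (by omega) (hs.trans hl a1)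
  have e1 : s2.reg l' = u := (a2.1 l' (by omega)).trans v1
  refine ⟨_, Runs.seq hK r1 (Runs.seq hK r2 Runs.sub),
    (a1.trans (Nat.le_succ _) a2).setReg le_rfl, by simp [e1, v2]⟩

theorem ld (hK : 8 ≤ K) {a : RamExpr} {u : ℕ} (ha : Ev W K l s a u) :
    Ev W K l s (ld a) (s.mem u) := by
  intro l' s' hl hs
  obtain ⟨s1, r1, a1, v1⟩ := ha l' s' hl hs
  exact ⟨_, Runs.seq hK r1 Runs.load, a1.setReg le_rfl, by simp [v1, a1.2, hs.2]⟩

theorem cond (hK : 8 ≤ K) {c a b : RamExpr} {w u : ℕ} (hc : Ev W K l s c w)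
    (ha : w ≠ 0 → Ev W K l s a u) (hb : w = 0 → Ev W K l s b u) : Ev W K l s (cond c a b) u := by
  intro l' s' hl hs
  obtain ⟨s1, r1, a1, v1⟩ := hc l' s' hl hs
  by_cases hw : w = 0
  · obtain ⟨s2, r2, a2, v2⟩ := hb hw l' s1 hl (hs.trans hl a1)
    exact ⟨s2, Runs.seq hK r1 (Runs.ite hK (by simpa [v1, hw] using r2)),
      a1.trans le_rfl a2, v2⟩
  · obtain ⟨s2, r2, a2, v2⟩ := ha hw l' s1 hl (hs.trans hl a1)
    exact ⟨s2, Runs.seq hK r1 (Runs.ite hK (by simpa [v1, hw] using r2)),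
      a1.trans le_rfl a2, v2⟩

/-- The value of a bounded iteration: `F i` is the value of the accumulator after `i` rounds. -/
theorem fold (hK : 8 ≤ K) (hKW : K ≤ W) {init bnd : RamExpr} {f : ℕ → ℕ → RamExpr} {b : ℕ}
    (F : ℕ → ℕ) (h0 : Ev W K l s init (F 0)) (hb : Ev W K l s bnd b) (hbK : b ≤ K)
    (hf : ∀ i < b, ∀ x s', l ≤ x → Agree l s s' → s'.reg x = F i → s'.reg (x + 1) = i →
      Ev W K (x + 2) s' (f x (x + 1)) (F (i + 1))) :
    Ev W K l s (fold init bnd f) (F b) := by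
  intro l' s' hl hs
  obtain ⟨s1, r1, a1, v1⟩ := h0 l' s' hl hs
  have r2 : Runs W K (.const (l' + 1) 0) s1 (s1.setReg (l' + 1) 0) := Runs.const (Nat.zero_le _)
  have a2 : Agree l' s' (s1.setReg (l' + 1) 0) := a1.setReg (Nat.le_succ _)
  obtain ⟨s3, r3, a3, v3⟩ := hb (l' + 2) _ (by omega) (hs.trans hl a2)
  obtain ⟨s4, r4, i4⟩ := Runs.loop (W := W) hK (x := l' + 2) (J := b)
    (p := .seq (f l' (l' + 1) (l' + 3)) <| .seq (.const (l' + 4) 0) <|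
      .seq (.sub l' (l' + 3) (l' + 4)) <| .seq (.const (l' + 4) 1) <|
      .seq (.add (l' + 1) (l' + 1) (l' + 4)) (.sub (l' + 2) (l' + 2) (l' + 4))) hbK
    (fun i σ => Agree l' s' σ ∧ σ.reg l' = F i ∧ σ.reg (l' + 1) = i ∧ σ.reg (l' + 2) = b - i)
    (by
      rintro i hi σ ⟨hA, h1, h2, h3⟩
      refine ⟨by omega, ?_⟩
      obtain ⟨τ, rτ, aτ, vτ⟩ := hf i hi l' σ hl (hs.trans hl hA) h1 h2 (l' + 3) σ (by omega)
        (Agree.refl _ _)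
      have e2 := aτ.1 (l' + 1) (by omega)
      have e3 := aτ.1 (l' + 2) (by omega)
      refine ⟨_, Runs.seq hK rτ (Runs.seq hK (Runs.const (Nat.zero_le _)) (Runs.seq hK Runs.sub
        (Runs.seq hK (Runs.const (by omega)) (Runs.seq hK (Runs.add ?_) Runs.sub)))), ?_, ?_⟩
      · simp [e2, h2]; omega
      · exact (((((hA.trans (by omega) aτ).setReg (by omega)).setReg (by omega)).setReg
          (by omega)).setReg (by omega)).setReg (by omega)
      · simp [e2, e3, h2, h3, vτ]; omega)
    (by rintro σ ⟨-, -, -, h⟩; simpa using h)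
    (s := s3) ⟨a2.trans (by omega) a3, by
      rw [a3.1 _ (by omega)]; simp [v1], by rw [a3.1 _ (by omega)]; simp, by simpa using v3⟩
  exact ⟨s4, Runs.seq hK r1 (Runs.seq hK r2 (Runs.seq hK r3 r4)), i4.1, i4.2.1⟩

end Ev

/-! ### Derived expressions -/

/-- The truth value as a number. -/
noncomputable def truth (P : Prop) : ℕ := open Classical in if P then 1 else 0

theorem truth_of {P : Prop} (h : P) : truth P = 1 := if_pos h

theorem truth_of_not {P : Prop} (h : ¬ P) : truth P = 0 := if_neg h

theorem truth_congr {P Q : Prop} (h : P ↔ Q) : truth P = truth Q := by rw [propext h]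

theorem truth_ne_zero {P : Prop} : truth P ≠ 0 ↔ P := by
  by_cases h : P <;> simp [truth, h]

theorem truth_eq_zero {P : Prop} : truth P = 0 ↔ ¬ P := by
  by_cases h : P <;> simp [truth, h]

namespace RamExpr

/-- Conjunction, evaluated lazily, so that `b` needs a value only if `a` holds. -/
def conj (a b : RamExpr) : RamExpr := cond a b (cst 0)

/-- Disjunction. -/
def disj (a b : RamExpr) : RamExpr := cond a (cst 1) b

/-- Negation. -/
def neg (a : RamExpr) : RamExpr := cond a (cst 0) (cst 1)

/-- The truth value of `a = b`. -/
def eqE (a b : RamExpr) : RamExpr :=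
  cond (minus a b) (cst 0) (cond (minus b a) (cst 0) (cst 1))

/-- The truth value of `a < b`. -/
def ltE (a b : RamExpr) : RamExpr := cond (minus b a) (cst 1) (cst 0)

/-- The maximum, as `a + (b - a)`. -/
def maxE (a b : RamExpr) : RamExpr := plus a (minus b a)

/-- Bounded existential quantifier. -/
def ex (bnd : RamExpr) (f : ℕ → RamExpr) : RamExpr :=
  fold (cst 0) bnd fun acc i => cond (f i) (cst 1) (var acc)

/-- Bounded universal quantifier. -/
def all (bnd : RamExpr) (f : ℕ → RamExpr) : RamExpr := neg (ex bnd fun i => neg (f i))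

/-- The number of indices below a bound with a given property. -/
def countE (bnd : RamExpr) (f : ℕ → RamExpr) : RamExpr :=
  fold (cst 0) bnd fun acc i => cond (f i) (plus (var acc) (cst 1)) (var acc)

/-- The largest value of an expression over the indices below a bound. -/
def supE (bnd : RamExpr) (f : ℕ → RamExpr) : RamExpr :=
  fold (cst 0) bnd fun acc i => maxE (var acc) (f i)

/-- The product, as a repeated addition. -/
def mulE (a b : RamExpr) : RamExpr := fold (cst 0) a fun acc _ => plus (var acc) b

/-- The power `a ^ b`. -/
def powE (a b : RamExpr) : RamExpr := fold (cst 1) b fun acc _ => mulE a (var acc)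

/-- The quotient: the number of indices `i < a` with `(i + 1) * b ≤ a`. -/
def divE (a b : RamExpr) : RamExpr :=
  countE a fun i => neg (ltE a (mulE (plus (var i) (cst 1)) b))

/-- The remainder. -/
def modE (a b : RamExpr) : RamExpr := minus a (mulE (divE a b) b)

/-- The digit of `a` with index `i` in base `b`. -/
def digE (a b i : RamExpr) : RamExpr := modE (fold a i fun acc _ => divE (var acc) b) b

end RamExpr

namespace Ev

variable {W K l : ℕ} {s : RamState}

theorem conj (hK : 8 ≤ K) {a b : RamExpr} {P Q : Prop} (ha : Ev W K l s a (truth P))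
    (hb : P → Ev W K l s b (truth Q)) : Ev W K l s (conj a b) (truth (P ∧ Q)) := by
  refine cond hK ha (fun h => ?_) (fun h => ?_)
  · rw [truth_ne_zero] at h
    simpa [h] using hb h
  · rw [truth_eq_zero] at h
    simpa [h, truth] using cst (Nat.zero_le W)

theorem disj (hK : 8 ≤ K) (hKW : K ≤ W) {a b : RamExpr} {P Q : Prop}
    (ha : Ev W K l s a (truth P)) (hb : Ev W K l s b (truth Q)) :
    Ev W K l s (disj a b) (truth (P ∨ Q)) := by
  refine cond hK ha (fun h => ?_) (fun h => ?_)
  · rw [truth_ne_zero] at h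
    simpa [h, truth] using cst (show 1 ≤ W by omega)
  · rw [truth_eq_zero] at h
    simpa [h] using hb

theorem neg (hK : 8 ≤ K) (hKW : K ≤ W) {a : RamExpr} {P : Prop} (ha : Ev W K l s a (truth P)) :
    Ev W K l s (neg a) (truth (¬ P)) := by
  refine cond hK ha (fun h => ?_) (fun h => ?_)
  · rw [truth_ne_zero] at h
    simpa [h, truth] using cst (Nat.zero_le W)
  · rw [truth_eq_zero] at h
    simpa [h, truth] using cst (show 1 ≤ W by omega)

theorem eqE (hK : 8 ≤ K) (hKW : K ≤ W) {a b : RamExpr} {u v : ℕ} (ha : Ev W K l s a u)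
    (hb : Ev W K l s b v) : Ev W K l s (eqE a b) (truth (u = v)) := by
  refine cond hK (minus hK ha hb) (fun h => ?_) (fun h => cond hK (minus hK hb ha) (fun h' => ?_)
    (fun h' => ?_))
  · rw [truth_of_not (by omega)]; exact cst (Nat.zero_le W)
  · rw [truth_of_not (by omega)]; exact cst (Nat.zero_le W)
  · rw [truth_of (by omega)]; exact cst (by omega)

theorem ltE (hK : 8 ≤ K) (hKW : K ≤ W) {a b : RamExpr} {u v : ℕ} (ha : Ev W K l s a u)
    (hb : Ev W K l s b v) : Ev W K l s (ltE a b) (truth (u < v)) := by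
  refine cond hK (minus hK hb ha) (fun h => ?_) (fun h => ?_)
  · rw [truth_of (by omega)]; exact cst (by omega)
  · rw [truth_of_not (by omega)]; exact cst (Nat.zero_le W)

theorem maxE (hK : 8 ≤ K) {a b : RamExpr} {u v : ℕ} (ha : Ev W K l s a u)
    (hb : Ev W K l s b v) (hu : u ≤ W) (hv : v ≤ W) : Ev W K l s (maxE a b) (max u v) := by
  have := plus hK ha (minus hK hb ha) (by omega)
  rwa [show u + (v - u) = max u v by omega] at this

theorem ex (hK : 8 ≤ K) (hKW : K ≤ W) {bnd : RamExpr} {f : ℕ → RamExpr} {b : ℕ} {P : ℕ → Prop}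
    (hb : Ev W K l s bnd b) (hbK : b ≤ K)
    (hf : ∀ i < b, ∀ x s', l ≤ x → Agree l s s' → s'.reg x = i →
      Ev W K (x + 1) s' (f x) (truth (P i))) :
    Ev W K l s (ex bnd f) (truth (∃ i < b, P i)) := by
  refine fold hK hKW (fun j => truth (∃ i < j, P i)) ?_ hb hbK ?_
  · rw [truth_of_not (by simp)]; exact cst (Nat.zero_le W)
  · intro i hi x s' hx hs h1 h2
    refine cond hK (hf i hi (x + 1) s' (by omega) hs h2) (fun h => ?_) (fun h => ?_)
    · rw [truth_ne_zero] at h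
      rw [truth_of ⟨i, by omega, h⟩]
      exact cst (by omega)
    · rw [truth_eq_zero] at h
      refine var hK (by omega) (h1.trans (truth_congr ?_))
      constructor
      · rintro ⟨j, hj, hp⟩
        exact ⟨j, by omega, hp⟩
      · rintro ⟨j, hj, hp⟩
        rcases Nat.lt_succ_iff_lt_or_eq.1 hj with hj | rfl
        · exact ⟨j, hj, hp⟩
        · exact absurd hp h

theorem all (hK : 8 ≤ K) (hKW : K ≤ W) {bnd : RamExpr} {f : ℕ → RamExpr} {b : ℕ}
    {P : ℕ → Prop} (hb : Ev W K l s bnd b) (hbK : b ≤ K)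
    (hf : ∀ i < b, ∀ x s', l ≤ x → Agree l s s' → s'.reg x = i →
      Ev W K (x + 1) s' (f x) (truth (P i))) :
    Ev W K l s (all bnd f) (truth (∀ i < b, P i)) := by
  have := neg hK hKW (ex hK hKW (P := fun i => ¬ P i) hb hbK
    fun i hi x s' hx hs h => neg hK hKW (hf i hi x s' hx hs h))
  rwa [truth_congr (show (¬ ∃ i < b, ¬ P i) ↔ ∀ i < b, P i by push Not; rfl)] at this

theorem countE (hK : 8 ≤ K) (hKW : K ≤ W) {bnd : RamExpr} {f : ℕ → RamExpr} {b : ℕ}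
    {P : ℕ → Prop} [DecidablePred P] (hb : Ev W K l s bnd b) (hbK : b ≤ K)
    (hf : ∀ i < b, ∀ x s', l ≤ x → Agree l s s' → s'.reg x = i →
      Ev W K (x + 1) s' (f x) (truth (P i))) :
    Ev W K l s (countE bnd f) (Nat.count P b) := by
  refine fold hK hKW (Nat.count P) ?_ hb hbK ?_
  · simpa using cst (Nat.zero_le W)
  · intro i hi x s' hx hs h1 h2
    have hle := Nat.count_le (p := P) (n := i)
    rw [Nat.count_succ]
    refine cond hK (hf i hi (x + 1) s' (by omega) hs h2) (fun h => ?_) (fun h => ?_)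
    · rw [truth_ne_zero] at h
      rw [if_pos h]
      exact plus hK (var hK (by omega) h1) (cst (by omega)) (by omega)
    · rw [truth_eq_zero] at h
      rw [if_neg h]
      exact var hK (by omega) h1

theorem supE (hK : 8 ≤ K) (hKW : K ≤ W) {bnd : RamExpr} {f : ℕ → RamExpr} {b : ℕ}
    {F : ℕ → ℕ} (hb : Ev W K l s bnd b) (hbK : b ≤ K) (hF : ∀ i < b, F i ≤ W)
    (hf : ∀ i < b, ∀ x s', l ≤ x → Agree l s s' → s'.reg x = i →
      Ev W K (x + 1) s' (f x) (F i)) :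
    Ev W K l s (supE bnd f) ((Finset.range b).sup F) := by
  refine fold hK hKW (fun j => (Finset.range j).sup F) ?_ hb hbK ?_
  · simpa using cst (Nat.zero_le W)
  · intro i hi x s' hx hs h1 h2
    rw [Finset.range_add_one, Finset.sup_insert, sup_comm]
    exact maxE hK (var hK (by omega) h1) (hf i hi (x + 1) s' (by omega) hs h2)
      (Finset.sup_le fun j hj => hF j ((Finset.mem_range.1 hj).trans hi)) (hF i hi)

theorem mulE (hK : 8 ≤ K) (hKW : K ≤ W) {a b : RamExpr} {u v : ℕ} (ha : Ev W K l s a u)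
    (hb : Ev W K l s b v) (hu : u ≤ K) (huv : u * v ≤ W) :
    Ev W K l s (mulE a b) (u * v) := by
  refine fold hK hKW (fun i => i * v) ?_ ha hu ?_
  · simpa using cst (Nat.zero_le W)
  · intro i hi x s' hx hs h1 h2
    have : (i + 1) * v ≤ u * v := Nat.mul_le_mul_right _ hi
    have := plus hK (var hK (by omega) h1) (hb.mono (show l ≤ x + 2 by omega) hs)
      (by rw [add_mul] at this; omega)
    rwa [show i * v + v = (i + 1) * v by ring] at this

theorem powE (hK : 8 ≤ K) (hKW : K ≤ W) {a b : RamExpr} {u v : ℕ} (ha : Ev W K l s a u)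
    (hb : Ev W K l s b v) (hu0 : 0 < u) (hu : u ≤ K) (hv : v ≤ K) (huv : u ^ v ≤ W) :
    Ev W K l s (powE a b) (u ^ v) := by
  refine fold hK hKW (fun i => u ^ i) ?_ hb hv ?_
  · simpa using cst (show 1 ≤ W by omega)
  · intro i hi x s' hx hs h1 h2
    have h3 : u ^ (i + 1) ≤ u ^ v := Nat.pow_le_pow_right hu0 hi
    rw [pow_succ']
    exact mulE hK hKW (ha.mono (by omega) hs) (var hK (by omega) h1) hu
      (by rw [← pow_succ']; exact h3.trans huv)

theorem count_succ_mul_le (a b : ℕ) (hb : 0 < b) :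
    Nat.count (fun i => ¬ a < (i + 1) * b) a = a / b := by
  have key : ∀ j, Nat.count (fun i => ¬ a < (i + 1) * b) j = min j (a / b) := by
    intro j
    induction j with
    | zero => simp
    | succ j ih =>
      have h := Nat.le_div_iff_mul_le (x := j + 1) (y := a) hb
      rw [Nat.count_succ, ih]
      split_ifs with h'
      · rw [← not_le, ← h] at h'
        omega
      · rw [not_lt, ← h] at h'
        omega
  rw [key, min_eq_right (Nat.div_le_self a b)]

theorem divE (hK : 8 ≤ K) (hKW : K * K ≤ W) {a b : RamExpr} {u v : ℕ} (ha : Ev W K l s a u)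
    (hb : Ev W K l s b v) (hu : u ≤ K) (hv0 : 0 < v) (hv : v ≤ K) :
    Ev W K l s (divE a b) (u / v) := by
  have hKW' : K ≤ W := by nlinarith
  rw [← count_succ_mul_le u v hv0]
  refine countE hK hKW' ha hu fun i hi x s' hx hs h =>
    neg hK hKW' (ltE hK hKW' (ha.mono (by omega) hs) ?_)
  exact mulE hK hKW' (plus hK (var hK (by omega) h) (cst (by omega)) (by omega))
    (hb.mono (by omega) hs) (by omega)
    ((Nat.mul_le_mul (show i + 1 ≤ K by omega) hv).trans hKW)

theorem modE (hK : 8 ≤ K) (hKW : K * K ≤ W) {a b : RamExpr} {u v : ℕ} (ha : Ev W K l s a u)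
    (hb : Ev W K l s b v) (hu : u ≤ K) (hv0 : 0 < v) (hv : v ≤ K) :
    Ev W K l s (modE a b) (u % v) := by
  have hKW' : K ≤ W := by nlinarith
  have h1 := Nat.div_mul_le_self u v
  have h2 := Nat.div_le_self u v
  have := minus hK ha (mulE hK hKW' (divE hK hKW ha hb hu hv0 hv) hb (by omega) (by omega))
  rwa [show u - u / v * v = u % v by have := Nat.div_add_mod' u v; omega] at this

theorem digE (hK : 8 ≤ K) (hKW : K * K ≤ W) {a b i : RamExpr} {u v j : ℕ}
    (ha : Ev W K l s a u) (hb : Ev W K l s b v) (hi : Ev W K l s i j) (hu : u ≤ K) (hv0 : 0 < v)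
    (hv : v ≤ K) (hj : j ≤ K) :
    Ev W K l s (digE a b i) (u / v ^ j % v) := by
  have hKW' : K ≤ W := by nlinarith
  refine modE hK hKW ?_ hb ((Nat.div_le_self _ _).trans hu) hv0 hv
  refine fold hK hKW' (fun i => u / v ^ i) (by simpa using ha) hi hj ?_
  intro i hi x s' hx hs h1 h2
  rw [pow_succ, ← Nat.div_div_eq_div_mul]
  exact divE hK hKW (var hK (by omega) h1) (hb.mono (by omega) hs)
    ((Nat.div_le_self _ _).trans hu) hv0 hv

end Ev

/-! ### The dynamic program on state codes -/

/-- The numbers that describe an instance: `n` vertices, `m` edges `(eu e, ev e)`, `d` demands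
`((du j, dv j), dt j)`, and the bounds `k` and `h`. -/
structure Tables where
  (n m d k h : ℕ)
  (eu ev du dv dt : ℕ → ℕ)

namespace Tables

variable (T : Tables)

/-- The number of slots, each of which carries at most one walk at a time. -/
def slots : ℕ := 4 * T.n

/-- The base in which states are written. -/
def base : ℕ := T.n + T.d + 1

/-- The number of state codes; a state has two digits for every slot.  The digits with indices
below `slots` are the positions, and the others are the starting demands. -/
def codes : ℕ := T.base ^ (2 * T.slots)

/-- The vertex at which a slot is. -/
def pos (s i : ℕ) : ℕ := s / T.base ^ i % T.base

/-- The demand with which the walk in a slot started: `0` if there has been no walk yet, and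
`j + 1` for the demand with index `j`. -/
def idx (s i : ℕ) : ℕ := s / T.base ^ (T.slots + i) % T.base

/-- In the transition from `s` to `s'`, slot `i` either keeps its walk, which waits or traverses
an edge, or it starts a new walk with a demand at time `t`. -/
def SlotOK (t s s' i : ℕ) : Prop :=
  (T.idx s i = T.idx s' i ∧ (T.pos s i = T.pos s' i ∨
    ∃ e < T.m, T.eu e = T.pos s i ∧ T.ev e = T.pos s' i)) ∨
  (¬ T.idx s i = T.idx s' i ∧ ∃ j < T.d, T.idx s' i = j + 1 ∧ T.dt j = t ∧ T.dv j = T.pos s' i)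

/-- In the transition from `s` to `s'`, slot `i` goes from `x` to `y`. -/
def Uses (s s' i x y : ℕ) : Prop :=
  ((T.idx s i = T.idx s' i ∧ T.pos s i = x) ∨
    (¬ T.idx s i = T.idx s' i ∧ ∃ j < T.d, T.idx s' i = j + 1 ∧ T.du j = x)) ∧ T.pos s' i = y

/-- The walk that started with the demand coded by `a` may traverse an edge at time `t` without
exceeding the lifespan `h`. -/
def Alive (t a : ℕ) : Prop := ∃ j < T.d, a = j + 1 ∧ t < T.dt j + T.h

/-- The transition from `s` to `s'` is allowed at time `t`. -/
def StepOK (t s s' : ℕ) : Prop :=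
  (∀ i < T.slots, T.SlotOK t s s' i) ∧
  (∀ e < T.m, ∀ i < T.slots, ∀ i' < T.slots, T.Uses s s' i (T.eu e) (T.ev e) →
    T.Uses s s' i' (T.eu e) (T.ev e) → i = i') ∧
  (∀ j < T.d, T.dt j = t → ∃ i < T.slots, T.Uses s s' i (T.du j) (T.dv j) ∧
    T.Alive t (T.idx s' i))

open Classical in
/-- The number of walks started in a transition. -/
noncomputable def starts (s s' : ℕ) : ℕ := Nat.count (fun i => ¬ T.idx s i = T.idx s' i) T.slots

open Classical in
/-- One round of the dynamic program at time `t`.  A value `v + 1` means that the state can be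
reached with `v` walks still available; the value `0` means that it cannot be reached. -/
noncomputable def next (t : ℕ) (val : ℕ → ℕ) (s' : ℕ) : ℕ :=
  (Finset.range T.codes).sup fun s => if T.StepOK t s s' then val s - T.starts s s' else 0

/-- The first time of a demand after time `t`, among the first `j` demands; `0` if there is
none. -/
def firstAfter (t : ℕ) : ℕ → ℕ
  | 0 => 0
  | j + 1 => if t < T.dt j then
      (if firstAfter t j ≠ 0 then min (firstAfter t j) (T.dt j) else T.dt j) else firstAfter t j

theorem firstAfter_spec (t j : ℕ) :
    (T.firstAfter t j = 0 ∧ ∀ i < j, T.dt i ≤ t) ∨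
    (t < T.firstAfter t j ∧ (∃ i < j, T.dt i = T.firstAfter t j) ∧
      ∀ i < j, t < T.dt i → T.firstAfter t j ≤ T.dt i) := by
  induction j with
  | zero => simp [firstAfter]
  | succ j ih =>
    rw [firstAfter]
    by_cases h : t < T.dt j
    · rw [if_pos h]
      right
      by_cases h0 : T.firstAfter t j = 0
      · rw [if_neg (by simpa using h0)]
        refine ⟨h, ⟨j, by omega, rfl⟩, fun i hi hti => ?_⟩
        rcases ih with ⟨-, h2⟩ | ⟨h1, -⟩
        · rcases Nat.lt_succ_iff_lt_or_eq.1 hi with hi | rfl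
          · have := h2 i hi; omega
          · rfl
        · omega
      · rw [if_pos h0]
        rcases ih with ⟨h1, -⟩ | ⟨h1, ⟨i, hi, hi'⟩, h3⟩
        · exact absurd h1 h0
        refine ⟨by omega, ?_, fun i hi hti => ?_⟩
        · rcases le_total (T.firstAfter t j) (T.dt j) with hle | hle
          · exact ⟨i, by omega, by rw [min_eq_left hle, hi']⟩
          · exact ⟨j, by omega, by rw [min_eq_right hle]⟩
        · rcases Nat.lt_succ_iff_lt_or_eq.1 hi with hi | rfl
          · have := h3 i hi hti; omega
          · omega
    · rw [if_neg h]
      rcases ih with ⟨h1, h2⟩ | ⟨h1, ⟨i, hi, hi'⟩, h3⟩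
      · refine Or.inl ⟨h1, fun i hi => ?_⟩
        rcases Nat.lt_succ_iff_lt_or_eq.1 hi with hi | rfl
        · exact h2 i hi
        · omega
      · refine Or.inr ⟨h1, ⟨i, by omega, hi'⟩, fun i hi hti => ?_⟩
        rcases Nat.lt_succ_iff_lt_or_eq.1 hi with hi | rfl
        · exact h3 i hi hti
        · omega

/-- The first address behind the input. -/
def free : ℕ := 5 + 2 * T.m + 3 * T.d

/-- The memory starts with the input. -/
structure Stored (s : RamState) : Prop where
  n : s.mem 0 = T.n
  m : s.mem 1 = T.m
  d : s.mem 2 = T.d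
  k : s.mem 3 = T.k
  h : s.mem 4 = T.h
  eu : ∀ e < T.m, s.mem (5 + (e + e)) = T.eu e
  ev : ∀ e < T.m, s.mem (6 + (e + e)) = T.ev e
  du : ∀ j < T.d, s.mem (5 + (T.m + T.m) + (j + (j + j))) = T.du j
  dv : ∀ j < T.d, s.mem (6 + (T.m + T.m) + (j + (j + j))) = T.dv j
  dt : ∀ j < T.d, s.mem (7 + (T.m + T.m) + (j + (j + j))) = T.dt j

variable {T}

theorem Stored.agree {s s' : RamState} {l : ℕ} (h : T.Stored s) (hs : Agree l s s') :
    T.Stored s' := by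
  have := hs.2
  constructor <;> rw [this]
  exacts [h.n, h.m, h.d, h.k, h.h, h.eu, h.ev, h.du, h.dv, h.dt]

end Tables

/-! The expressions `nE`, `mE`, …, `firstAfterE` evaluate the entries of the input and the functions
of `Tables` of the same names. -/

namespace RamExpr

/-- The number of vertices, in the first cell of the input. -/
def nE : RamExpr := ld (cst 0)
/-- The number of edges. -/
def mE : RamExpr := ld (cst 1)
/-- The number of demands. -/
def dE : RamExpr := ld (cst 2)
/-- The bound on the number of walks. -/
def kE : RamExpr := ld (cst 3)
/-- The bound on the lifespan. -/
def hE : RamExpr := ld (cst 4)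
/-- The source of an edge; the edges start at address `5` and take two cells each. -/
def euE (e : RamExpr) : RamExpr := ld (plus (cst 5) (plus e e))
/-- The target of an edge. -/
def evE (e : RamExpr) : RamExpr := ld (plus (cst 6) (plus e e))
/-- The source of a demand; the demands follow the `m` edges and take three cells each. -/
def duE (j : RamExpr) : RamExpr := ld (plus (plus (cst 5) (plus mE mE)) (plus j (plus j j)))
/-- The target of a demand. -/
def dvE (j : RamExpr) : RamExpr := ld (plus (plus (cst 6) (plus mE mE)) (plus j (plus j j)))
/-- The time of a demand. -/
def dtE (j : RamExpr) : RamExpr := ld (plus (plus (cst 7) (plus mE mE)) (plus j (plus j j)))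
/-- `Tables.free`. -/
def freeE : RamExpr := plus (plus (cst 5) (plus mE mE)) (plus dE (plus dE dE))
/-- `Tables.base`. -/
def baseE : RamExpr := plus (plus nE dE) (cst 1)
/-- `Tables.slots`. -/
def slotsE : RamExpr := plus (plus nE nE) (plus nE nE)
/-- `Tables.codes`. -/
def codesE : RamExpr := powE baseE (plus slotsE slotsE)
/-- `Tables.pos`. -/
def posE (s i : RamExpr) : RamExpr := digE s baseE i
/-- `Tables.idx`. -/
def idxE (s i : RamExpr) : RamExpr := digE s baseE (plus slotsE i)

/-- `Tables.SlotOK`. -/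
def slotOKE (t s s' i : RamExpr) : RamExpr :=
  disj (conj (eqE (idxE s i) (idxE s' i)) (disj (eqE (posE s i) (posE s' i))
      (ex mE fun e => conj (eqE (euE (var e)) (posE s i)) (eqE (evE (var e)) (posE s' i)))))
    (conj (neg (eqE (idxE s i) (idxE s' i))) (ex dE fun j =>
      conj (eqE (idxE s' i) (plus (var j) (cst 1)))
        (conj (eqE (dtE (var j)) t) (eqE (dvE (var j)) (posE s' i)))))

/-- `Tables.Uses`. -/
def usesE (s s' i x y : RamExpr) : RamExpr :=
  conj (disj (conj (eqE (idxE s i) (idxE s' i)) (eqE (posE s i) x))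
    (conj (neg (eqE (idxE s i) (idxE s' i))) (ex dE fun j =>
      conj (eqE (idxE s' i) (plus (var j) (cst 1))) (eqE (duE (var j)) x)))) (eqE (posE s' i) y)

/-- `Tables.Alive`. -/
def aliveE (t a : RamExpr) : RamExpr :=
  ex dE fun j => conj (eqE a (plus (var j) (cst 1))) (ltE t (plus (dtE (var j)) hE))

/-- `Tables.StepOK`. -/
def stepOKE (t s s' : RamExpr) : RamExpr :=
  conj (all slotsE fun i => slotOKE t s s' (var i))
    (conj (all mE fun e => all slotsE fun i => all slotsE fun i' =>
        disj (neg (usesE s s' (var i) (euE (var e)) (evE (var e))))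
          (disj (neg (usesE s s' (var i') (euE (var e)) (evE (var e)))) (eqE (var i) (var i'))))
      (all dE fun j => disj (neg (eqE (dtE (var j)) t)) (ex slotsE fun i =>
        conj (usesE s s' (var i) (duE (var j)) (dvE (var j))) (aliveE t (idxE s' (var i))))))

/-- `Tables.starts`. -/
def startsE (s s' : RamExpr) : RamExpr :=
  countE slotsE fun i => neg (eqE (idxE s (var i)) (idxE s' (var i)))

/-- `Tables.next`, for the table stored from the address `table` on.  The number of codes is an
argument because it is computed only once. -/
def nextE (codes table t s' : RamExpr) : RamExpr :=
  supE codes fun s => cond (stepOKE t (var s) s')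
    (minus (ld (plus table (var s))) (startsE (var s) s')) (cst 0)

/-- `Tables.firstAfter` for all demands; the minimum of `a` and `b` is `a - (a - b)`. -/
def firstAfterE (t : RamExpr) : RamExpr :=
  fold (cst 0) dE fun acc j => cond (ltE t (dtE (var j)))
    (cond (var acc) (minus (var acc) (minus (var acc) (dtE (var j)))) (dtE (var j))) (var acc)

end RamExpr

/-- Bounds on the numbers of an instance, in terms of the largest word `W` and of a bound `K` on
all numbers but times. -/
structure Tables.Bounded (T : Tables) (W K : ℕ) : Prop where
  hK : 8 ≤ K
  hKW : K * K ≤ W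
  hfree : T.free + 10 ≤ K
  hslots : 2 * T.slots ≤ K
  hcodes : T.codes ≤ K
  hbase : T.base ≤ K
  hdt : ∀ j < T.d, T.dt j + T.h + 1 ≤ W
  hk : T.k + 1 ≤ W

namespace Ev

variable {W K l : ℕ} {s : RamState} {T : Tables}

theorem nE (hB : T.Bounded W K) (hs : T.Stored s) : Ev W K l s nE T.n :=
  hs.n ▸ ld hB.hK (cst (Nat.zero_le W))

theorem mE (hB : T.Bounded W K) (hs : T.Stored s) : Ev W K l s mE T.m :=
  hs.m ▸ ld hB.hK (cst (by have := hB.hK; have := hB.hKW; nlinarith))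

theorem dE (hB : T.Bounded W K) (hs : T.Stored s) : Ev W K l s dE T.d :=
  hs.d ▸ ld hB.hK (cst (by have := hB.hK; have := hB.hKW; nlinarith))

theorem kE (hB : T.Bounded W K) (hs : T.Stored s) : Ev W K l s kE T.k :=
  hs.k ▸ ld hB.hK (cst (by have := hB.hK; have := hB.hKW; nlinarith))

theorem hE (hB : T.Bounded W K) (hs : T.Stored s) : Ev W K l s hE T.h :=
  hs.h ▸ ld hB.hK (cst (by have := hB.hK; have := hB.hKW; nlinarith))

theorem _root_.Tables.Bounded.le (hB : T.Bounded W K) : K + K ≤ W := by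
  have := hB.hK; have := hB.hKW; nlinarith

theorem euE (hB : T.Bounded W K) (hs : T.Stored s) {e : RamExpr} {v : ℕ} (he : Ev W K l s e v)
    (hv : v < T.m) : Ev W K l s (euE e) (T.eu v) := by
  have := hB.le; have hf := hB.hfree; simp only [Tables.free] at hf
  exact hs.eu v hv ▸ ld hB.hK
    (plus hB.hK (cst (by omega)) (plus hB.hK he he (by omega)) (by omega))

theorem evE (hB : T.Bounded W K) (hs : T.Stored s) {e : RamExpr} {v : ℕ} (he : Ev W K l s e v)
    (hv : v < T.m) : Ev W K l s (evE e) (T.ev v) := by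
  have := hB.le; have hf := hB.hfree; simp only [Tables.free] at hf
  exact hs.ev v hv ▸ ld hB.hK
    (plus hB.hK (cst (by omega)) (plus hB.hK he he (by omega)) (by omega))

theorem demandAddr (hB : T.Bounded W K) (hs : T.Stored s) {j : RamExpr} {v a : ℕ}
    (hj : Ev W K l s j v) (hv : v ≤ T.d) (ha : a ≤ 7) :
    Ev W K l s (RamExpr.plus (RamExpr.plus (RamExpr.cst a) (RamExpr.plus RamExpr.mE RamExpr.mE))
      (RamExpr.plus j (RamExpr.plus j j))) (a + (T.m + T.m) + (v + (v + v))) := by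
  have := hB.le; have hf := hB.hfree; simp only [Tables.free] at hf
  have hm := mE (l := l) hB hs
  exact plus hB.hK (plus hB.hK (cst (by omega)) (plus hB.hK hm hm (by omega)) (by omega))
    (plus hB.hK hj (plus hB.hK hj hj (by omega)) (by omega)) (by omega)

theorem duE (hB : T.Bounded W K) (hs : T.Stored s) {j : RamExpr} {v : ℕ} (hj : Ev W K l s j v)
    (hv : v < T.d) : Ev W K l s (duE j) (T.du v) :=
  hs.du v hv ▸ ld hB.hK (demandAddr hB hs hj hv.le (by omega))

theorem dvE (hB : T.Bounded W K) (hs : T.Stored s) {j : RamExpr} {v : ℕ} (hj : Ev W K l s j v)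
    (hv : v < T.d) : Ev W K l s (dvE j) (T.dv v) :=
  hs.dv v hv ▸ ld hB.hK (demandAddr hB hs hj hv.le (by omega))

theorem dtE (hB : T.Bounded W K) (hs : T.Stored s) {j : RamExpr} {v : ℕ} (hj : Ev W K l s j v)
    (hv : v < T.d) : Ev W K l s (dtE j) (T.dt v) :=
  hs.dt v hv ▸ ld hB.hK (demandAddr hB hs hj hv.le (by omega))

theorem freeE (hB : T.Bounded W K) (hs : T.Stored s) : Ev W K l s freeE T.free := by
  have := demandAddr (l := l) hB hs (dE hB hs) le_rfl (show 5 ≤ 7 by omega)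
  rwa [show 5 + (T.m + T.m) + (T.d + (T.d + T.d)) = T.free by simp only [Tables.free]; ring] at this

theorem baseE (hB : T.Bounded W K) (hs : T.Stored s) : Ev W K l s baseE T.base := by
  have := hB.le; have hf := hB.hbase; simp only [Tables.base] at hf
  exact plus hB.hK (plus hB.hK (nE hB hs) (dE hB hs) (by omega)) (cst (by omega)) (by omega)

theorem slotsE (hB : T.Bounded W K) (hs : T.Stored s) : Ev W K l s slotsE T.slots := by
  have := hB.le; have hf := hB.hslots; simp only [Tables.slots] at hf
  have hn := nE (l := l) hB hs
  have := plus hB.hK (plus hB.hK hn hn (by omega)) (plus hB.hK hn hn (by omega)) (by omega)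
  rwa [show T.n + T.n + (T.n + T.n) = T.slots by simp only [Tables.slots]; ring] at this

theorem codesE (hB : T.Bounded W K) (hs : T.Stored s) : Ev W K l s codesE T.codes := by
  have := hB.le; have hf := hB.hslots; have hc := hB.hcodes
  rw [Tables.codes] at hc
  have := powE hB.hK (by omega) (baseE (l := l) hB hs)
    (plus hB.hK (slotsE hB hs) (slotsE hB hs) (by omega)) (by simp [Tables.base]) hB.hbase
    (by omega) (by rw [← two_mul]; omega)
  rwa [← two_mul] at this

theorem posE (hB : T.Bounded W K) (hs : T.Stored s) {a i : RamExpr} {u j : ℕ}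
    (ha : Ev W K l s a u) (hi : Ev W K l s i j) (hu : u < T.codes) (hj : j < T.slots) :
    Ev W K l s (posE a i) (T.pos u j) :=
  digE hB.hK hB.hKW ha (baseE hB hs) hi (hu.le.trans hB.hcodes) (by simp [Tables.base]) hB.hbase
    (by have := hB.hslots; omega)

theorem idxE (hB : T.Bounded W K) (hs : T.Stored s) {a i : RamExpr} {u j : ℕ}
    (ha : Ev W K l s a u) (hi : Ev W K l s i j) (hu : u < T.codes) (hj : j < T.slots) :
    Ev W K l s (idxE a i) (T.idx u j) := by
  have := hB.le; have := hB.hslots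
  exact digE hB.hK hB.hKW ha (baseE hB hs) (plus hB.hK (slotsE hB hs) hi (by omega))
    (hu.le.trans hB.hcodes) (by simp [Tables.base]) hB.hbase (by omega)

theorem slotOKE (hB : T.Bounded W K) (hs : T.Stored s) {a b c i : RamExpr} {t u v j : ℕ}
    (hc : Ev W K l s c t) (ha : Ev W K l s a u) (hb : Ev W K l s b v) (hi : Ev W K l s i j)
    (hu : u < T.codes) (hv : v < T.codes) (hj : j < T.slots) :
    Ev W K l s (slotOKE c a b i) (truth (T.SlotOK t u v j)) := by
  have hK := hB.hK
  have h2 := hB.le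
  have hW : K ≤ W := by omega
  have hf := hB.hfree; simp only [Tables.free] at hf
  have e1 := idxE hB hs ha hi hu hj
  have e2 := idxE hB hs hb hi hv hj
  have e3 := posE hB hs ha hi hu hj
  have e4 := posE hB hs hb hi hv hj
  refine disj hK hW (conj hK (eqE hK hW e1 e2) fun _ => disj hK hW (eqE hK hW e3 e4)
    (ex hK hW (mE hB hs) (by omega) fun e he x s' hx hs' h => ?_))
    (conj hK (neg hK hW (eqE hK hW e1 e2)) fun _ =>
      ex hK hW (dE hB hs) (by omega) fun e he x s' hx hs' h => ?_)
  · have e5 := var (W := W) hK (Nat.lt_succ_self x) h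
    exact conj hK (eqE hK hW (euE hB (hs.agree hs') e5 he) (e3.mono (by omega) hs'))
      fun _ => (eqE hK hW (evE hB (hs.agree hs') e5 he) (e4.mono (by omega) hs'))
  · have e5 := var (W := W) hK (Nat.lt_succ_self x) h
    exact conj hK (eqE hK hW (e2.mono (by omega) hs') (plus hK e5 (cst (by omega)) (by omega)))
      fun _ => conj hK (eqE hK hW (dtE hB (hs.agree hs') e5 he) (hc.mono (by omega) hs'))
      fun _ => (eqE hK hW (dvE hB (hs.agree hs') e5 he) (e4.mono (by omega) hs'))

theorem usesE (hB : T.Bounded W K) (hs : T.Stored s) {a b i x y : RamExpr} {u v j p q : ℕ}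
    (ha : Ev W K l s a u) (hb : Ev W K l s b v) (hi : Ev W K l s i j)
    (hp : Ev W K l s x p) (hq : Ev W K l s y q)
    (hu : u < T.codes) (hv : v < T.codes) (hj : j < T.slots) :
    Ev W K l s (usesE a b i x y) (truth (T.Uses u v j p q)) := by
  have hK := hB.hK
  have h2 := hB.le
  have hW : K ≤ W := by omega
  have hf := hB.hfree; simp only [Tables.free] at hf
  have e1 := idxE hB hs ha hi hu hj
  have e2 := idxE hB hs hb hi hv hj
  have e3 := posE hB hs ha hi hu hj
  have e4 := posE hB hs hb hi hv hj
  refine conj hK (disj hK hW (conj hK (eqE hK hW e1 e2) fun _ => eqE hK hW e3 hp)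
    (conj hK (neg hK hW (eqE hK hW e1 e2)) fun _ =>
      ex hK hW (dE hB hs) (by omega) fun e he x s' hx hs' h => ?_)) fun _ => eqE hK hW e4 hq
  have e5 := var (W := W) hK (Nat.lt_succ_self x) h
  exact conj hK (eqE hK hW (e2.mono (by omega) hs') (plus hK e5 (cst (by omega)) (by omega)))
    fun _ => (eqE hK hW (duE hB (hs.agree hs') e5 he) (hp.mono (by omega) hs'))

theorem aliveE (hB : T.Bounded W K) (hs : T.Stored s) {c a : RamExpr} {t u : ℕ}
    (hc : Ev W K l s c t) (ha : Ev W K l s a u) :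
    Ev W K l s (aliveE c a) (truth (T.Alive t u)) := by
  have hK := hB.hK
  have h2 := hB.le
  have hW : K ≤ W := by omega
  have hf := hB.hfree; simp only [Tables.free] at hf
  refine ex hK hW (dE hB hs) (by omega) fun e he x s' hx hs' h => ?_
  have e5 := var (W := W) hK (Nat.lt_succ_self x) h
  have hd := hB.hdt e he
  exact conj hK (eqE hK hW (ha.mono (by omega) hs') (plus hK e5 (cst (by omega)) (by omega)))
    fun _ => ltE hK hW (hc.mono (by omega) hs') (plus hK (dtE hB (hs.agree hs') e5 he)
      (hE hB (hs.agree hs')) (by omega))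

theorem stepOKE (hB : T.Bounded W K) (hs : T.Stored s) {c a b : RamExpr} {t u v : ℕ}
    (hc : Ev W K l s c t) (ha : Ev W K l s a u) (hb : Ev W K l s b v)
    (hu : u < T.codes) (hv : v < T.codes) :
    Ev W K l s (stepOKE c a b) (truth (T.StepOK t u v)) := by
  have hK := hB.hK
  have h2 := hB.le
  have hW : K ≤ W := by omega
  have hf := hB.hfree; simp only [Tables.free] at hf
  have hsl := hB.hslots
  refine conj hK (all hK hW (slotsE hB hs) (by omega) fun i hi x s' hx hs' h => ?_) fun _ =>
    conj hK (all hK hW (mE hB hs) (by omega) fun e he x s' hx hs' h => ?_) fun _ =>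
    all hK hW (dE hB hs) (by omega) fun j hj x s' hx hs' h => ?_
  · exact slotOKE hB (hs.agree hs') (hc.mono (by omega) hs') (ha.mono (by omega) hs')
      (hb.mono (by omega) hs') (var hK (Nat.lt_succ_self x) h) hu hv hi
  · refine all hK hW (slotsE hB (hs.agree hs')) (by omega) fun i hi y s₂ hy hs₂ h' =>
      all hK hW (slotsE hB ((hs.agree hs').agree hs₂)) (by omega) fun i' hi' z s₃ hz hs₃ h'' => ?_
    have a3 := hs'.trans (by omega) (hs₂.trans (by omega) hs₃)
    have hS := hs.agree a3
    have ea := ha.mono (show l ≤ z + 1 by omega) a3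
    have eb := hb.mono (show l ≤ z + 1 by omega) a3
    have ee := ((var (W := W) hK (Nat.lt_succ_self x) h).mono (show x + 1 ≤ z + 1 by omega)
      (hs₂.trans (by omega) hs₃))
    have ei := ((var (W := W) hK (Nat.lt_succ_self y) h').mono (show y + 1 ≤ z + 1 by omega) hs₃)
    have ei' := var (W := W) hK (Nat.lt_succ_self z) h''
    rw [truth_congr (show (T.Uses u v i (T.eu e) (T.ev e) → T.Uses u v i' (T.eu e) (T.ev e) →
      i = i') ↔ (¬ T.Uses u v i (T.eu e) (T.ev e) ∨ (¬ T.Uses u v i' (T.eu e) (T.ev e) ∨ i = i'))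
      by tauto)]
    exact disj hK hW (neg hK hW (usesE hB hS ea eb ei (euE hB hS ee he) (evE hB hS ee he)
      hu hv hi)) (disj hK hW (neg hK hW (usesE hB hS ea eb ei' (euE hB hS ee he)
      (evE hB hS ee he) hu hv hi')) (eqE hK hW ei ei'))
  · have ej := var (W := W) hK (Nat.lt_succ_self x) h
    rw [truth_congr (imp_iff_not_or)]
    refine disj hK hW (neg hK hW (eqE hK hW (dtE hB (hs.agree hs') ej hj)
      (hc.mono (by omega) hs'))) (ex hK hW (slotsE hB (hs.agree hs')) (by omega)
      fun i hi y s₂ hy hs₂ h' => ?_)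
    have a3 := hs'.trans (by omega) hs₂
    have hS := hs.agree a3
    have ea := ha.mono (show l ≤ y + 1 by omega) a3
    have eb := hb.mono (show l ≤ y + 1 by omega) a3
    have ej' := ej.mono (show x + 1 ≤ y + 1 by omega) hs₂
    have ei := var (W := W) hK (Nat.lt_succ_self y) h'
    exact conj hK (usesE hB hS ea eb ei (duE hB hS ej' hj) (dvE hB hS ej' hj) hu hv hi)
      fun _ => aliveE hB hS (hc.mono (by omega) a3) (idxE hB hS eb ei hv hi)

theorem startsE (hB : T.Bounded W K) (hs : T.Stored s) {a b : RamExpr} {u v : ℕ}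
    (ha : Ev W K l s a u) (hb : Ev W K l s b v) (hu : u < T.codes) (hv : v < T.codes) :
    Ev W K l s (startsE a b) (T.starts u v) := by
  have hK := hB.hK
  have h2 := hB.le
  have hW : K ≤ W := by omega
  have hsl := hB.hslots
  refine countE hK hW (slotsE hB hs) (by omega) fun i hi x s' hx hs' h => ?_
  have ei := var (W := W) hK (Nat.lt_succ_self x) h
  exact neg hK hW (eqE hK hW (idxE hB (hs.agree hs') (ha.mono (by omega) hs') ei hu hi)
    (idxE hB (hs.agree hs') (hb.mono (by omega) hs') ei hv hi))

theorem nextE (hB : T.Bounded W K) (hs : T.Stored s) {c a g t' : RamExpr} {t v p : ℕ}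
    (hg : Ev W K l s g T.codes) (ha : Ev W K l s a p) (hc : Ev W K l s c t)
    (hb : Ev W K l s t' v) (hv : v < T.codes) (hp : p + T.codes ≤ W) {val : ℕ → ℕ}
    (hval : ∀ u < T.codes, s.mem (p + u) = val u) (hval' : ∀ u < T.codes, val u ≤ W) :
    Ev W K l s (nextE g a c t') (T.next t val v) := by
  have hK := hB.hK
  have h2 := hB.le
  have hW : K ≤ W := by omega
  refine supE hK hW hg hB.hcodes (fun u hu => ?_) fun u hu x s' hx hs' h => ?_
  · split_ifs
    · exact (Nat.sub_le _ _).trans (hval' u hu)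
    · exact Nat.zero_le _
  have eu := var (W := W) hK (Nat.lt_succ_self x) h
  have hS := hs.agree hs'
  have eb := hb.mono (show l ≤ x + 1 by omega) hs'
  refine cond hK (stepOKE hB hS (hc.mono (by omega) hs') eu eb hu hv) (fun h' => ?_) (fun h' => ?_)
  · rw [if_pos (truth_ne_zero.1 h'), ← hval u hu, ← hs'.2]
    exact minus hK (ld hK (plus hK (ha.mono (by omega) hs') eu (by omega)))
      (startsE hB hS eu eb hu hv)
  · rw [if_neg (truth_eq_zero.1 h')]
    exact cst (Nat.zero_le _)

theorem firstAfterE (hB : T.Bounded W K) (hs : T.Stored s) {c : RamExpr} {t : ℕ}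
    (hc : Ev W K l s c t) : Ev W K l s (firstAfterE c) (T.firstAfter t T.d) := by
  have hK := hB.hK
  have h2 := hB.le
  have hW : K ≤ W := by omega
  have hf := hB.hfree; simp only [Tables.free] at hf
  refine fold hK hW (T.firstAfter t) (cst (Nat.zero_le _)) (dE hB hs) (by omega)
    fun j hj x s' hx hs' h h' => ?_
  have ej := dtE hB (hs.agree hs') (var (W := W) hK (Nat.lt_succ_self (x + 1)) h') hj
  have eacc := var (W := W) hK (show x < x + 2 by omega) h
  rw [Tables.firstAfter]
  refine cond hK (ltE hK hW (hc.mono (by omega) hs') ej) (fun h1 => ?_) (fun h1 => ?_)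
  · rw [if_pos (truth_ne_zero.1 h1)]
    refine cond hK eacc (fun h3 => ?_) (fun h3 => ?_)
    · rw [if_pos h3]
      have := minus hK eacc (minus hK eacc ej)
      rwa [show ∀ a b : ℕ, a - (a - b) = min a b by intros; omega] at this
    · rwa [if_neg (not_not.2 h3)]
  · rwa [if_neg (truth_eq_zero.1 h1)]

end Ev

/-! ### The program -/

namespace RamProg

/-- `x := e`.  Statements evaluate expressions in the registers from `8` on, so the registers below
`8` hold the variables of the program. -/
def assign (x : ℕ) (e : RamExpr) : RamProg := .seq (e 8) (.seq (.const 9 0) (.sub x 8 9))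

/-- `mem[a] := v`. -/
def storeAt (a v : RamExpr) : RamProg := .seq (a 8) (.seq (v 9) (.store 8 9))

/-- Run `p` for all values of register `3` below the value of register `1`. -/
def forCodes (p : RamProg) : RamProg :=
  .seq (.const 3 0) <| .seq (assign 6 (var 1)) <| .loop 6 <|
    .seq p <| .seq (.const 8 1) <| .seq (.add 3 3 8) (.sub 6 6 8)

/-- One round of the dynamic program.  Register `1` holds the number of state codes, register `2`
the time, register `4` the address of the table, and register `5` the next time of a demand.  The
new table is written behind the old one. -/
def round : RamProg :=
  .seq (assign 2 (maxE (plus (var 2) (cst 1)) (minus (var 5) (plus slotsE slotsE)))) <|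
  .seq (forCodes (storeAt (plus (plus (var 4) (var 1)) (var 3))
    (nextE (var 1) (var 4) (var 2) (var 3)))) <|
  .seq (assign 4 (plus (var 4) (var 1))) (assign 5 (firstAfterE (var 2)))

/-- The decision program: in the initial table, the code `0` has the value `k + 1`.  The memory
behind the input is zero, so no other value has to be written. -/
def decision : RamProg :=
  .seq (assign 1 codesE) <| .seq (assign 4 freeE) <|
  .seq (storeAt (var 4) (plus kE (cst 1))) <| .seq (assign 5 (firstAfterE (var 2))) <|
  .seq (.loop 5 round) <|
  assign 0 (ex (var 1) fun s => ltE (cst 0) (ld (plus (var 4) (var s))))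

end RamProg

section Statements

variable {W K : ℕ} {s : RamState}

theorem Runs.assign (hK : 8 ≤ K) {x v : ℕ} {e : RamExpr} (he : Ev W K 8 s e v) :
    ∃ s', Runs W K (assign x e) s s' ∧ s'.mem = s.mem ∧
      ∀ r < 8, s'.reg r = if r = x then v else s.reg r := by
  obtain ⟨s1, r1, a1, v1⟩ := he 8 s le_rfl (Agree.refl _ _)
  refine ⟨_, Runs.seq hK r1 (Runs.seq hK (Runs.const (Nat.zero_le _)) Runs.sub), a1.2, ?_⟩
  intro r hr
  have h9 : r ≠ 9 := by omega
  simp [v1, h9, a1.1 r hr]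

theorem Runs.storeAt (hK : 8 ≤ K) {a b : RamExpr} {p q : ℕ} (ha : Ev W K 8 s a p)
    (hb : Ev W K 8 s b q) :
    ∃ s', Runs W K (storeAt a b) s s' ∧ (∀ i, s'.mem i = if i = p then q else s.mem i) ∧
      ∀ r < 8, s'.reg r = s.reg r := by
  obtain ⟨s1, r1, a1, v1⟩ := ha 8 s le_rfl (Agree.refl _ _)
  obtain ⟨s2, r2, a2, v2⟩ := hb 9 s1 (by omega) a1
  have e : s2.reg 8 = p := (a2.1 8 (by omega)).trans v1
  refine ⟨_, Runs.seq hK r1 (Runs.seq hK r2 Runs.store), ?_, ?_⟩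
  · intro i
    simp [e, v2, a2.2, a1.2]
  · intro r hr
    simp [a2.1 r (by omega), a1.1 r hr]

theorem Runs.forCodes (hK : 8 ≤ K) (hKW : K ≤ W) {p : RamProg} {N : ℕ} (hN : N ≤ K)
    (h1 : s.reg 1 = N) (Inv : ℕ → RamState → Prop)
    (hInv : ∀ i s s', Inv i s → s'.mem = s.mem →
      (∀ r < 8, r ≠ 3 → r ≠ 6 → s'.reg r = s.reg r) → Inv i s')
    (hp : ∀ i < N, ∀ s, Inv i s → s.reg 3 = i →
      ∃ s', Runs W K p s s' ∧ Inv (i + 1) s' ∧ s'.reg 3 = s.reg 3 ∧ s'.reg 6 = s.reg 6)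
    (h0 : Inv 0 s) :
    ∃ s', Runs W K (forCodes p) s s' ∧ Inv N s' := by
  have r1 : Runs W K (.const 3 0) s (s.setReg 3 0) := Runs.const (Nat.zero_le _)
  obtain ⟨s2, r2, m2, v2⟩ := Runs.assign (x := 6) (s := s.setReg 3 0) hK
    (Ev.var (W := W) hK (x := 1) (v := N) (by omega) (by simp [h1]))
  obtain ⟨s3, r3, i3⟩ := Runs.loop (W := W) hK (x := 6) (J := N)
    (p := .seq p <| .seq (.const 8 1) <| .seq (.add 3 3 8) (.sub 6 6 8)) hN
    (fun i s => Inv i s ∧ s.reg 3 = i ∧ s.reg 6 = N - i)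
    (by
      rintro i hi σ ⟨hI, h3, h6⟩
      obtain ⟨τ, rτ, hτ, e3, e6⟩ := hp i hi σ hI h3
      refine ⟨by omega, _, Runs.seq hK rτ (Runs.seq hK (Runs.const (by omega)) (Runs.seq hK
        (Runs.add ?_) Runs.sub)), hInv _ _ _ hτ rfl ?_, ?_, ?_⟩
      · simp [e3, h3]; omega
      · intro r hr hr3 hr6
        have : r ≠ 8 := by omega
        simp [hr3, hr6, this]
      · simp [e3, h3]
      · simp [e6, h6]; omega)
    (by rintro σ ⟨-, -, h⟩; simpa using h)
    (s := s2) ⟨hInv _ _ _ h0 m2 (fun r hr hr3 hr6 => by rw [v2 r hr]; simp [hr3, hr6]),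
      by rw [v2 3 (by omega)]; simp, by rw [v2 6 (by omega)]; simp⟩
  exact ⟨s3, Runs.seq hK r1 (Runs.seq hK r2 r3), i3.1⟩

end Statements

namespace Tables

variable (T : Tables)

/-- The time of the dynamic program after `i` rounds. -/
def time : ℕ → ℕ
  | 0 => 0
  | i + 1 => max (time i + 1) (T.firstAfter (time i) T.d - (T.slots + T.slots))

/-- The table of the dynamic program after `i` rounds.  At the beginning, the state with code `0` is
the only one: all slots are at vertex `0`, and there are no walks. -/
noncomputable def table : ℕ → ℕ → ℕ
  | 0 => fun u => if u = 0 then T.k + 1 else 0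
  | i + 1 => T.next (T.time (i + 1)) (table i)

variable {T}

theorem table_le (i u : ℕ) : T.table i u ≤ T.k + 1 := by
  induction i generalizing u with
  | zero => simp only [table]; split_ifs <;> omega
  | succ i ih =>
    rw [table, next]
    refine Finset.sup_le fun v _ => ?_
    split_ifs
    · exact (Nat.sub_le _ _).trans (ih v)
    · exact Nat.zero_le _

theorem le_time_of_firstAfter_ne_zero {t : ℕ} (h : T.firstAfter t T.d ≠ 0) :
    t < T.firstAfter t T.d ∧ ∃ j < T.d, T.dt j = T.firstAfter t T.d := by
  rcases T.firstAfter_spec t T.d with h' | h'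
  · exact absurd h'.1 h
  · exact ⟨h'.1, h'.2.1⟩

/-- The state of the machine after `i` rounds. -/
structure Snapshot (T : Tables) (i : ℕ) (s : RamState) : Prop where
  stored : T.Stored s
  r1 : s.reg 1 = T.codes
  r2 : s.reg 2 = T.time i
  r4 : s.reg 4 = T.free + i * T.codes
  r5 : s.reg 5 = T.firstAfter (T.time i) T.d
  tab : ∀ u < T.codes, s.mem (T.free + i * T.codes + u) = T.table i u

theorem Stored.of_mem {s s' : RamState} (h : T.Stored s)
    (hs : ∀ i < T.free, s'.mem i = s.mem i) : T.Stored s' := by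
  simp only [free] at hs
  constructor
  · rw [hs _ (by omega), h.n]
  · rw [hs _ (by omega), h.m]
  · rw [hs _ (by omega), h.d]
  · rw [hs _ (by omega), h.k]
  · rw [hs _ (by omega), h.h]
  · intro e he; rw [hs _ (by omega), h.eu e he]
  · intro e he; rw [hs _ (by omega), h.ev e he]
  · intro j hj; rw [hs _ (by omega), h.du j hj]
  · intro j hj; rw [hs _ (by omega), h.dv j hj]
  · intro j hj; rw [hs _ (by omega), h.dt j hj]

theorem Snapshot.round {W K : ℕ} (hB : T.Bounded W K) {i : ℕ} (hi : i + 3 ≤ K) {s : RamState}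
    (h : T.Snapshot i s) (hne : T.firstAfter (T.time i) T.d ≠ 0) :
    ∃ s', Runs W K round s s' ∧ T.Snapshot (i + 1) s' := by
  have hK := hB.hK
  have h2 := hB.le
  have hW : K ≤ W := by omega
  have hsl := hB.hslots
  have hcK := hB.hcodes
  have hfK := hB.hfree
  obtain ⟨ht, j, hj, hjt⟩ := le_time_of_firstAfter_ne_zero hne
  have hdj := hB.hdt j hj
  have haddr : T.free + (i + 2) * T.codes ≤ W := by
    have h3 : (i + 2) * T.codes ≤ (K - 1) * K := Nat.mul_le_mul (by omega) hcK
    have h4 : (K - 1) * K + K = K * K := by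
      rw [Nat.sub_mul, one_mul]; exact Nat.sub_add_cancel (Nat.le_mul_self K)
    have := hB.hKW
    omega
  have e1 : (i + 1) * T.codes = i * T.codes + T.codes := by ring
  have e2 : (i + 2) * T.codes = i * T.codes + T.codes + T.codes := by ring
  obtain ⟨s1, r1, m1, v1⟩ := Runs.assign (s := s) (x := 2) hK (Ev.maxE (W := W) hK
    (Ev.plus hK (Ev.var hK (by omega) h.r2) (Ev.cst (a := 1) (by omega)) (by omega))
    (Ev.minus hK (Ev.var hK (by omega) h.r5) (Ev.plus hK (Ev.slotsE hB h.stored)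
      (Ev.slotsE hB h.stored) (by omega))) (by omega) (by omega))
  change ∀ r < 8, s1.reg r = if r = 2 then T.time (i + 1) else s.reg r at v1
  obtain ⟨s2, r2, hst, a1, a2, a4, a5, a6⟩ := Runs.forCodes (W := W) (s := s1) hK hW hcK
    (p := RamProg.storeAt (RamExpr.plus (RamExpr.plus (RamExpr.var 4) (RamExpr.var 1))
        (RamExpr.var 3))
      (RamExpr.nextE (RamExpr.var 1) (RamExpr.var 4) (RamExpr.var 2) (RamExpr.var 3)))
    (by rw [v1 1 (by omega)]; simp [h.r1])
    (fun i' σ => T.Stored σ ∧ σ.reg 1 = T.codes ∧ σ.reg 2 = T.time (i + 1) ∧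
      σ.reg 4 = T.free + i * T.codes ∧
      (∀ u < T.codes, σ.mem (T.free + i * T.codes + u) = T.table i u) ∧
      (∀ u < i', σ.mem (T.free + i * T.codes + T.codes + u) = T.table (i + 1) u))
    (by
      rintro i' σ σ' ⟨b0, b1, b2, b4, b5, b6⟩ hm hr
      refine ⟨b0.of_mem fun a _ => by rw [hm], ?_, ?_, ?_, ?_, ?_⟩
      · rw [hr 1 (by omega) (by omega) (by omega), b1]
      · rw [hr 2 (by omega) (by omega) (by omega), b2]
      · rw [hr 4 (by omega) (by omega) (by omega), b4]
      · rw [hm]; exact b5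
      · rw [hm]; exact b6)
    (by
      rintro i' hi' σ ⟨b0, b1, b2, b4, b5, b6⟩ b3
      have x1 := Ev.var (W := W) hK (show 1 < 8 by omega) b1
      have x2 := Ev.var (W := W) hK (show 2 < 8 by omega) b2
      have x3 := Ev.var (W := W) hK (show 3 < 8 by omega) b3
      have x4 := Ev.var (W := W) hK (show 4 < 8 by omega) b4
      obtain ⟨σ', rσ, mσ, vσ⟩ := Runs.storeAt (s := σ) hK
        (Ev.plus hK (Ev.plus hK x4 x1 (by omega)) x3 (by omega))
        (Ev.nextE hB b0 x1 x4 x2 x3 hi' (by omega) b5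
          (fun u _ => (table_le i u).trans hB.hk))
      refine ⟨σ', rσ, ⟨b0.of_mem fun a ha => ?_, ?_, ?_, ?_, ?_, ?_⟩, vσ _ (by omega),
        vσ _ (by omega)⟩
      · rw [mσ, if_neg (by omega)]
      · rw [vσ _ (by omega), b1]
      · rw [vσ _ (by omega), b2]
      · rw [vσ _ (by omega), b4]
      · intro u hu
        rw [mσ, if_neg (by omega), b5 u hu]
      · intro u hu
        rw [mσ]
        rcases Nat.lt_succ_iff_lt_or_eq.1 hu with hu | rfl
        · rw [if_neg (by omega), b6 u hu]
        · rw [if_pos rfl, table])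
    ⟨h.stored.of_mem fun a _ => by rw [m1], by rw [v1 1 (by omega)]; simp [h.r1],
      by rw [v1 2 (by omega)]; simp, by rw [v1 4 (by omega)]; simp [h.r4],
      by rw [m1]; exact h.tab, by simp⟩
  obtain ⟨s3, r3, m3, v3⟩ := Runs.assign (s := s2) (x := 4) hK (Ev.plus (W := W) hK
    (Ev.var hK (by omega) a4) (Ev.var hK (by omega) a1) (by omega))
  have hst3 : T.Stored s3 := hst.of_mem fun a _ => by rw [m3]
  obtain ⟨s4, r4, m4, v4⟩ := Runs.assign (s := s3) (x := 5) hK (Ev.firstAfterE (W := W) hB hst3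
    (Ev.var (x := 2) (v := T.time (i + 1)) hK (by omega)
      (by rw [v3 2 (by omega)]; simp [a2])))
  refine ⟨s4, Runs.seq hK r1 (Runs.seq hK r2 (Runs.seq hK r3 r4)), ?_⟩
  constructor
  · exact hst3.of_mem fun a _ => by rw [m4]
  · rw [v4 _ (by omega), v3 _ (by omega)]; simp [a1]
  · rw [v4 _ (by omega), v3 _ (by omega)]; simp [a2]
  · rw [v4 _ (by omega), v3 _ (by omega)]; simp; omega
  · rw [v4 _ (by omega)]; simp
  · intro u hu
    rw [m4, m3, e1, ← add_assoc]
    exact a6 u hu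

theorem runs_decision {W K : ℕ} (hB : T.Bounded W K) {J : ℕ} (hJ : J + 3 ≤ K)
    (hlt : ∀ i < J, T.firstAfter (T.time i) T.d ≠ 0) (hJ0 : T.firstAfter (T.time J) T.d = 0)
    {s : RamState} (hs : T.Stored s) (hreg : ∀ r, s.reg r = 0)
    (hmem : ∀ i, T.free ≤ i → s.mem i = 0) :
    ∃ s', Runs W K decision s s' ∧ s'.reg 0 = truth (∃ u < T.codes, 0 < T.table J u) := by
  have hK := hB.hK
  have h2 := hB.le
  have hW : K ≤ W := by omega
  have hcK := hB.hcodes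
  have hfK := hB.hfree
  have hk := hB.hk
  obtain ⟨s1, r1, m1, v1⟩ := Runs.assign (s := s) (x := 1) hK (Ev.codesE hB hs)
  have hs1 : T.Stored s1 := hs.of_mem fun a _ => by rw [m1]
  obtain ⟨s2, r2, m2, v2⟩ := Runs.assign (s := s1) (x := 4) hK (Ev.freeE hB hs1)
  have hs2 : T.Stored s2 := hs1.of_mem fun a _ => by rw [m2]
  obtain ⟨s3, r3, m3, v3⟩ := Runs.storeAt (s := s2) hK
    (Ev.var (W := W) (x := 4) (v := T.free) hK (by omega) (by rw [v2 _ (by omega)]; simp))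
    (Ev.plus hK (Ev.kE hB hs2) (Ev.cst (by omega)) hk)
  have hs3 : T.Stored s3 := hs2.of_mem fun a ha => by rw [m3, if_neg (by omega)]
  have e2 : s3.reg 2 = T.time 0 := by
    rw [v3 _ (by omega), v2 _ (by omega), v1 _ (by omega)]; simp [hreg, time]
  obtain ⟨s4, r4, m4, v4⟩ := Runs.assign (s := s3) (x := 5) hK
    (Ev.firstAfterE hB hs3 (Ev.var (W := W) hK (show 2 < 8 by omega) e2))
  have snap : T.Snapshot 0 s4 := by
    constructor
    · exact hs3.of_mem fun a _ => by rw [m4]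
    · rw [v4 _ (by omega), v3 _ (by omega), v2 _ (by omega), v1 _ (by omega)]; simp
    · rw [v4 _ (by omega)]; simp [e2]
    · rw [v4 _ (by omega), v3 _ (by omega), v2 _ (by omega)]; simp
    · rw [v4 _ (by omega)]; simp
    · intro u hu
      rw [m4, m3, zero_mul, add_zero]
      simp only [table]
      by_cases hu0 : u = 0
      · simp [hu0]
      · rw [if_neg (by omega), if_neg hu0, m2, m1, hmem _ (by omega)]
  obtain ⟨s5, r5, h5⟩ := Runs.loop (W := W) hK (x := 5) (J := J) (p := round) (by omega)
    (fun i σ => T.Snapshot i σ)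
    (fun i hi σ hσ => ⟨by rw [hσ.r5]; exact hlt i hi, hσ.round hB (by omega) (hlt i hi)⟩)
    (fun σ hσ => hσ.r5.trans hJ0) snap
  have haddr : T.free + (J + 1) * T.codes ≤ W := by
    have h3 : (J + 1) * T.codes ≤ (K - 1) * K := Nat.mul_le_mul (by omega) hcK
    have h4 : (K - 1) * K + K = K * K := by
      rw [Nat.sub_mul, one_mul]; exact Nat.sub_add_cancel (Nat.le_mul_self K)
    have := hB.hKW
    omega
  have e1 : (J + 1) * T.codes = J * T.codes + T.codes := by ring
  obtain ⟨s6, r6, m6, v6⟩ := Runs.assign (s := s5) (x := 0) hK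
    (Ev.ex (W := W) hK hW (f := fun s => RamExpr.ltE (RamExpr.cst 0)
      (RamExpr.ld (RamExpr.plus (RamExpr.var 4) (RamExpr.var s))))
      (P := fun u => 0 < T.table J u)
      (Ev.var hK (show 1 < 8 by omega) h5.r1) hcK (fun u hu x s' hx hs' h => by
        have := Ev.ltE (s := s') (l := x + 1) hK hW (Ev.cst (Nat.zero_le W)) (Ev.ld hK (Ev.plus hK
          ((Ev.var (W := W) hK (show 4 < 8 by omega) h5.r4).mono (by omega) hs')
          (Ev.var hK (Nat.lt_succ_self x) h) (by omega)))
        rwa [hs'.2, h5.tab u hu] at this))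
  refine ⟨s6, Runs.seq hK r1 (Runs.seq hK r2 (Runs.seq hK r3 (Runs.seq hK r4
    (Runs.seq hK r5 r6)))), ?_⟩
  rw [v6 _ (by omega), if_pos rfl]

/-! ### The table and the runs of the dynamic program -/

/-- The times at which walks may move: `2 * slots` steps suffice for an arbitrary rearrangement
of the walks before the next demand. -/
def Relevant (T : Tables) (t : ℕ) : Prop :=
  ∃ j < T.d, T.dt j - (T.slots + T.slots) ≤ t ∧ t ≤ T.dt j

/-- The state `s` can be reached with the transitions at relevant times up to `t` and with `w`
new walks. -/
def Reach (T : Tables) : ℕ → ℕ → ℕ → Prop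
  | 0, s, w => s = 0 ∧ w = 0
  | t + 1, s', w =>
    (T.Relevant (t + 1) ∧ ∃ s w', s < T.codes ∧ T.Reach t s w' ∧ T.StepOK (t + 1) s s' ∧
      w = w' + T.starts s s') ∨ (¬ T.Relevant (t + 1) ∧ T.Reach t s' w)

theorem reach_iff_of_not_relevant {t t' s w : ℕ} (htt : t ≤ t')
    (h : ∀ x, t < x → x ≤ t' → ¬ T.Relevant x) : T.Reach t' s w ↔ T.Reach t s w := by
  induction t', htt using Nat.le_induction with
  | base => rfl
  | succ t' htt ih =>
    rw [Reach, ← ih fun x hx hx' => h x hx (by omega)]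
    have := h (t' + 1) (by omega) le_rfl
    tauto

theorem time_succ_spec {i : ℕ} (hne : T.firstAfter (T.time i) T.d ≠ 0) :
    T.time i < T.time (i + 1) ∧ T.Relevant (T.time (i + 1)) ∧
      ∀ x, T.time i < x → x < T.time (i + 1) → ¬ T.Relevant x := by
  rcases T.firstAfter_spec (T.time i) T.d with ⟨h, -⟩ | ⟨h1, ⟨j, hj, hjt⟩, h3⟩
  · exact absurd h hne
  rw [time]
  refine ⟨by omega, ⟨j, hj, by omega, by omega⟩, ?_⟩
  rintro x hx hx' ⟨j', hj', ha, hb⟩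
  have := h3 j' hj' (by omega)
  omega

/-- The meaning of the table: a value above `v` means that at least `v` of the `k` walks are
left. -/
theorem lt_table_iff {i : ℕ} (hlt : ∀ i' < i, T.firstAfter (T.time i') T.d ≠ 0) {u : ℕ}
    (v : ℕ) : v < T.table i u ↔ ∃ w, T.Reach (T.time i) u w ∧ w + v ≤ T.k := by
  induction i generalizing u v with
  | zero =>
    simp only [table, time, Reach]
    by_cases hu : u = 0 <;> simp [hu]
  | succ i ih =>
    obtain ⟨h1, h2, h3⟩ := time_succ_spec (hlt i (by omega))
    obtain ⟨t', ht'⟩ : ∃ t', T.time (i + 1) = t' + 1 := ⟨T.time (i + 1) - 1, by omega⟩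
    have hR : ∀ s w, T.Reach t' s w ↔ T.Reach (T.time i) s w := fun s w =>
      reach_iff_of_not_relevant (by omega) fun x hx hx' => h3 x hx (by omega)
    simp only [table, next, Finset.lt_sup_iff, ht', Reach]
    rw [ht'] at h2
    constructor
    · rintro ⟨s, hs, hv⟩
      split_ifs at hv with hst
      · obtain ⟨w, hw, hwk⟩ :=
          (ih (fun i' hi' => hlt i' (by omega)) (u := s) (v + T.starts s u)).1 (by omega)
        exact ⟨w + T.starts s u,
          Or.inl ⟨h2, s, w, Finset.mem_range.1 hs, (hR s w).2 hw, ht' ▸ hst, rfl⟩,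
          by omega⟩
      · omega
    · rintro ⟨w, ⟨-, s, w', hs, hw', hst, rfl⟩ | ⟨h, -⟩, hwk⟩
      · refine ⟨s, Finset.mem_range.2 hs, ?_⟩
        rw [ht', if_pos hst]
        have := (ih (fun i' hi' => hlt i' (by omega)) (u := s) (v + T.starts s u)).2
          ⟨w', (hR s w').1 hw', by omega⟩
        omega
      · exact absurd h2 h

/-- The dynamic program ends after a polynomial number of rounds, because it visits only relevant
times. -/
theorem exists_rounds (T : Tables) : ∃ J ≤ T.d * (2 * T.slots + 1),
    (∀ i < J, T.firstAfter (T.time i) T.d ≠ 0) ∧ T.firstAfter (T.time J) T.d = 0 := by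
  classical
  have hex : ∃ J ≤ T.d * (2 * T.slots + 1), T.firstAfter (T.time J) T.d = 0 := by
    by_contra! hne
    set B := T.d * (2 * T.slots + 1) with hB
    have hmono : StrictMonoOn T.time (Set.Iic (B + 1)) :=
      strictMonoOn_of_lt_succ Set.ordConnected_Iic fun a _ _ ha' =>
        (time_succ_spec (hne a (by simpa using ha'))).1
    have hinj : Set.InjOn T.time (Finset.Icc 1 (B + 1)) := fun a ha b hb h =>
      hmono.injOn (by simp at ha ⊢; omega) (by simp at hb ⊢; omega) h
    have hsub : (Finset.Icc 1 (B + 1)).image T.time ⊆ (Finset.range T.d).biUnion fun j =>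
        Finset.Icc (T.dt j - (T.slots + T.slots)) (T.dt j) := by
      intro x hx
      obtain ⟨a, ha, rfl⟩ := Finset.mem_image.1 hx
      obtain ⟨ha1, ha2⟩ := Finset.mem_Icc.1 ha
      obtain ⟨c, rfl⟩ : ∃ c, a = c + 1 := ⟨a - 1, by omega⟩
      obtain ⟨j, hj, hj'⟩ := (time_succ_spec (hne c (by omega))).2.1
      exact Finset.mem_biUnion.2 ⟨j, Finset.mem_range.2 hj, Finset.mem_Icc.2 hj'⟩
    have h1 := Finset.card_le_card hsub
    rw [Finset.card_image_of_injOn hinj, Nat.card_Icc] at h1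
    have h2 := Finset.card_biUnion_le_card_mul (Finset.range T.d)
      (fun j => Finset.Icc (T.dt j - (T.slots + T.slots)) (T.dt j)) (2 * T.slots + 1)
      (fun j _ => by rw [Nat.card_Icc]; omega)
    rw [Finset.card_range] at h2
    omega
  have hex' : ∃ J, T.firstAfter (T.time J) T.d = 0 := let ⟨J, _, h⟩ := hex; ⟨J, h⟩
  obtain ⟨J, hJ, hJ0⟩ := hex
  exact ⟨Nat.find hex', (Nat.find_min' hex' hJ0).trans hJ, fun i hi => Nat.find_min hex' hi,
    Nat.find_spec hex'⟩

/-- The program computes whether some state can be reached, at the time `L` of the last demand,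
with at most `k` walks. -/
theorem runs_decision_reach {W K L : ℕ} (hB : T.Bounded W K)
    (hrounds : T.d * (2 * T.slots + 1) + 3 ≤ K) (hL : ∀ j < T.d, T.dt j ≤ L)
    (hL' : ∃ j < T.d, T.dt j = L) {s : RamState} (hs : T.Stored s) (hreg : ∀ r, s.reg r = 0)
    (hmem : ∀ i, T.free ≤ i → s.mem i = 0) :
    ∃ s', Runs W K decision s s' ∧
      s'.reg 0 = truth (∃ u < T.codes, ∃ w ≤ T.k, T.Reach L u w) := by
  obtain ⟨J, hJ, hlt, hJ0⟩ := T.exists_rounds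
  obtain ⟨s', hr, h0⟩ := runs_decision hB (by omega) hlt hJ0 hs hreg hmem
  refine ⟨s', hr, h0.trans (truth_congr ?_)⟩
  have htime : T.time J = L := by
    obtain ⟨j, hj, hjL⟩ := hL'
    refine le_antisymm ?_ ?_
    · cases J with
      | zero => simp [time]
      | succ J =>
        obtain ⟨j', hj', -, h⟩ := (time_succ_spec (hlt J (by omega))).2.1
        exact h.trans (hL j' hj')
    · rcases T.firstAfter_spec (T.time J) T.d with ⟨-, h⟩ | ⟨h, -⟩
      · exact hjL ▸ h j hj
      · omega
  simp only [lt_table_iff hlt, htime, add_zero]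
  constructor
  · rintro ⟨u, hu, w, h, hw⟩; exact ⟨u, hu, w, hw, h⟩
  · rintro ⟨u, hu, w, hw, h⟩; exact ⟨u, hu, w, h, hw⟩

end Tables

/-! ### Plans: walks as functions of time -/

/-- A walk as a function of time: it is at `pos t` immediately before time `t`, and it traverses
an edge at the times `t` from `start` to `finish - 1` at which its position changes. -/
structure Itinerary (V : Type) where
  start : ℕ
  finish : ℕ
  pos : ℕ → V

/-- The time-edges of an itinerary. -/
def Itinerary.edges {V : Type} (w : Itinerary V) : Set ((V × V) × ℕ) :=
  {e | w.start ≤ e.2 ∧ e.2 < w.finish ∧ w.pos e.2 = e.1.1 ∧ w.pos (e.2 + 1) = e.1.2 ∧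
    e.1.1 ≠ e.1.2}

namespace LifeTEDSC

variable {V : Type}

/-- A family of itineraries that solves the instance, apart from the bound on the number of
walks. -/
structure IsPlan (I : LifeTEDSC V) {ι : Type} (w : ι → Itinerary V) : Prop where
  mem : ∀ i, ∀ e ∈ (w i).edges, I.G.Adj e.1.1 e.1.2 ∧ 1 ≤ e.2 ∧ e.2 ≤ I.lifetime
  life : ∀ i, (w i).finish ≤ (w i).start + I.h
  disj : ∀ i j, ∀ e ∈ (w i).edges, e ∈ (w j).edges → i = j
  cover : ∀ d ∈ I.D, ∃ i, d ∈ (w i).edges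

/-- There is a plan with at most `m` itineraries. -/
def HasPlan (I : LifeTEDSC V) (m : ℕ) : Prop :=
  ∃ (ι : Type) (_ : Fintype ι) (w : ι → Itinerary V), Fintype.card ι ≤ m ∧ I.IsPlan w

end LifeTEDSC

namespace TemporalWalk

variable {V : Type} {𝒢 : TemporalGraph V} (p : TemporalWalk 𝒢)

/-- The number of edges traversed before time `t`. -/
def stepsBefore (t : ℕ) : ℕ :=
  (Finset.univ.filter fun i : Fin p.length => p.time i.castSucc < t).card

theorem stepsBefore_lt (t : ℕ) : p.stepsBefore t < p.length + 1 :=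
  Nat.lt_succ_of_le ((Finset.card_filter_le _ _).trans (by simp))

/-- The itinerary of a temporal walk, which waits between the traversals of its edges. -/
def itinerary : Itinerary V where
  start := p.time 0
  finish := p.time (Fin.last _)
  pos := fun t => p.vertex ⟨p.stepsBefore t, p.stepsBefore_lt t⟩

theorem stepsBefore_time (i : Fin p.length) : p.stepsBefore (p.time i.castSucc) = i := by
  have : (Finset.univ.filter fun j : Fin p.length => p.time j.castSucc < p.time i.castSucc) =
      Finset.Iio i := by
    ext j
    simp [p.time_strictMono.lt_iff_lt]
  rw [stepsBefore, this, Fin.card_Iio]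

theorem stepsBefore_time_succ (i : Fin p.length) :
    p.stepsBefore (p.time i.castSucc + 1) = i + 1 := by
  have : (Finset.univ.filter fun j : Fin p.length => p.time j.castSucc < p.time i.castSucc + 1) =
      Finset.Iic i := by
    ext j
    simp [p.time_strictMono.le_iff_le]
  rw [stepsBefore, this, Fin.card_Iic]

theorem pos_time (i : Fin p.length) :
    p.itinerary.pos (p.time i.castSucc) = p.vertex i.castSucc := by
  simp only [itinerary]
  congr 1
  ext
  simp [stepsBefore_time]

theorem pos_time_succ (i : Fin p.length) :
    p.itinerary.pos (p.time i.castSucc + 1) = p.vertex i.succ := by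
  simp only [itinerary]
  congr 1
  ext
  simp [stepsBefore_time_succ]

theorem edges_itinerary (hG : ∀ v, ¬ 𝒢.G.Adj v v) : p.itinerary.edges = p.timeEdges := by
  ext e
  constructor
  · rintro ⟨-, -, h1, h2, hne⟩
    obtain ⟨i, hi⟩ : ∃ i : Fin p.length, p.time i.castSucc = e.2 := by
      by_contra! hno
      refine hne ?_
      rw [← h1, ← h2]
      simp only [itinerary]
      congr 2
      unfold stepsBefore
      congr 1
      ext i
      have := hno i
      simp only [Finset.mem_filter, Finset.mem_univ, true_and]
      omega
    rw [← hi, p.pos_time] at h1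
    rw [← hi, p.pos_time_succ] at h2
    exact ⟨i, Prod.ext (Prod.ext h1.symm h2.symm) hi.symm⟩
  · rintro ⟨i, rfl⟩
    refine ⟨p.time_strictMono.monotone (Fin.zero_le _), p.time_strictMono (Fin.castSucc_lt_last i),
      p.pos_time i, p.pos_time_succ i, fun h => ?_⟩
    have := (p.edge_mem i).1
    simp only at this h
    rw [h] at this
    exact hG _ this

end TemporalWalk

namespace Itinerary

variable {V : Type} (w : Itinerary V)

theorem pos_eq_of_forall {a b : ℕ} (hab : a ≤ b)
    (h : ∀ t, a ≤ t → t < b → w.pos t = w.pos (t + 1)) :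
    w.pos a = w.pos b := by
  induction b, hab using Nat.le_induction with
  | base => rfl
  | succ b hab ih =>
    exact (ih fun t ht ht' => h t ht (by omega)).trans (h b hab (by omega))

open Classical in
/-- The times at which an itinerary traverses an edge. -/
noncomputable def moves : Finset ℕ :=
  (Finset.Ico w.start w.finish).filter fun t => w.pos t ≠ w.pos (t + 1)

theorem mem_moves {t : ℕ} :
    t ∈ w.moves ↔ (w.start ≤ t ∧ t < w.finish) ∧ w.pos t ≠ w.pos (t + 1) := by
  simp [moves]

/-- The times of the temporal walk of an itinerary: the times of its moves, and then the time at
which it ends. -/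
noncomputable def times : Fin (w.moves.card + 1) → ℕ :=
  Fin.snoc (α := fun _ => ℕ) (w.moves.orderEmbOfFin rfl) w.finish

theorem times_castSucc (i : Fin w.moves.card) :
    w.times i.castSucc = w.moves.orderEmbOfFin rfl i := by simp [times]

theorem times_last : w.times (Fin.last _) = w.finish := by simp [times]

theorem times_mem (i : Fin w.moves.card) : w.times i.castSucc ∈ w.moves := by
  rw [times_castSucc]; exact Finset.orderEmbOfFin_mem _ _ _

theorem exists_times_eq {t : ℕ} (ht : t ∈ w.moves) :
    ∃ i : Fin w.moves.card, w.times i.castSucc = t := by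
  have : t ∈ Set.range (w.moves.orderEmbOfFin rfl) := by
    rw [Finset.range_orderEmbOfFin]; exact ht
  obtain ⟨i, hi⟩ := this
  exact ⟨i, (w.times_castSucc i).trans hi⟩

theorem times_lt_succ (i : Fin w.moves.card) : w.times i.castSucc < w.times i.succ := by
  rcases Fin.eq_castSucc_or_eq_last i.succ with ⟨j, hj⟩ | hj
  · rw [hj, times_castSucc, times_castSucc, OrderEmbedding.lt_iff_lt,
      ← Fin.castSucc_lt_castSucc_iff, ← hj]
    exact Fin.castSucc_lt_succ
  · rw [hj, times_last]
    have := w.times_mem i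
    rw [mem_moves] at this
    exact this.1.2

theorem strictMono_times : StrictMono w.times := Fin.strictMono_iff_lt_succ.2 w.times_lt_succ

theorem times_le_finish (i : Fin (w.moves.card + 1)) : w.times i ≤ w.finish :=
  (w.strictMono_times.monotone (Fin.le_last i)).trans_eq w.times_last

theorem pos_times_succ (i : Fin w.moves.card) :
    w.pos (w.times i.succ) = w.pos (w.times i.castSucc + 1) := by
  refine (w.pos_eq_of_forall (w.times_lt_succ i) fun t ht ht' => ?_).symm
  by_contra hne
  have hi := w.times_mem i
  rw [mem_moves] at hi
  obtain ⟨j, rfl⟩ := w.exists_times_eq (t := t) (by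
    rw [mem_moves]
    exact ⟨⟨by omega, ht'.trans_le (w.times_le_finish _)⟩, hne⟩)
  have h1 : i.castSucc < j.castSucc := w.strictMono_times.lt_iff_lt.1 ht
  have h2 : j.castSucc < i.succ := w.strictMono_times.lt_iff_lt.1 ht'
  simp only [Fin.lt_def, Fin.val_castSucc, Fin.val_succ] at h1 h2
  omega

/-- The temporal walk of an itinerary. -/
noncomputable def toWalk {𝒢 : TemporalGraph V} (h : w.edges ⊆ 𝒢.timeEdges) : TemporalWalk 𝒢 where
  length := w.moves.card
  vertex := fun i => w.pos (w.times i)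
  time := w.times
  time_strictMono := w.strictMono_times
  edge_mem := by
    intro i
    have hi := w.times_mem i
    rw [mem_moves] at hi
    refine h ⟨hi.1.1, hi.1.2, rfl, ?_, ?_⟩
    · exact (w.pos_times_succ i).symm
    · simpa only [w.pos_times_succ] using hi.2

theorem timeEdges_toWalk {𝒢 : TemporalGraph V} (h : w.edges ⊆ 𝒢.timeEdges) :
    (w.toWalk h).timeEdges = w.edges := by
  ext e
  constructor
  · rintro ⟨i, rfl⟩
    have hi := w.times_mem i
    rw [mem_moves] at hi
    refine ⟨hi.1.1, hi.1.2, rfl, ?_, ?_⟩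
    · exact (w.pos_times_succ i).symm
    · exact fun h' => hi.2 (h'.trans (w.pos_times_succ i))
  · rintro ⟨h1, h2, h3, h4, h5⟩
    obtain ⟨i, hi⟩ := w.exists_times_eq (t := e.2) (by
      rw [mem_moves]
      exact ⟨⟨h1, h2⟩, by rw [h3, h4]; exact h5⟩)
    refine ⟨i, Prod.ext (Prod.ext ?_ ?_) hi.symm⟩
    · simp only [toWalk, hi, h3]
    · simp only [toWalk, w.pos_times_succ, hi, h4]

theorem lifespan_toWalk {𝒢 : TemporalGraph V} (h : w.edges ⊆ 𝒢.timeEdges) {L : ℕ}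
    (hL : w.finish ≤ w.start + L) : (w.toWalk h).lifespan ≤ L := by
  change w.times (Fin.last _) - w.times 0 ≤ L
  rw [times_last]
  rcases Fin.eq_castSucc_or_eq_last (0 : Fin (w.moves.card + 1)) with ⟨j, hj⟩ | hj
  · have hi := w.times_mem j
    rw [mem_moves] at hi
    rw [hj]
    omega
  · rw [hj, times_last]
    omega

end Itinerary

namespace LifeTEDSC

variable {V : Type} {I : LifeTEDSC V}

theorem hasPlan_of_isFeasible (hG : ∀ v, ¬ I.G.Adj v v) (h : I.IsFeasible) : I.HasPlan I.k := by
  obtain ⟨S, hS, hext, hcard, hlife⟩ := h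
  have hfin : S.Finite := Set.finite_of_encard_le_coe hcard
  have : Fintype S := hfin.fintype
  refine ⟨S, this, fun p => p.1.itinerary, ?_, ?_⟩
  · rw [← Set.toFinset_card]
    rw [Set.encard_eq_coe_toFinset_card] at hcard
    exact_mod_cast hcard
  · have he : ∀ p : TemporalWalk I.temporalGraph, p.itinerary.edges = p.timeEdges :=
      fun p => p.edges_itinerary hG
    constructor
    · intro p e hp
      rw [he] at hp
      obtain ⟨i, rfl⟩ := hp
      exact p.1.edge_mem i
    · intro p
      have := hlife p.1 p.2
      simp only [TemporalWalk.lifespan] at this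
      simp only [TemporalWalk.itinerary]
      omega
    · intro p q e hp hq
      rw [he] at hp hq
      by_contra hne
      exact Set.disjoint_left.1 (hS p.2 q.2 (fun h => hne (Subtype.ext h))) hp hq
    · intro d hd
      obtain ⟨p, hp, hdp⟩ := hext d hd
      exact ⟨⟨p, hp⟩, by rw [he]; exact hdp⟩

theorem isFeasible_of_hasPlan (h : I.HasPlan I.k) : I.IsFeasible := by
  obtain ⟨ι, _, w, hcard, hw⟩ := h
  have hsub : ∀ i, (w i).edges ⊆ I.temporalGraph.timeEdges := fun i e he => hw.mem i e he
  refine ⟨Set.range fun i => (w i).toWalk (hsub i), ?_, ?_, ?_, ?_⟩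
  · rintro _ ⟨i, rfl⟩ _ ⟨j, rfl⟩ hne
    rw [TemporalWalk.TED, Itinerary.timeEdges_toWalk, Itinerary.timeEdges_toWalk,
      Set.disjoint_left]
    intro e hi hj
    obtain rfl := hw.disj i j e hi hj
    exact hne rfl
  · intro d hd
    obtain ⟨i, hi⟩ := hw.cover d hd
    exact ⟨_, ⟨i, rfl⟩, by rwa [Itinerary.timeEdges_toWalk]⟩
  · rw [← Set.image_univ]
    refine (Set.encard_image_le _ _).trans ?_
    rw [Set.encard_univ, ENat.card_eq_coe_fintype_card]
    exact_mod_cast hcard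
  · rintro _ ⟨i, rfl⟩
    exact (w i).lifespan_toWalk (hsub i) (hw.life i)

/-! ### Few walks at a time -/

open Classical in
/-- The number of itineraries that are under way at time `t`. -/
noncomputable def crowd {ι : Type} [Fintype ι] (w : ι → Itinerary V) (t : ℕ) : ℕ :=
  (Finset.univ.filter fun i => (w i).start ≤ t ∧ t < (w i).finish).card

/-- The itinerary that alternates between `c` and `v` at every time step. -/
def shuttle (c v : V) (b : Bool) (start finish : ℕ) : Itinerary V where
  start := start
  finish := finish
  pos := fun x => if (x + b.toNat) % 2 = 0 then c else v

theorem pos_shuttle_succ (c v : V) (b : Bool) (s s' x : ℕ) :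
    (shuttle c v b s s').pos (x + 1) = if (x + b.toNat) % 2 = 0 then v else c := by
  simp only [shuttle]
  split_ifs <;> first | rfl | omega

theorem mem_edges_shuttle {c v : V} {b : Bool} {s s' : ℕ} {e : (V × V) × ℕ} :
    e ∈ (shuttle c v b s s').edges ↔ s ≤ e.2 ∧ e.2 < s' ∧ c ≠ v ∧
      (((e.2 + b.toNat) % 2 = 0 ∧ e.1 = (c, v)) ∨ ((e.2 + b.toNat) % 2 = 1 ∧ e.1 = (v, c))) := by
  obtain ⟨⟨x, y⟩, t⟩ := e
  simp only [Itinerary.edges, Set.mem_ofPred_eq, pos_shuttle_succ]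
  simp only [shuttle, Prod.mk.injEq]
  rcases Nat.mod_two_eq_zero_or_one (t + b.toNat) with h | h
  · simp only [h, if_true, true_and]
    constructor
    · rintro ⟨h1, h2, rfl, rfl, h5⟩
      exact ⟨h1, h2, h5, Or.inl ⟨rfl, rfl⟩⟩
    · rintro ⟨h1, h2, h5, ⟨rfl, rfl⟩ | ⟨h, -⟩⟩
      · exact ⟨h1, h2, rfl, rfl, h5⟩
      · omega
  · simp only [h, if_neg one_ne_zero, true_and]
    constructor
    · rintro ⟨h1, h2, rfl, rfl, h5⟩
      exact ⟨h1, h2, h5.symm, Or.inr ⟨rfl, rfl⟩⟩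
    · rintro ⟨h1, h2, h5, ⟨h, -⟩ | ⟨rfl, rfl⟩⟩
      · omega
      · exact ⟨h1, h2, rfl, rfl, h5.symm⟩

/-- The two directions of every leg of the star are served at time `t` by the two shuttles of that
leg. -/
theorem exists_shuttle {c : V} (hc : ∀ u v : V, I.G.Adj u v ↔ (u = c ∧ v ≠ c) ∨ (u ≠ c ∧ v = c))
    {e : (V × V) × ℕ} (he : I.G.Adj e.1.1 e.1.2) :
    ∃ v b, ∀ s s', s ≤ e.2 → e.2 < s' → e ∈ (shuttle c v b s s').edges := by
  obtain ⟨⟨x, y⟩, t⟩ := e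
  rcases (hc _ _).1 he with ⟨rfl, hy⟩ | ⟨hx, rfl⟩
  · rcases Nat.mod_two_eq_zero_or_one t with h | h
    · exact ⟨y, false, fun s s' h1 h2 => mem_edges_shuttle.2 ⟨h1, h2, hy.symm,
        Or.inl ⟨by simpa using h, rfl⟩⟩⟩
    · exact ⟨y, true, fun s s' h1 h2 => mem_edges_shuttle.2 ⟨h1, h2, hy.symm,
        Or.inl ⟨by simp; omega, rfl⟩⟩⟩
  · rcases Nat.mod_two_eq_zero_or_one t with h | h
    · exact ⟨x, true, fun s s' h1 h2 => mem_edges_shuttle.2 ⟨h1, h2, hx.symm,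
        Or.inr ⟨by simp; omega, rfl⟩⟩⟩
    · exact ⟨x, false, fun s s' h1 h2 => mem_edges_shuttle.2 ⟨h1, h2, hx.symm,
        Or.inr ⟨by simpa using h, rfl⟩⟩⟩

theorem shuttle_unique {c v v' : V} {b b' : Bool} {s s' r r' : ℕ} {e : (V × V) × ℕ}
    (h : e ∈ (shuttle c v b s s').edges) (h' : e ∈ (shuttle c v' b' r r').edges) :
    v = v' ∧ b = b' := by
  obtain ⟨⟨x, y⟩, t⟩ := e
  rw [mem_edges_shuttle] at h h'
  simp only [Prod.mk.injEq] at h h'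
  obtain ⟨-, -, hv, h⟩ := h
  obtain ⟨-, -, hv', h'⟩ := h'
  rcases h with ⟨h1, rfl, rfl⟩ | ⟨h1, rfl, rfl⟩ <;> rcases h' with ⟨h2, h3, h4⟩ | ⟨h2, h3, h4⟩
  · refine ⟨h4, ?_⟩
    cases b <;> cases b' <;> simp at h1 h2 ⊢ <;> omega
  · exact absurd h3 hv'
  · exact absurd h3.symm hv
  · refine ⟨h3, ?_⟩
    cases b <;> cases b' <;> simp at h1 h2 ⊢ <;> omega

/-- A plan with as few itineraries as possible has at most `4 * n` of them under way at any time
`t`.  Otherwise these could be replaced by `4 * n` shuttles, which serve all edges at all times of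
the window from `t + 1 - h` to `t + h`; the other itineraries meet the complement of this window
in one piece. -/
theorem HasPlan.exists_crowd_le [Fintype V] (hstar : IsBidirectedStar I.G) {m : ℕ}
    (h : I.HasPlan m) : ∃ (ι : Type) (_ : Fintype ι) (w : ι → Itinerary V),
      Fintype.card ι ≤ m ∧ I.IsPlan w ∧ ∀ t, crowd w t ≤ 4 * Fintype.card V := by
  classical
  obtain ⟨c, hc⟩ := hstar
  have hex : ∃ m, I.HasPlan m := ⟨m, h⟩
  obtain ⟨ι, _, w, hcard, hw⟩ := Nat.find_spec hex
  refine ⟨ι, _, w, hcard.trans (Nat.find_min' hex h), hw, fun t => ?_⟩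
  by_contra! hlt
  let act : ι → Prop := fun i => (w i).start ≤ t ∧ t < (w i).finish
  let w' : {i // ¬ act i} ⊕ (Bool × V × Bool) → Itinerary V := fun
    | .inl i => if (w i).finish ≤ t then ⟨(w i).start, min (w i).finish (t + 1 - I.h), (w i).pos⟩
        else ⟨max (w i).start (t + 1 + I.h), (w i).finish, (w i).pos⟩
    | .inr (false, v, b) => shuttle c v b (max 1 (t + 1 - I.h)) (min (t + 1) (I.lifetime + 1))
    | .inr (true, v, b) => shuttle c v b (t + 1) (min (t + 1 + I.h) (I.lifetime + 1))
  have hinl : ∀ i e, e ∈ (w' (.inl i)).edges ↔ e ∈ (w i).edges ∧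
      (e.2 < t + 1 - I.h ∨ t + 1 + I.h ≤ e.2) := by
    rintro ⟨i, hi⟩ e
    have hi' : ¬ ((w i).start ≤ t ∧ t < (w i).finish) := hi
    simp only [w']
    split_ifs with hs
    · simp only [Itinerary.edges, Set.mem_ofPred_eq]
      constructor
      · rintro ⟨h1, h2, h3⟩
        exact ⟨⟨h1, by omega, h3⟩, Or.inl (by omega)⟩
      · rintro ⟨⟨h1, h2, h3⟩, h4⟩
        exact ⟨h1, by omega, h3⟩
    · simp only [Itinerary.edges, Set.mem_ofPred_eq]
      constructor
      · rintro ⟨h1, h2, h3⟩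
        exact ⟨⟨by omega, h2, h3⟩, Or.inr (by omega)⟩
      · rintro ⟨⟨h1, h2, h3⟩, h4⟩
        exact ⟨by omega, h2, h3⟩
  have hinr : ∀ a e, e ∈ (w' (.inr a)).edges → t + 1 - I.h ≤ e.2 ∧ e.2 < t + 1 + I.h ∧
      1 ≤ e.2 ∧ e.2 ≤ I.lifetime ∧ (a.1 = true ↔ t < e.2) ∧ c ≠ a.2.1 ∧
      ∃ s s', e ∈ (shuttle c a.2.1 a.2.2 s s').edges := by
    rintro ⟨a, v, b⟩ e he
    cases a
    · have := mem_edges_shuttle.1 he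
      exact ⟨by omega, by omega, by omega, by omega, by simp; omega, this.2.2.1, _, _, he⟩
    · have := mem_edges_shuttle.1 he
      exact ⟨by omega, by omega, by omega, by omega, by simp; omega, this.2.2.1, _, _, he⟩
  have hplan : I.IsPlan w' := by
    constructor
    · rintro (i | a) e he
      · exact hw.mem i e ((hinl i e).1 he).1
      · obtain ⟨-, -, h1, h2, -, hv, s, s', he⟩ := hinr a e he
        refine ⟨(hc _ _).2 ?_, h1, h2⟩
        rcases (mem_edges_shuttle.1 he).2.2.2 with ⟨-, h⟩ | ⟨-, h⟩
        · rw [h]; exact Or.inl ⟨rfl, hv.symm⟩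
        · rw [h]; exact Or.inr ⟨hv.symm, rfl⟩
    · rintro (i | ⟨a, v, b⟩)
      · have := hw.life i
        simp only [w']
        split_ifs <;> simp only <;> omega
      · cases a <;> simp only [w', shuttle] <;> omega
    · rintro (i | a) (j | b) e hi hj
      · rw [hinl] at hi hj
        rw [Subtype.ext (hw.disj _ _ e hi.1 hj.1)]
      · have h1 := ((hinl i e).1 hi).2
        have h2 := hinr b e hj
        omega
      · have h1 := ((hinl j e).1 hj).2
        have h2 := hinr a e hi
        omega
      · obtain ⟨-, -, -, -, h1, -, s, s', h2⟩ := hinr a e hi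
        obtain ⟨-, -, -, -, h1', -, r, r', h2'⟩ := hinr b e hj
        obtain ⟨h3, h4⟩ := shuttle_unique h2 h2'
        rw [show a = b from Prod.ext (Bool.eq_iff_iff.2 (h1.trans h1'.symm)) (Prod.ext h3 h4)]
    · intro d hd
      obtain ⟨i, hi⟩ := hw.cover d hd
      obtain ⟨h1, h2, h3⟩ := hw.mem i d hi
      by_cases hwin : t + 1 - I.h ≤ d.2 ∧ d.2 < t + 1 + I.h
      · obtain ⟨v, b, hvb⟩ := exists_shuttle hc h1
        by_cases hdt : d.2 ≤ t
        · exact ⟨.inr (false, v, b), hvb _ _ (by omega) (by omega)⟩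
        · exact ⟨.inr (true, v, b), hvb _ _ (by omega) (by omega)⟩
      · have hact : ¬ act i := by
          rintro ⟨h4, h5⟩
          have h6 := hw.life i
          have h7 := hi.1
          have h8 := hi.2.1
          omega
        exact ⟨.inl ⟨i, hact⟩, (hinl ⟨i, hact⟩ d).2 ⟨hi, by omega⟩⟩
  have hcard' : Fintype.card ({i // ¬ act i} ⊕ (Bool × V × Bool)) < Nat.find hex := by
    have h1 : Fintype.card {i // ¬ act i} = Fintype.card ι - crowd w t := by
      rw [Fintype.card_subtype_compl, Fintype.card_subtype, crowd]
    have h2 : crowd w t ≤ Fintype.card ι := Finset.card_le_univ _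
    rw [Fintype.card_sum, Fintype.card_prod, Fintype.card_prod, Fintype.card_bool, h1]
    omega
  exact Nat.find_min hex hcard' ⟨_, inferInstance, w', le_rfl, hplan⟩

/-- The itinerary starts with a demand, unless it is empty. -/
def StartsWithDemand (I : LifeTEDSC V) (w : Itinerary V) : Prop :=
  w.start < w.finish → ((w.pos w.start, w.pos (w.start + 1)), w.start) ∈ I.D

/-- Cutting off the part before the first demand. -/
theorem IsPlan.exists_startsWithDemand {ι : Type} [Fintype ι] {w : ι → Itinerary V}
    (hw : I.IsPlan w) : ∃ w' : ι → Itinerary V, I.IsPlan w' ∧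
      (∀ i, I.StartsWithDemand (w' i)) ∧ ∀ t, crowd w' t ≤ crowd w t := by
  classical
  let P : ι → ℕ → Prop := fun i t => (w i).start ≤ t ∧ t < (w i).finish ∧
    (((w i).pos t, (w i).pos (t + 1)), t) ∈ I.D
  let a : ι → ℕ := fun i => if h : ∃ t, P i t then Nat.find h else max (w i).start (w i).finish
  have ha : ∀ i, (w i).start ≤ a i := by
    intro i
    simp only [a]
    split_ifs with h
    · exact (Nat.find_spec h).1
    · exact le_max_left _ _
  have hle : ∀ i t, P i t → a i ≤ t := by
    intro i t ht
    have h : ∃ t, P i t := ⟨t, ht⟩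
    simp only [a, dif_pos h]
    exact Nat.find_min' h ht
  have hsub : ∀ i, (Itinerary.mk (a i) (w i).finish (w i).pos).edges ⊆ (w i).edges :=
    fun i e he => ⟨(ha i).trans he.1, he.2⟩
  refine ⟨fun i => ⟨a i, (w i).finish, (w i).pos⟩, ⟨?_, ?_, ?_, ?_⟩, ?_, ?_⟩
  · exact fun i e he => hw.mem i e (hsub i he)
  · exact fun i => (hw.life i).trans (Nat.add_le_add_right (ha i) _)
  · exact fun i j e hi hj => hw.disj i j e (hsub i hi) (hsub j hj)
  · intro d hd
    obtain ⟨i, hi⟩ := hw.cover d hd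
    refine ⟨i, hle i d.2 ⟨hi.1, hi.2.1, ?_⟩, hi.2⟩
    rw [hi.2.2.1, hi.2.2.2.1]
    exact hd
  · intro i hi
    simp only [a] at hi ⊢
    split_ifs at hi ⊢ with h
    · exact (Nat.find_spec h).2.2
    · omega
  · intro t
    refine Finset.card_le_card fun i hi => ?_
    simp only [Finset.mem_filter, Finset.mem_univ, true_and] at hi ⊢
    exact ⟨(ha i).trans hi.1, hi.2⟩

end LifeTEDSC

/-! ### Colouring intervals -/

/-- Intervals of which at most `M` contain a common point can be coloured with `M` colours such
that intervals with a common point have different colours. -/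
theorem exists_interval_coloring {ι : Type} [Fintype ι] (a b : ι → ℕ) {M : ℕ} (hM : 0 < M)
    (h : ∀ t, Set.ncard {i | a i ≤ t ∧ t < b i} ≤ M) :
    ∃ col : ι → Fin M, ∀ i j t, a i ≤ t → t < b i → a j ≤ t → t < b j → col i = col j → i = j := by
  classical
  suffices H : ∀ s : Finset ι, ∃ col : ι → Fin M, ∀ i ∈ s, ∀ j ∈ s, ∀ t, a i ≤ t → t < b i →
      a j ≤ t → t < b j → col i = col j → i = j by
    obtain ⟨col, hcol⟩ := H Finset.univ
    exact ⟨col, fun i j => hcol i (Finset.mem_univ _) j (Finset.mem_univ _)⟩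
  intro s
  induction s using Finset.induction_on_max_value a with
  | empty => exact ⟨fun _ => ⟨0, hM⟩, by simp⟩
  | insert x s hx hmax ih =>
    obtain ⟨col, hcol⟩ := ih
    obtain ⟨q, hq⟩ : ∃ q : Fin M, a x < b x → ∀ j ∈ s, a x < b j → col j ≠ q := by
      by_cases hxe : a x < b x
      · let N := s.filter fun j => a x < b j
        have h1 : (insert x N).card ≤ M := by
          have h2 : ((insert x N : Finset ι) : Set ι) ⊆ {i | a i ≤ a x ∧ a x < b i} := by
            intro j hj
            rcases Finset.mem_insert.1 (Finset.mem_coe.1 hj) with rfl | hj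
            · exact ⟨le_rfl, hxe⟩
            · obtain ⟨h3, h4⟩ := Finset.mem_filter.1 hj
              exact ⟨hmax j h3, h4⟩
          have h3 := Set.ncard_le_ncard h2 (Set.toFinite _)
          rw [Set.ncard_coe_finset] at h3
          exact h3.trans (h _)
        rw [Finset.card_insert_of_notMem (fun hN => hx (Finset.mem_filter.1 hN).1)] at h1
        have h4 : (N.image col).card < (Finset.univ : Finset (Fin M)).card := by
          rw [Finset.card_univ, Fintype.card_fin]
          exact (Finset.card_image_le).trans_lt h1
        obtain ⟨q, -, hq⟩ := Finset.exists_mem_notMem_of_card_lt_card h4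
        exact ⟨q, fun _ j hj hj' hjq => hq (Finset.mem_image.2
          ⟨j, Finset.mem_filter.2 ⟨hj, hj'⟩, hjq⟩)⟩
      · exact ⟨⟨0, hM⟩, fun h => absurd h hxe⟩
    refine ⟨Function.update col x q, ?_⟩
    have hne : ∀ j ∈ s, j ≠ x := fun j hj h => hx (h ▸ hj)
    intro i hi j hj t h1 h2 h3 h4 hc
    rcases Finset.mem_insert.1 hi with hi' | hi' <;> rcases Finset.mem_insert.1 hj with hj' | hj'
    · exact hi'.trans hj'.symm
    · rw [hi', Function.update_self, Function.update_of_ne (hne j hj')] at hc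
      rw [hi'] at h1 h2
      exact absurd hc.symm (hq (by omega) j hj' (by omega))
    · rw [hj', Function.update_self, Function.update_of_ne (hne i hi')] at hc
      rw [hj'] at h3 h4
      exact absurd hc (hq (by omega) i hi' (by omega))
    · rw [Function.update_of_ne (hne i hi'), Function.update_of_ne (hne j hj')] at hc
      exact hcol i hi' j hj' t h1 h2 h3 h4 hc

/-! ### Runs: plans in which the walks occupy slots -/

/-- For every slot, its vertex and the demand with which its current walk started. -/
abbrev Config (V : Type) (M : ℕ) := Fin M → V × Option ((V × V) × ℕ)

namespace LifeTEDSC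

variable {V : Type} (I : LifeTEDSC V)

/-- At time `t`, a slot either keeps its walk, which waits or traverses an edge, or it starts a new
walk with a demand. -/
def SlotStep (t : ℕ) (x x' : V × Option ((V × V) × ℕ)) : Prop :=
  (x.2 = x'.2 ∧ (x.1 = x'.1 ∨ I.G.Adj x.1 x'.1)) ∨
  (x.2 ≠ x'.2 ∧ ∃ d ∈ I.D, x'.2 = some d ∧ d.2 = t ∧ d.1.2 = x'.1)

/-- In a transition of a slot, its walk goes from `u` to `v`.  A new walk appears at the first
vertex of its first demand. -/
def Traverses (x x' : V × Option ((V × V) × ℕ)) (u v : V) : Prop :=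
  ((x.2 = x'.2 ∧ x.1 = u) ∨ (x.2 ≠ x'.2 ∧ ∃ d ∈ I.D, x'.2 = some d ∧ d.1.1 = u)) ∧ x'.1 = v

/-- A transition at time `t`.  The lifespan matters only for walks that serve a demand: after its
last demand, a walk can be cut off. -/
structure Step {M : ℕ} (t : ℕ) (c c' : Config V M) : Prop where
  slot : ∀ i, I.SlotStep t (c i) (c' i)
  unique : ∀ u v, I.G.Adj u v → ∀ i i', I.Traverses (c i) (c' i) u v →
    I.Traverses (c i') (c' i') u v → i = i'
  serve : ∀ d ∈ I.D, d.2 = t → ∃ i, I.Traverses (c i) (c' i) d.1.1 d.1.2 ∧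
    ∃ d' ∈ I.D, (c' i).2 = some d' ∧ t < d'.2 + I.h

open Classical in
/-- The number of walks that start in a transition. -/
noncomputable def newWalks {M : ℕ} (c c' : Config V M) : ℕ :=
  (Finset.univ.filter fun i => (c i).2 ≠ (c' i).2).card

/-- A sequence of configurations with a transition at every time.  The configuration `cfg t` is
the one immediately before time `t`. -/
structure IsRun {M : ℕ} (v₀ : V) (cfg : ℕ → Config V M) (T : ℕ) : Prop where
  init : ∀ i, cfg 1 i = (v₀, none)
  step : ∀ t, 1 ≤ t → t ≤ T → I.Step t (cfg t) (cfg (t + 1))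

/-- The number of walks started up to time `T`. -/
noncomputable def totalWalks {M : ℕ} (cfg : ℕ → Config V M) (T : ℕ) : ℕ :=
  ∑ t ∈ Finset.Icc 1 T, newWalks (cfg t) (cfg (t + 1))

variable {I}

theorem totalWalks_succ {M : ℕ} (cfg : ℕ → Config V M) (T : ℕ) :
    totalWalks cfg (T + 1) = totalWalks cfg T + newWalks (cfg (T + 1)) (cfg (T + 2)) := by
  rw [totalWalks, Finset.sum_Icc_succ_top (by omega)]
  rfl

/-- A plan with few itineraries at a time, each starting with a demand, yields a run. -/
theorem IsPlan.exists_isRun (hG : ∀ v, ¬ I.G.Adj v v) {ι : Type} [Fintype ι]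
    {w : ι → Itinerary V} (hw : I.IsPlan w) (hs : ∀ i, I.StartsWithDemand (w i)) {M : ℕ}
    (hM : 0 < M) (hcrowd : ∀ t, crowd w t ≤ M) (v₀ : V) :
    ∃ cfg : ℕ → Config V M, I.IsRun v₀ cfg I.lifetime ∧
      totalWalks cfg I.lifetime ≤ Fintype.card ι := by
  classical
  obtain ⟨col, hcol⟩ := exists_interval_coloring (fun i => (w i).start) (fun i => (w i).finish) hM
    (fun t => by
      refine le_trans (le_of_eq ?_) (hcrowd t)
      rw [crowd, ← Set.ncard_coe_finset]
      congr 1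
      ext i
      simp)
  let act : Fin M → ℕ → ι → Prop := fun q t i => col i = q ∧ (w i).start ≤ t ∧ t < (w i).finish
  let dem : ι → (V × V) × ℕ := fun i =>
    (((w i).pos (w i).start, (w i).pos ((w i).start + 1)), (w i).start)
  let cfg : ℕ → Config V M := fun t => Nat.rec (fun _ => (v₀, none)) (fun t c q =>
    if h : ∃ i, act q t i then ((w h.choose).pos (t + 1), some (dem h.choose)) else c q) t
  have huniq : ∀ {q t i j}, act q t i → act q t j → i = j := fun {q t i j} hi hj =>
    hcol i j t hi.2.1 hi.2.2 hj.2.1 hj.2.2 (hi.1.trans hj.1.symm)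
  have hcfg : ∀ {q t i}, act q t i → cfg (t + 1) q = ((w i).pos (t + 1), some (dem i)) := by
    intro q t i hi
    have h : ∃ i, act q t i := ⟨i, hi⟩
    have : h.choose = i := huniq h.choose_spec hi
    change (if h : ∃ i, act q t i then _ else _) = _
    rw [dif_pos h, this]
  have hcfg' : ∀ {q t}, (¬ ∃ i, act q t i) → cfg (t + 1) q = cfg t q := by
    intro q t h
    change (if h : ∃ i, act q t i then _ else _) = _
    rw [dif_neg h]
  have hdem : ∀ {q t i}, act q t i → dem i ∈ I.D := fun {q t i} hi =>
    hs i (hi.2.1.trans_lt hi.2.2)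
  have htime : ∀ t q d, (cfg t q).2 = some d → d.2 < t := by
    intro t
    induction t with
    | zero =>
      intro q d h
      exact absurd h (by simp [cfg])
    | succ t ih =>
      intro q d h
      by_cases hact : ∃ i, act q t i
      · obtain ⟨i, hi⟩ := hact
        rw [hcfg hi] at h
        obtain rfl := Option.some.inj h
        exact Nat.lt_succ_of_le hi.2.1
      · rw [hcfg' hact] at h
        exact (ih q d h).trans (Nat.lt_succ_self t)
  -- A slot is idle, or it starts a new walk, or it continues with the same walk.
  have htri : ∀ q t, (cfg (t + 1) q = cfg t q ∧ ¬ ∃ i, act q t i) ∨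
      (∃ i, act q t i ∧ (w i).start = t ∧ (cfg t q).2 ≠ some (dem i)) ∨
      (∃ i, act q t i ∧ cfg t q = ((w i).pos t, some (dem i))) := by
    intro q t
    by_cases hact : ∃ i, act q t i
    · obtain ⟨i, hi⟩ := hact
      right
      rcases hi.2.1.eq_or_lt with h | h
      · refine Or.inl ⟨i, hi, h, fun h' => ?_⟩
        have := htime _ _ _ h'
        simp only [dem] at this
        omega
      · obtain ⟨t', rfl⟩ : ∃ t', t = t' + 1 := ⟨t - 1, by omega⟩
        exact Or.inr ⟨i, hi, hcfg ⟨hi.1, by omega, by have := hi.2.2; omega⟩⟩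
    · exact Or.inl ⟨hcfg' hact, hact⟩
  have htrav : ∀ {q t u v}, I.G.Adj u v → I.Traverses (cfg t q) (cfg (t + 1) q) u v →
      ∃ i, act q t i ∧ ((u, v), t) ∈ (w i).edges := by
    rintro q t u v huv ⟨h1, h2⟩
    have hne : u ≠ v := fun h => hG v (h ▸ huv)
    rcases htri q t with ⟨h, -⟩ | ⟨i, hi, hst, hnew⟩ | ⟨i, hi, hold⟩
    · rw [h] at h1 h2
      rcases h1 with ⟨-, h1⟩ | ⟨h1, -⟩
      · exact absurd (h1.symm.trans h2) hne
      · exact absurd rfl h1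
    · rw [hcfg hi] at h1 h2
      rcases h1 with ⟨h1, -⟩ | ⟨-, d, -, h3, h4⟩
      · exact absurd h1 hnew
      · obtain rfl := Option.some.inj h3
        refine ⟨i, hi, hi.2.1, hi.2.2, ?_, h2, hne⟩
        rw [← h4]
        simp only [dem, hst]
    · rw [hcfg hi, hold] at h1
      rw [hcfg hi] at h2
      rcases h1 with ⟨-, h1⟩ | ⟨h1, -⟩
      · exact ⟨i, hi, hi.2.1, hi.2.2, h1, h2, hne⟩
      · exact absurd rfl h1
  refine ⟨cfg, ⟨?_, ?_⟩, ?_⟩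
  · intro q
    refine hcfg' ?_
    rintro ⟨i, hi⟩
    have := I.demand_pos _ (hdem hi)
    have := hi.2.1
    simp only [dem] at *
    omega
  · intro t ht1 htL
    constructor
    · intro q
      rcases htri q t with ⟨h, -⟩ | ⟨i, hi, hst, hnew⟩ | ⟨i, hi, hold⟩
      · rw [h]; exact Or.inl ⟨rfl, Or.inl rfl⟩
      · rw [hcfg hi]
        refine Or.inr ⟨hnew, dem i, hdem hi, rfl, hst, ?_⟩
        simp only [dem, hst]
      · rw [hcfg hi, hold]
        refine Or.inl ⟨rfl, ?_⟩
        by_cases hne : (w i).pos t = (w i).pos (t + 1)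
        · exact Or.inl hne
        · exact Or.inr (hw.mem i (((w i).pos t, (w i).pos (t + 1)), t)
            ⟨hi.2.1, hi.2.2, rfl, rfl, hne⟩).1
    · intro u v huv q q' h h'
      obtain ⟨i, hi, he⟩ := htrav huv h
      obtain ⟨j, hj, he'⟩ := htrav huv h'
      rw [← hi.1, ← hj.1, hw.disj i j _ he he']
    · intro d hd hdt
      obtain ⟨i, hi⟩ := hw.cover d hd
      have hact : act (col i) t i := ⟨rfl, hdt ▸ hi.1, hdt ▸ hi.2.1⟩
      obtain ⟨-, -, h3, h4, -⟩ := hi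
      rw [hdt] at h3 h4
      refine ⟨col i, ?_, dem i, hdem hact, by rw [hcfg hact], ?_⟩
      · rcases htri (col i) t with ⟨-, h⟩ | ⟨j, hj, hst, hnew⟩ | ⟨j, hj, hold⟩
        · exact absurd ⟨i, hact⟩ h
        · obtain rfl := huniq hj hact
          rw [hcfg hact]
          refine ⟨Or.inr ⟨hnew, dem j, hdem hact, rfl, ?_⟩, h4⟩
          simp only [dem, hst, h3]
        · obtain rfl := huniq hj hact
          rw [hcfg hact, hold]
          exact ⟨Or.inl ⟨rfl, h3⟩, h4⟩
      · exact hact.2.2.trans_le (hw.life i)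
  · have h1 : ∀ t, newWalks (cfg t) (cfg (t + 1)) ≤
        (Finset.univ.filter fun i => (w i).start = t).card := by
      intro t
      refine le_trans (Finset.card_le_card ?_) (Finset.card_image_le (f := col))
      intro q hq
      simp only [Finset.mem_filter, Finset.mem_univ, true_and] at hq
      rcases htri q t with ⟨h, -⟩ | ⟨i, hi, hst, hnew⟩ | ⟨i, hi, hold⟩
      · exact absurd (by rw [h]) hq
      · exact Finset.mem_image.2 ⟨i, by simpa using hst, hi.1⟩
      · exact absurd (by rw [hcfg hi, hold]) hq
    refine (Finset.sum_le_sum fun t _ => h1 t).trans ?_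
    rw [← Finset.card_biUnion]
    · exact Finset.card_le_univ _
    · intro a _ b _ hab
      rw [Function.onFun, Finset.disjoint_left]
      intro i hi hi'
      simp only [Finset.mem_filter, Finset.mem_univ, true_and] at hi hi'
      exact hab (hi.symm.trans hi')

/-- A run yields a plan: every new walk becomes an itinerary, which ends when its slot starts
another walk or when its lifespan is used up. -/
theorem IsRun.hasPlan (hG : ∀ v, ¬ I.G.Adj v v) {M : ℕ} {v₀ : V} {cfg : ℕ → Config V M}
    (hr : I.IsRun v₀ cfg I.lifetime) : I.HasPlan (totalWalks cfg I.lifetime) := by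
  classical
  let ch : ℕ → Fin M → Prop := fun t q => (cfg t q).2 ≠ (cfg (t + 1) q).2
  let A : Finset (Σ _ : ℕ, Fin M) := (Finset.Icc 1 I.lifetime).sigma fun t =>
    Finset.univ.filter fun q => ch t q
  have hA : ∀ {t q}, ⟨t, q⟩ ∈ A ↔ (1 ≤ t ∧ t ≤ I.lifetime) ∧ ch t q := by
    intro t q
    simp [A]
  have hex : ∀ t q, ∃ y, t < y ∧ (I.lifetime < y ∨ ch y q) := fun t q =>
    ⟨t + I.lifetime + 1, by omega, by omega⟩
  let fin : ℕ → Fin M → ℕ := fun t q => Nat.find (hex t q)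
  have hfin : ∀ t q y, t < y → (I.lifetime < y ∨ ch y q) → fin t q ≤ y := fun t q y h1 h2 =>
    Nat.find_min' (hex t q) ⟨h1, h2⟩
  let src : ℕ → Fin M → V := fun t q => ((cfg (t + 1) q).2.map fun d => d.1.1).getD v₀
  let w : A → Itinerary V := fun a =>
    ⟨a.1.1, min (a.1.1 + I.h) (fin a.1.1 a.1.2),
      fun t => if t = a.1.1 then src t a.1.2 else (cfg t a.1.2).1⟩
  have hnew : ∀ {t q}, 1 ≤ t → t ≤ I.lifetime → ch t q → ∃ d ∈ I.D,
      (cfg (t + 1) q).2 = some d ∧ d.2 = t ∧ d.1.2 = (cfg (t + 1) q).1 ∧ src t q = d.1.1 := by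
    intro t q h1 h2 hch
    rcases (hr.step t h1 h2).slot q with ⟨h, -⟩ | ⟨-, d, hd, h3, h4, h5⟩
    · exact absurd h hch
    · exact ⟨d, hd, h3, h4, h5, by simp [src, h3]⟩
  have hedge : ∀ (a : A) e, e ∈ (w a).edges → 1 ≤ e.2 ∧ e.2 ≤ I.lifetime ∧
      I.G.Adj e.1.1 e.1.2 ∧ I.Traverses (cfg e.2 a.1.2) (cfg (e.2 + 1) a.1.2) e.1.1 e.1.2 ∧
      e.2 < fin a.1.1 a.1.2 := by
    rintro ⟨⟨t, q⟩, ha⟩ ⟨⟨u, v⟩, x⟩ ⟨h1, h2, h3, h4, h5⟩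
    obtain ⟨⟨ht1, ht2⟩, hch⟩ := hA.1 ha
    simp only [w] at h1 h2 h3 h4 h5 ⊢
    rw [if_neg (by omega)] at h4
    have hxL : x ≤ I.lifetime := by
      by_contra hx
      have := hfin t q (I.lifetime + 1) (by omega) (Or.inl (by omega))
      omega
    refine ⟨by omega, hxL, ?_⟩
    by_cases hx : x = t
    · subst hx
      rw [if_pos rfl] at h3
      obtain ⟨d, hd, h6, h7, h8, h9⟩ := hnew ht1 ht2 hch
      have hu : d.1.1 = u := h9.symm.trans h3
      have hv : d.1.2 = v := h8.trans h4
      exact ⟨hu ▸ hv ▸ I.demand_edge d hd, ⟨Or.inr ⟨hch, d, hd, h6, hu⟩, h4⟩, by omega⟩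
    · rw [if_neg hx] at h3
      have hnc : ¬ ch x q := fun hc => by
        have := hfin t q x (by omega) (Or.inr hc)
        omega
      have hidx := not_not.1 hnc
      refine ⟨?_, ⟨Or.inl ⟨hidx, h3⟩, h4⟩, by omega⟩
      rcases (hr.step x (by omega) hxL).slot q with ⟨-, h | h⟩ | ⟨h, -⟩
      · exact absurd (h3.symm.trans (h.trans h4)) h5
      · rwa [h3, h4] at h
      · exact absurd hidx h
  refine ⟨A, inferInstance, w, ?_, ?_, ?_, ?_, ?_⟩
  · rw [Fintype.card_coe, Finset.card_sigma]
    refine le_of_eq (Finset.sum_congr rfl fun t _ => ?_)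
    simp only [newWalks, ch]
  · intro a e he
    obtain ⟨h1, h2, h3, -⟩ := hedge a e he
    exact ⟨h3, h1, h2⟩
  · intro a
    exact min_le_left _ _
  · intro a b e ha hb
    have ha0 := ha.1
    have hb0 := hb.1
    obtain ⟨h1, h2, h3, h4, h5⟩ := hedge a e ha
    obtain ⟨-, -, -, h4', h5'⟩ := hedge b e hb
    obtain ⟨⟨t, q⟩, hta⟩ := a
    obtain ⟨⟨t', q'⟩, htb⟩ := b
    obtain rfl : q = q' := (hr.step e.2 h1 h2).unique _ _ h3 _ _ h4 h4'
    have hc := (hA.1 hta).2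
    have hc' := (hA.1 htb).2
    simp only [w] at ha0 hb0 h5 h5'
    obtain rfl : t = t' := by
      rcases lt_trichotomy t t' with h | h | h
      · have := hfin t q t' h (Or.inr hc'); omega
      · exact h
      · have := hfin t' q t h (Or.inr hc); omega
    rfl
  · intro d hd
    have hdL : d.2 ≤ I.lifetime := Finset.le_sup (f := Prod.snd) hd
    obtain ⟨q, ⟨htr, hv⟩, d', hd', hidx, hlt⟩ :=
      (hr.step d.2 (I.demand_pos d hd) hdL).serve d hd rfl
    have hstart : ∀ x, x ≤ I.lifetime → ∀ d', (cfg (x + 1) q).2 = some d' →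
        1 ≤ d'.2 ∧ d'.2 ≤ x ∧ ch d'.2 q ∧ ∀ y, d'.2 < y → y ≤ x → ¬ ch y q := by
      intro x
      induction x with
      | zero =>
        intro _ d' h
        rw [zero_add, hr.init q] at h
        exact absurd h (by simp)
      | succ x ih =>
        intro hx d' h
        by_cases hc : ch (x + 1) q
        · obtain ⟨d'', -, h3, h4, -⟩ := hnew (by omega) hx hc
          obtain rfl := Option.some.inj (h3.symm.trans h)
          exact ⟨by omega, by omega, h4.symm ▸ hc, fun y h5 h6 => by omega⟩
        · have h' : (cfg (x + 1) q).2 = some d' := (not_not.1 hc).trans h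
          obtain ⟨h1, h2, h3, h4⟩ := ih (by omega) d' h'
          refine ⟨h1, by omega, h3, fun y h5 h6 => ?_⟩
          rcases Nat.lt_succ_iff_lt_or_eq.1 (Nat.lt_succ_of_le h6) with h7 | rfl
          · exact h4 y h5 (by omega)
          · exact hc
    obtain ⟨h1, h2, h3, h4⟩ := hstart d.2 hdL d' hidx
    refine ⟨⟨⟨d'.2, q⟩, hA.2 ⟨⟨h1, by omega⟩, h3⟩⟩, h2, ?_, ?_, ?_, ?_⟩
    · refine lt_min hlt ?_
      refine (Nat.lt_find_iff _ _).2 fun y hy => ?_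
      rintro ⟨h5, h6 | h6⟩
      · omega
      · exact h4 y h5 hy h6
    · simp only [w]
      by_cases hx : d.2 = d'.2
      · rw [if_pos hx]
        have hc : ch d.2 q := hx ▸ h3
        rcases htr with ⟨h, -⟩ | ⟨-, d'', -, h5, h6⟩
        · exact absurd h hc
        · rw [← h6]
          simp [src, h5]
      · rw [if_neg hx]
        rcases htr with ⟨-, h⟩ | ⟨h, -⟩
        · exact h
        · exact absurd h (h4 d.2 (by omega) le_rfl)
    · simp only [w]
      rw [if_neg (by omega)]
      exact hv
    · intro h
      exact hG _ (h ▸ I.demand_edge d hd)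

end LifeTEDSC

/-! ### Runs that move only shortly before demands -/

namespace LifeTEDSC

variable {V : Type} (I : LifeTEDSC V)

/-- The times at most `2 * M` before a demand. -/
def Relevant (M t : ℕ) : Prop := ∃ d ∈ I.D, d.2 - (M + M) ≤ t ∧ t ≤ d.2

/-- The configuration can be reached with the transitions at relevant times up to `t` and with `w`
new walks. -/
def Reach (I : LifeTEDSC V) {M : ℕ} (v₀ : V) : ℕ → Config V M → ℕ → Prop
  | 0, c, w => c = (fun _ => (v₀, none)) ∧ w = 0
  | t + 1, c', w =>
    (I.Relevant M (t + 1) ∧ ∃ c w', I.Reach v₀ t c w' ∧ I.Step (t + 1) c c' ∧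
      w = w' + newWalks c c') ∨ (¬ I.Relevant M (t + 1) ∧ I.Reach v₀ t c' w)

variable {I}

theorem newWalks_eq_zero {M : ℕ} {c c' : Config V M} (h : ∀ i, (c i).2 = (c' i).2) :
    newWalks c c' = 0 := by
  classical
  rw [newWalks, Finset.card_eq_zero, Finset.filter_eq_empty_iff]
  exact fun i _ hi => hi (h i)

/-- A slot that stays where it is does not traverse an edge. -/
theorem Traverses.ne (hG : ∀ v, ¬ I.G.Adj v v) {x x' : V × Option ((V × V) × ℕ)} {u v : V}
    (h : I.Traverses x x' u v) (huv : I.G.Adj u v) : x ≠ x' := by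
  rintro rfl
  obtain ⟨⟨-, rfl⟩ | ⟨h, -⟩, rfl⟩ := h
  · exact hG _ huv
  · exact h rfl

theorem step_self (hG : ∀ v, ¬ I.G.Adj v v) {M t : ℕ} (ht : ∀ d ∈ I.D, d.2 ≠ t)
    (c : Config V M) : I.Step t c c :=
  ⟨fun _ => Or.inl ⟨rfl, Or.inl rfl⟩, fun _ _ huv _ _ h _ => absurd rfl (h.ne hG huv),
    fun d hd hdt => absurd hdt (ht d hd)⟩

theorem IsRun.extend {M T : ℕ} {v₀ : V} {cfg : ℕ → Config V M} (h : I.IsRun v₀ cfg T)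
    {c : Config V M} (hc : I.Step (T + 1) (cfg (T + 1)) c) :
    ∃ cfg' : ℕ → Config V M, I.IsRun v₀ cfg' (T + 1) ∧ cfg' (T + 2) = c ∧
      totalWalks cfg' (T + 1) = totalWalks cfg T + newWalks (cfg (T + 1)) c := by
  have hold : ∀ t ≤ T + 1, Function.update cfg (T + 2) c t = cfg t := fun t ht =>
    Function.update_of_ne (by omega) _ _
  have hlast : Function.update cfg (T + 2) c (T + 2) = c := Function.update_self _ _ _
  refine ⟨Function.update cfg (T + 2) c, ⟨fun i => ?_, fun t h1 h2 => ?_⟩, hlast, ?_⟩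
  · rw [hold 1 (by omega)]; exact h.init i
  · rcases Nat.lt_succ_iff_lt_or_eq.1 (Nat.lt_succ_of_le h2) with h2 | rfl
    · rw [hold t (by omega), hold (t + 1) (by omega)]
      exact h.step t h1 (by omega)
    · rw [hold _ le_rfl, hlast]; exact hc
  · rw [totalWalks_succ, hold _ le_rfl, hlast, totalWalks]
    congr 1
    refine Finset.sum_congr rfl fun t ht => ?_
    rw [Finset.mem_Icc] at ht
    rw [hold t (by omega), hold (t + 1) (by omega)]

theorem Reach.exists_isRun (hG : ∀ v, ¬ I.G.Adj v v) {M t w : ℕ} {v₀ : V} {c : Config V M}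
    (h : I.Reach v₀ t c w) :
    ∃ cfg, I.IsRun v₀ cfg t ∧ cfg (t + 1) = c ∧ totalWalks cfg t = w := by
  induction t generalizing c w with
  | zero =>
    obtain ⟨rfl, rfl⟩ := h
    exact ⟨fun _ _ => (v₀, none), ⟨fun _ => rfl, fun t h1 h2 => by omega⟩, rfl, by
      simp [totalWalks]⟩
  | succ t ih =>
    rcases h with ⟨-, c₀, w', h, hstep, rfl⟩ | ⟨hrel, h⟩
    · obtain ⟨cfg, hrun, rfl, rfl⟩ := ih h
      exact hrun.extend hstep
    · obtain ⟨cfg, hrun, rfl, rfl⟩ := ih h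
      have hs := step_self hG (t := t + 1) (fun d hd hdt => hrel ⟨d, hd, by omega, by omega⟩)
        (cfg (t + 1))
      obtain ⟨cfg', h1, h2, h3⟩ := hrun.extend hs
      exact ⟨cfg', h1, h2, by rw [h3, newWalks_eq_zero fun _ => rfl, add_zero]⟩

theorem Reach.of_not_relevant {M t t' w : ℕ} {v₀ : V} {c : Config V M} (h : I.Reach v₀ t c w)
    (htt : t ≤ t') (hrel : ∀ x, t < x → x ≤ t' → ¬ I.Relevant M x) : I.Reach v₀ t' c w := by
  induction t', htt using Nat.le_induction with
  | base => exact h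
  | succ t' htt ih =>
    exact Or.inr ⟨hrel _ (by omega) le_rfl, ih fun x hx hx' => hrel x hx (by omega)⟩

/-- After `j` steps of the rearrangement of the slots from `c` to `c'`: one after the other, the
slots move to the center and then to their new vertices. -/
def detour {M : ℕ} (z : V) (c c' : Config V M) (j : ℕ) : Config V M := fun i =>
  (if j ≤ 2 * i then (c i).1 else if j = 2 * i + 1 then z else (c' i).1, (c i).2)

theorem step_detour {z : V} (hz : ∀ u v : V, I.G.Adj u v ↔ (u = z ∧ v ≠ z) ∨ (u ≠ z ∧ v = z))
    {M t : ℕ} (ht : ∀ d ∈ I.D, d.2 ≠ t) (c c' : Config V M) (j : ℕ) :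
    I.Step t (detour z c c' j) (detour z c c' (j + 1)) := by
  have hG : ∀ v, ¬ I.G.Adj v v := fun v => by rw [hz]; tauto
  have hmove : ∀ i : Fin M, detour z c c' j i ≠ detour z c c' (j + 1) i → (i : ℕ) = j / 2 := by
    intro i hi
    by_contra hne
    refine hi ?_
    simp only [detour]
    congr 1
    split_ifs <;> first | rfl | omega
  refine ⟨fun i => Or.inl ⟨rfl, ?_⟩, fun u v huv i i' h h' => Fin.ext ?_,
    fun d hd hdt => absurd hdt (ht d hd)⟩
  · rw [hz]
    simp only [detour]
    split_ifs <;> first | omega | tauto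
  · rw [hmove i (h.ne hG huv), hmove i' (h'.ne hG huv)]

/-- Every run can be changed so that walks move only at relevant times. -/
theorem IsRun.reach (hstar : IsBidirectedStar I.G) {M T : ℕ} {v₀ : V} {cfg : ℕ → Config V M}
    (h : I.IsRun v₀ cfg T) {t : ℕ} (htT : t ≤ T) (ht : t = 0 ∨ ∃ d ∈ I.D, d.2 = t) :
    I.Reach v₀ t (cfg (t + 1)) (totalWalks cfg t) := by
  classical
  obtain ⟨z, hz⟩ := hstar
  induction t using Nat.strong_induction_on with
  | _ t ih =>
  rcases Nat.eq_zero_or_pos t with rfl | hpos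
  · exact ⟨funext h.init, by simp [totalWalks]⟩
  replace ht := ht.resolve_left (by omega)
  obtain ⟨t', rfl⟩ : ∃ t', t = t' + 1 := ⟨t - 1, by omega⟩
  obtain ⟨d, hd, hdt⟩ := ht
  -- The previous demand is at time `p`.
  obtain ⟨p, hp, hpd, hgap⟩ : ∃ p ≤ t', (p = 0 ∨ ∃ d ∈ I.D, d.2 = p) ∧
      ∀ x, p < x → x ≤ t' → ∀ d ∈ I.D, d.2 ≠ x := by
    let P : ℕ → Prop := fun p => p = 0 ∨ ∃ d ∈ I.D, d.2 = p
    refine ⟨Nat.findGreatest P t', Nat.findGreatest_le _,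
      Nat.findGreatest_spec (P := P) (Nat.zero_le t') (Or.inl rfl), fun x hx hx' d hd hdx => ?_⟩
    exact Nat.findGreatest_is_greatest hx hx' (Or.inr ⟨d, hd, hdx⟩)
  have hR := ih p (by omega) (by omega) hpd
  have hidx : ∀ x, p < x → x ≤ t' → ∀ i, (cfg x i).2 = (cfg (x + 1) i).2 := by
    intro x h1 h2 i
    rcases (h.step x (by omega) (by omega)).slot i with ⟨h3, -⟩ | ⟨-, d, hd, -, h3, -⟩
    · exact h3
    · exact absurd h3 (hgap x h1 h2 d hd)
  have hconst : ∀ x, p ≤ x → x ≤ t' → totalWalks cfg x = totalWalks cfg p ∧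
      ∀ i, (cfg (x + 1) i).2 = (cfg (p + 1) i).2 := by
    intro x hpx
    induction x, hpx using Nat.le_induction with
    | base => exact fun _ => ⟨rfl, fun _ => rfl⟩
    | succ x hpx ihx =>
      intro hx
      obtain ⟨h1, h2⟩ := ihx (by omega)
      have h3 := hidx (x + 1) (by omega) hx
      exact ⟨by rw [totalWalks_succ, newWalks_eq_zero h3, h1, add_zero],
        fun i => (h3 i).symm.trans (h2 i)⟩
  have hrel : ∀ x, t' + 1 - (M + M) ≤ x → x ≤ t' + 1 → I.Relevant M x := fun x h1 h2 =>
    ⟨d, hd, by omega, by omega⟩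
  suffices hpre : I.Reach v₀ t' (cfg (t' + 1)) (totalWalks cfg t') from
    Or.inl ⟨hrel _ (by omega) le_rfl, _, _, hpre, h.step _ (by omega) htT, totalWalks_succ _ _⟩
  by_cases hlong : p + 1 < t' + 1 - (M + M)
  · -- The walks stay in place until the relevant times, and then they are rearranged.
    have h0 : I.Reach v₀ (t' - (M + M)) (cfg (p + 1)) (totalWalks cfg p) := by
      refine hR.of_not_relevant (by omega) ?_
      rintro x hx hx' ⟨d', hd', h1, h2⟩
      by_cases h3 : d'.2 ≤ t'
      · exact hgap d'.2 (by omega) h3 d' hd' rfl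
      · omega
    have hdet : ∀ j ≤ M + M, I.Reach v₀ (t' - (M + M) + j)
        (detour z (cfg (p + 1)) (cfg (t' + 1)) j) (totalWalks cfg p) := by
      intro j
      induction j with
      | zero =>
        intro _
        have hd0 : detour z (cfg (p + 1)) (cfg (t' + 1)) 0 = cfg (p + 1) := by
          funext i
          simp [detour]
        rw [hd0]
        exact h0
      | succ j ihj =>
        intro hj
        rw [← add_assoc]
        refine Or.inl ⟨hrel _ (by omega) (by omega), _, _, ihj (by omega),
          step_detour hz (hgap _ (by omega) (by omega)) _ _ j, ?_⟩
        have hnew : newWalks (detour z (cfg (p + 1)) (cfg (t' + 1)) j)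
            (detour z (cfg (p + 1)) (cfg (t' + 1)) (j + 1)) = 0 := newWalks_eq_zero fun _ => rfl
        rw [hnew, add_zero]
    have hend := hdet (M + M) le_rfl
    rw [Nat.sub_add_cancel (by omega)] at hend
    convert hend using 1
    · funext i
      refine Prod.ext ?_ ((hconst t' hp le_rfl).2 i)
      have := i.2
      simp only [detour]
      rw [if_neg (by omega), if_neg (by omega)]
    · exact (hconst t' hp le_rfl).1
  · have hchain : ∀ x, p ≤ x → x ≤ t' → I.Reach v₀ x (cfg (x + 1)) (totalWalks cfg x) := by
      intro x hpx
      induction x, hpx using Nat.le_induction with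
      | base => exact fun _ => hR
      | succ x hpx ihx =>
        intro hx
        exact Or.inl ⟨hrel _ (by omega) (by omega), _, _, ihx (by omega),
          h.step _ (by omega) (by omega), totalWalks_succ _ _⟩
    exact hchain t' hp le_rfl

theorem HasPlan.mono {m m' : ℕ} (h : I.HasPlan m) (hm : m ≤ m') : I.HasPlan m' := by
  obtain ⟨ι, inst, w, h1, h2⟩ := h
  exact ⟨ι, inst, w, h1.trans hm, h2⟩

theorem exists_demand_eq_lifetime (I : LifeTEDSC V) : ∃ d ∈ I.D, d.2 = I.lifetime := by
  obtain ⟨d, hd, h⟩ := Finset.exists_mem_eq_sup I.D I.demands_nonempty Prod.snd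
  exact ⟨d, hd, h.symm⟩

/-- Feasibility in terms of the dynamic program; the vertex `v₀` of the empty slots is arbitrary. -/
theorem isFeasible_iff_reach [Fintype V] (hstar : IsBidirectedStar I.G) (v₀ : V) :
    I.IsFeasible ↔ ∃ (c : Config V (4 * Fintype.card V)) (w : ℕ), w ≤ I.k ∧
      I.Reach v₀ I.lifetime c w := by
  have hG : ∀ v, ¬ I.G.Adj v v := by
    obtain ⟨z, hz⟩ := hstar
    exact fun v => by rw [hz]; tauto
  constructor
  · intro h
    obtain ⟨ι, _, w, hcard, hw, hcrowd⟩ := (hasPlan_of_isFeasible hG h).exists_crowd_le hstar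
    obtain ⟨w', hw', hstart, hcrowd'⟩ := hw.exists_startsWithDemand
    obtain ⟨cfg, hrun, htotal⟩ := hw'.exists_isRun hG hstart
      (M := 4 * Fintype.card V) (by have := Fintype.card_pos_iff.2 ⟨v₀⟩; omega)
      (fun t => (hcrowd' t).trans (hcrowd t)) v₀
    exact ⟨_, _, htotal.trans hcard,
      hrun.reach hstar le_rfl (Or.inr I.exists_demand_eq_lifetime)⟩
  · rintro ⟨c, w, hw, h⟩
    obtain ⟨cfg, hrun, -, rfl⟩ := h.exists_isRun hG
    exact isFeasible_of_hasPlan ((hrun.hasPlan hG).mono hw)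

end LifeTEDSC

/-! ### Codes of configurations -/

namespace LifeTEDSC

variable {n : ℕ} (I : LifeTEDSC (Fin n))

/-- The lists enumerate the edges and the demands of the instance. -/
structure IsListing (es : List (Fin n × Fin n)) (ds : List ((Fin n × Fin n) × ℕ)) : Prop where
  nodup_edges : es.Nodup
  mem_edges : ∀ e, e ∈ es ↔ I.G.Adj e.1 e.2
  nodup_demands : ds.Nodup
  mem_demands : ∀ d, d ∈ ds ↔ d ∈ I.D

/-- The numbers of an instance, with edges and demands in the order of the lists. -/
def tables (es : List (Fin n × Fin n)) (ds : List ((Fin n × Fin n) × ℕ)) : Tables where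
  n := n
  m := es.length
  d := ds.length
  k := I.k
  h := I.h
  eu := fun e => (es.map fun e => (e.1 : ℕ)).getD e 0
  ev := fun e => (es.map fun e => (e.2 : ℕ)).getD e 0
  du := fun j => (ds.map fun d => (d.1.1 : ℕ)).getD j 0
  dv := fun j => (ds.map fun d => (d.1.2 : ℕ)).getD j 0
  dt := fun j => (ds.map fun d => d.2).getD j 0

/-- The digit for the demand with which the walk in a slot started. -/
def startCode (ds : List ((Fin n × Fin n) × ℕ)) : Option ((Fin n × Fin n) × ℕ) → ℕ
  | none => 0
  | some d => ds.idxOf d + 1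

/-- The number `s` is a code of the configuration `c`, and the walks of `c` start with demands. -/
def Codes (es : List (Fin n × Fin n)) (ds : List ((Fin n × Fin n) × ℕ)) (c : Config (Fin n) (4 * n))
    (s : ℕ) : Prop :=
  ∀ i : Fin (4 * n), (I.tables es ds).pos s i = (c i).1 ∧
    (I.tables es ds).idx s i = startCode ds (c i).2 ∧
    ∀ d, (c i).2 = some d → d ∈ I.D

variable {I} {es : List (Fin n × Fin n)} {ds : List ((Fin n × Fin n) × ℕ)}

theorem startCode_inj (hL : I.IsListing es ds) {x y : Option ((Fin n × Fin n) × ℕ)}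
    (hx : ∀ d, x = some d → d ∈ I.D) : startCode ds x = startCode ds y ↔ x = y := by
  cases x <;> cases y <;> simp [startCode]
  exact List.idxOf_inj ((hL.mem_demands _).2 (hx _ rfl))

theorem exists_edge_iff (hL : I.IsListing es ds) (Q : ℕ → ℕ → Prop) :
    (∃ e < (I.tables es ds).m, Q ((I.tables es ds).eu e) ((I.tables es ds).ev e)) ↔
      ∃ u v, I.G.Adj u v ∧ Q u v := by
  simp only [tables]
  constructor
  · rintro ⟨e, he, hQ⟩
    refine ⟨es[e].1, es[e].2, (hL.mem_edges _).1 (List.getElem_mem he), ?_⟩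
    simpa [List.getD_eq_getElem, he] using hQ
  · rintro ⟨u, v, huv, hQ⟩
    obtain ⟨e, he, h⟩ := List.getElem_of_mem ((hL.mem_edges (u, v)).2 huv)
    exact ⟨e, he, by simpa [List.getD_eq_getElem, he, h] using hQ⟩

theorem exists_demand_iff (hL : I.IsListing es ds) (Q : ℕ → ℕ → ℕ → ℕ → Prop) :
    (∃ j < (I.tables es ds).d, Q j ((I.tables es ds).du j) ((I.tables es ds).dv j)
      ((I.tables es ds).dt j)) ↔ ∃ d ∈ I.D, Q (ds.idxOf d) d.1.1 d.1.2 d.2 := by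
  simp only [tables]
  constructor
  · rintro ⟨j, hj, hQ⟩
    refine ⟨ds[j], (hL.mem_demands _).1 (List.getElem_mem hj), ?_⟩
    rw [hL.nodup_demands.idxOf_getElem j hj]
    simpa [List.getD_eq_getElem, hj] using hQ
  · rintro ⟨d, hd, hQ⟩
    have hj := List.idxOf_lt_length_of_mem ((hL.mem_demands d).2 hd)
    refine ⟨ds.idxOf d, hj, ?_⟩
    simpa [List.getD_eq_getElem, hj] using hQ

theorem forall_edge_iff (hL : I.IsListing es ds) (Q : ℕ → ℕ → Prop) :
    (∀ e < (I.tables es ds).m, Q ((I.tables es ds).eu e) ((I.tables es ds).ev e)) ↔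
      ∀ u v : Fin n, I.G.Adj u v → Q u v := by
  have := exists_edge_iff hL fun u v => ¬ Q u v
  rw [← not_iff_not]
  push Not
  exact this

theorem forall_demand_iff (hL : I.IsListing es ds) (Q : ℕ → ℕ → ℕ → Prop) :
    (∀ j < (I.tables es ds).d, Q ((I.tables es ds).du j) ((I.tables es ds).dv j)
      ((I.tables es ds).dt j)) ↔ ∀ d ∈ I.D, Q d.1.1 d.1.2 d.2 := by
  have := exists_demand_iff hL fun _ u v t => ¬ Q u v t
  rw [← not_iff_not]
  push Not
  exact this

theorem startCode_eq_succ_iff (hL : I.IsListing es ds) {x : Option ((Fin n × Fin n) × ℕ)}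
    {d : (Fin n × Fin n) × ℕ} (hd : d ∈ I.D) : startCode ds x = ds.idxOf d + 1 ↔ x = some d := by
  rw [eq_comm, @eq_comm _ x]
  exact startCode_inj (x := some d) hL fun d' h => Option.some.inj h ▸ hd

section Transitions

variable {c c' : Config (Fin n) (4 * n)} {s s' t : ℕ}

theorem slotOK_iff (hL : I.IsListing es ds) (hc : I.Codes es ds c s) (hc' : I.Codes es ds c' s')
    (i : Fin (4 * n)) : (I.tables es ds).SlotOK t s s' i ↔ I.SlotStep t (c i) (c' i) := by
  obtain ⟨h1, h2, h3⟩ := hc i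
  obtain ⟨h1', h2', -⟩ := hc' i
  rw [Tables.SlotOK, SlotStep, h1, h1', h2, h2', startCode_inj hL h3,
    exists_edge_iff hL fun u v => u = (c i).1 ∧ v = (c' i).1,
    exists_demand_iff hL fun j _ v t' => startCode ds (c' i).2 = j + 1 ∧ t' = t ∧ v = (c' i).1]
  simp only [← Fin.ext_iff]
  refine or_congr (and_congr_right fun _ => or_congr_right ?_) (and_congr_right fun _ =>
    exists_congr fun d => and_congr_right fun hd => ?_)
  · constructor
    · rintro ⟨u, v, huv, rfl, rfl⟩; exact huv
    · exact fun h => ⟨_, _, h, rfl, rfl⟩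
  · rw [startCode_eq_succ_iff hL hd]

theorem uses_iff (hL : I.IsListing es ds) (hc : I.Codes es ds c s) (hc' : I.Codes es ds c' s')
    (i : Fin (4 * n)) (u v : Fin n) :
    (I.tables es ds).Uses s s' i u v ↔ I.Traverses (c i) (c' i) u v := by
  obtain ⟨h1, h2, h3⟩ := hc i
  obtain ⟨h1', h2', -⟩ := hc' i
  rw [Tables.Uses, Traverses, h1, h1', h2, h2', startCode_inj hL h3,
    exists_demand_iff hL fun j u' _ _ => startCode ds (c' i).2 = j + 1 ∧ u' = u]
  simp only [← Fin.ext_iff]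
  refine and_congr_left fun _ => or_congr_right (and_congr_right fun _ =>
    exists_congr fun d => and_congr_right fun hd => ?_)
  rw [startCode_eq_succ_iff hL hd]

theorem alive_iff (hL : I.IsListing es ds) (hc : I.Codes es ds c s) (i : Fin (4 * n)) :
    (I.tables es ds).Alive t ((I.tables es ds).idx s i) ↔
      ∃ d ∈ I.D, (c i).2 = some d ∧ t < d.2 + I.h := by
  rw [Tables.Alive, (hc i).2.1,
    exists_demand_iff hL fun j _ _ t' => startCode ds (c i).2 = j + 1 ∧ t < t' + (I.tables es ds).h]
  refine exists_congr fun d => and_congr_right fun hd => ?_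
  rw [startCode_eq_succ_iff hL hd]
  rfl

theorem stepOK_iff (hL : I.IsListing es ds) (hc : I.Codes es ds c s)
    (hc' : I.Codes es ds c' s') : (I.tables es ds).StepOK t s s' ↔ I.Step t c c' := by
  have hfin : ∀ Q : ℕ → Prop, (∀ i < (I.tables es ds).slots, Q i) ↔ ∀ i : Fin (4 * n), Q i :=
    fun Q => ⟨fun h i => h i i.2, fun h i hi => h ⟨i, hi⟩⟩
  have hfin' : ∀ Q : ℕ → Prop, (∃ i < (I.tables es ds).slots, Q i) ↔ ∃ i : Fin (4 * n), Q i :=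
    fun Q => ⟨fun ⟨i, hi, h⟩ => ⟨⟨i, hi⟩, h⟩, fun ⟨i, h⟩ => ⟨i, i.2, h⟩⟩
  rw [Tables.StepOK, forall_edge_iff hL fun u v => ∀ i < (I.tables es ds).slots,
      ∀ i' < (I.tables es ds).slots, (I.tables es ds).Uses s s' i u v →
        (I.tables es ds).Uses s s' i' u v → i = i',
    forall_demand_iff hL fun u v t' => t' = t → ∃ i < (I.tables es ds).slots,
      (I.tables es ds).Uses s s' i u v ∧ (I.tables es ds).Alive t ((I.tables es ds).idx s' i)]
  simp only [hfin, hfin', slotOK_iff hL hc hc', uses_iff hL hc hc', alive_iff hL hc',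
    ← Fin.ext_iff]
  exact ⟨fun ⟨h1, h2, h3⟩ => ⟨h1, h2, h3⟩, fun ⟨h1, h2, h3⟩ => ⟨h1, h2, h3⟩⟩

theorem starts_eq (hL : I.IsListing es ds) (hc : I.Codes es ds c s)
    (hc' : I.Codes es ds c' s') : (I.tables es ds).starts s s' = newWalks c c' := by
  classical
  rw [Tables.starts, newWalks, Nat.count_eq_card_filter_range]
  symm
  refine Finset.card_bij (fun i _ => (i : ℕ)) ?_ (fun i _ j _ h => Fin.ext h) ?_
  · intro i hi
    simp only [Finset.mem_filter, Finset.mem_univ, true_and, Finset.mem_range] at hi ⊢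
    exact ⟨i.2, by rwa [(hc i).2.1, (hc' i).2.1, startCode_inj hL (hc i).2.2]⟩
  · intro i hi
    simp only [Finset.mem_filter, Finset.mem_univ, true_and, Finset.mem_range] at hi ⊢
    obtain ⟨hi, h⟩ := hi
    refine ⟨⟨i, hi⟩, ?_, rfl⟩
    rw [(hc ⟨i, hi⟩).2.1, (hc' ⟨i, hi⟩).2.1, startCode_inj hL (hc ⟨i, hi⟩).2.2] at h
    exact h

theorem exists_code (hL : I.IsListing es ds) (hwf : ∀ i d, (c i).2 = some d → d ∈ I.D) :
    ∃ s < (I.tables es ds).codes, I.Codes es ds c s := by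
  have hcode : ∀ i : Fin (4 * n), startCode ds (c i).2 < (I.tables es ds).base := by
    intro i
    have h := hwf i
    cases hx : (c i).2 with
    | none => simp [startCode, Tables.base]
    | some d =>
      have := List.idxOf_lt_length_of_mem ((hL.mem_demands d).2 (h d hx))
      simp only [startCode, Tables.base, tables]
      omega
  have hpos : ∀ v : Fin n, (v : ℕ) < (I.tables es ds).base := by
    intro v
    have := v.2
    simp only [Tables.base, tables]
    omega
  let f : Fin (2 * (4 * n)) → Fin (I.tables es ds).base := fun i =>
    if h : (i : ℕ) < 4 * n then ⟨(c ⟨i, h⟩).1, hpos _⟩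
    else ⟨startCode ds (c ⟨i - 4 * n, by omega⟩).2, hcode _⟩
  have hf : ∀ i : Fin (2 * (4 * n)),
      (finFunctionFinEquiv f : ℕ) / (I.tables es ds).base ^ (i : ℕ) % (I.tables es ds).base = f i :=
    fun i => congrArg (fun g : Fin (2 * (4 * n)) → Fin _ => (g i : ℕ))
      (finFunctionFinEquiv.symm_apply_apply f)
  refine ⟨finFunctionFinEquiv f, (finFunctionFinEquiv f).2, fun i => ⟨?_, ?_, hwf i⟩⟩
  · refine (hf ⟨i, by omega⟩).trans ?_
    simp [f]
  · refine (hf ⟨4 * n + i, by omega⟩).trans ?_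
    simp [f]

theorem exists_codes_of_stepOK (hL : I.IsListing es ds) (hc : I.Codes es ds c s)
    (h : (I.tables es ds).StepOK t s s') : ∃ c', I.Codes es ds c' s' := by
  suffices ∀ i : Fin (4 * n), ∃ x : Fin n × Option ((Fin n × Fin n) × ℕ),
      (I.tables es ds).pos s' i = x.1 ∧ (I.tables es ds).idx s' i = startCode ds x.2 ∧
        ∀ d, x.2 = some d → d ∈ I.D from
    ⟨fun i => (this i).choose, fun i => (this i).choose_spec⟩
  intro i
  obtain ⟨h1, h2, h3⟩ := hc i
  rcases h.1 i i.2 with ⟨h4, h5 | h5⟩ | ⟨-, h5⟩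
  · exact ⟨c i, h5 ▸ h1, h4 ▸ h2, h3⟩
  · rw [exists_edge_iff hL fun u v => u = (I.tables es ds).pos s i ∧
      v = (I.tables es ds).pos s' i] at h5
    obtain ⟨u, v, -, -, hv⟩ := h5
    exact ⟨(v, (c i).2), hv.symm, h4 ▸ h2, h3⟩
  · rw [exists_demand_iff hL fun j _ v t' => (I.tables es ds).idx s' i = j + 1 ∧ t' = t ∧
      v = (I.tables es ds).pos s' i] at h5
    obtain ⟨d, hd, h6, -, hv⟩ := h5
    exact ⟨(d.1.2, some d), hv.symm, h6, fun d' h' => Option.some.inj h' ▸ hd⟩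

end Transitions

theorem relevant_iff (hL : I.IsListing es ds) (t : ℕ) :
    (I.tables es ds).Relevant t ↔ I.Relevant (4 * n) t :=
  exists_demand_iff hL fun _ _ _ t' => t' - (4 * n + 4 * n) ≤ t ∧ t ≤ t'

theorem exists_reach_of_tables (hL : I.IsListing es ds) {v₀ : Fin n} (hv₀ : (v₀ : ℕ) = 0)
    {t s w : ℕ} (h : (I.tables es ds).Reach t s w) :
    ∃ c : Config (Fin n) (4 * n), I.Codes es ds c s ∧ I.Reach v₀ t c w := by
  induction t generalizing s w with
  | zero =>
    obtain ⟨rfl, rfl⟩ := h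
    exact ⟨fun _ => (v₀, none), fun i => ⟨by simp [Tables.pos, hv₀], by
      simp [Tables.idx, startCode], by simp⟩, rfl, rfl⟩
  | succ t ih =>
    rcases h with ⟨hrel, s₀, w', -, h, hstep, rfl⟩ | ⟨hrel, h⟩
    · obtain ⟨c, hc, hr⟩ := ih h
      obtain ⟨c', hc'⟩ := exists_codes_of_stepOK hL hc hstep
      exact ⟨c', hc', Or.inl ⟨(relevant_iff hL _).1 hrel, c, w', hr,
        (stepOK_iff hL hc hc').1 hstep, by rw [starts_eq hL hc hc']⟩⟩
    · obtain ⟨c, hc, hr⟩ := ih h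
      exact ⟨c, hc, Or.inr ⟨fun h => hrel ((relevant_iff hL _).2 h), hr⟩⟩

theorem exists_tables_of_reach (hL : I.IsListing es ds) {v₀ : Fin n} (hv₀ : (v₀ : ℕ) = 0)
    {t w : ℕ} {c : Config (Fin n) (4 * n)} (h : I.Reach v₀ t c w) :
    ∃ s < (I.tables es ds).codes, I.Codes es ds c s ∧ (I.tables es ds).Reach t s w := by
  induction t generalizing c w with
  | zero =>
    obtain ⟨rfl, rfl⟩ := h
    refine ⟨0, Nat.pos_of_ne_zero ?_, fun i => ⟨by simp [Tables.pos, hv₀], by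
      simp [Tables.idx, startCode], by simp⟩, rfl, rfl⟩
    simp [Tables.codes, Tables.base]
  | succ t ih =>
    rcases h with ⟨hrel, c₀, w', h, hstep, rfl⟩ | ⟨hrel, h⟩
    · obtain ⟨s, hs, hc, hr⟩ := ih h
      obtain ⟨s', hs', hc'⟩ := exists_code (c := c) hL (fun i d hd => by
        rcases hstep.slot i with ⟨h1, -⟩ | ⟨-, d', hd', h1, -⟩
        · exact (hc i).2.2 d (h1.trans hd)
        · exact Option.some.inj (h1.symm.trans hd) ▸ hd')
      exact ⟨s', hs', hc', Or.inl ⟨(relevant_iff hL _).2 hrel, s, w', hs, hr,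
        (stepOK_iff hL hc hc').2 hstep, by rw [starts_eq hL hc hc']⟩⟩
    · obtain ⟨s, hs, hc, hr⟩ := ih h
      exact ⟨s, hs, hc, Or.inr ⟨fun h => hrel ((relevant_iff hL _).1 h), hr⟩⟩

theorem isFeasible_iff_tables (hL : I.IsListing es ds) (hstar : IsBidirectedStar I.G) :
    I.IsFeasible ↔ ∃ u < (I.tables es ds).codes, ∃ w ≤ (I.tables es ds).k,
      (I.tables es ds).Reach I.lifetime u w := by
  obtain ⟨d, hd⟩ := I.demands_nonempty
  have hv₀ : ((⟨0, d.1.1.pos⟩ : Fin n) : ℕ) = 0 := rfl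
  have h := isFeasible_iff_reach hstar (⟨0, d.1.1.pos⟩ : Fin n)
  rw [Fintype.card_fin] at h
  rw [h]
  constructor
  · rintro ⟨c, w, hw, hr⟩
    obtain ⟨s, hs, -, hr'⟩ := exists_tables_of_reach hL hv₀ hr
    exact ⟨s, hs, w, hw, hr'⟩
  · rintro ⟨s, -, w, hw, hr⟩
    obtain ⟨c, -, hr'⟩ := exists_reach_of_tables hL hv₀ hr
    exact ⟨c, w, hw, hr'⟩

/-! ### Reading the input -/

theorem _root_.List.getD_flatMap_pair {α : Type*} (f g : α → ℕ) (l : List α) (r : List ℕ) (i : ℕ)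
    (hi : i < l.length) :
    (l.flatMap (fun a => [f a, g a]) ++ r).getD (i + i) 0 = (l.map f).getD i 0 ∧
    (l.flatMap (fun a => [f a, g a]) ++ r).getD (i + i + 1) 0 = (l.map g).getD i 0 := by
  induction l generalizing i with
  | nil => simp at hi
  | cons a l ih =>
    cases i with
    | zero => simp
    | succ i =>
      have := ih i (by simpa using hi)
      rw [show i + 1 + (i + 1) = i + i + 2 by ring]
      simpa using this

theorem _root_.List.getD_flatMap_triple {α : Type*} (f g k : α → ℕ) (l : List α) (i : ℕ)
    (hi : i < l.length) :
    (l.flatMap fun a => [f a, g a, k a]).getD (i + (i + i)) 0 = (l.map f).getD i 0 ∧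
    (l.flatMap fun a => [f a, g a, k a]).getD (i + (i + i) + 1) 0 = (l.map g).getD i 0 ∧
    (l.flatMap fun a => [f a, g a, k a]).getD (i + (i + i) + 2) 0 = (l.map k).getD i 0 := by
  induction l generalizing i with
  | nil => simp at hi
  | cons a l ih =>
    cases i with
    | zero => simp
    | succ i =>
      have := ih i (by simpa using hi)
      rw [show i + 1 + (i + 1 + (i + 1)) = i + (i + i) + 3 by ring]
      simpa using this

/-- The initial memory contains the entries of the instance, followed by zeros. -/
theorem stored_init (I : LifeTEDSC (Fin n)) (es : List (Fin n × Fin n))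
    (ds : List ((Fin n × Fin n) × ℕ)) {w : List ℕ}
    (hw : w = [n, es.length, ds.length, I.k, I.h]
      ++ es.flatMap (fun e => [(e.1 : ℕ), (e.2 : ℕ)])
      ++ ds.flatMap (fun d => [(d.1.1 : ℕ), (d.1.2 : ℕ), d.2])) :
    (I.tables es ds).Stored (RamState.init w) ∧
      ∀ i, (I.tables es ds).free ≤ i → (RamState.init w).mem i = 0 := by
  have hlen : (es.flatMap fun e => [(e.1 : ℕ), (e.2 : ℕ)]).length = es.length + es.length := by
    simp; ring
  have hlen' : (ds.flatMap fun d => [(d.1.1 : ℕ), (d.1.2 : ℕ), d.2]).length = 3 * ds.length := by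
    simp; ring
  have h5 : ∀ i, w.getD (5 + i) 0 = (es.flatMap (fun e => [(e.1 : ℕ), (e.2 : ℕ)])
      ++ ds.flatMap (fun d => [(d.1.1 : ℕ), (d.1.2 : ℕ), d.2])).getD i 0 := by
    intro i
    rw [hw, List.append_assoc, List.getD_append_right _ _ _ _ (by simp)]
    simp
  have hd : ∀ i, w.getD (5 + (es.length + es.length) + i) 0 =
      (ds.flatMap (fun d => [(d.1.1 : ℕ), (d.1.2 : ℕ), d.2])).getD i 0 := by
    intro i
    rw [add_assoc, h5, List.getD_append_right _ _ _ _ (by omega), hlen, Nat.add_sub_cancel_left]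
  refine ⟨?_, fun i hi => ?_⟩
  · constructor
    · subst hw; rfl
    · subst hw; rfl
    · subst hw; rfl
    · subst hw; rfl
    · subst hw; rfl
    · intro e he
      exact (h5 _).trans (List.getD_flatMap_pair _ _ es _ e he).1
    · intro e he
      refine (congrArg (fun i => w.getD i 0) (show 6 + (e + e) = 5 + (e + e + 1) by ring)).trans ?_
      exact (h5 _).trans (List.getD_flatMap_pair _ _ es _ e he).2
    · intro j hj
      exact (hd _).trans (List.getD_flatMap_triple _ _ _ ds j hj).1
    · intro j hj
      refine (congrArg (fun i => w.getD i 0) (show 6 + (es.length + es.length) + (j + (j + j)) =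
        5 + (es.length + es.length) + (j + (j + j) + 1) by ring)).trans ?_
      exact (hd _).trans (List.getD_flatMap_triple _ _ _ ds j hj).2.1
    · intro j hj
      refine (congrArg (fun i => w.getD i 0) (show 7 + (es.length + es.length) + (j + (j + j)) =
        5 + (es.length + es.length) + (j + (j + j) + 2) by ring)).trans ?_
      exact (hd _).trans (List.getD_flatMap_triple _ _ _ ds j hj).2.2
  · refine List.getD_eq_default _ _ ?_
    simp only [Tables.free, tables] at hi
    rw [hw, List.length_append, List.length_append, hlen, hlen']
    simp
    omega

/-! ### Bounds -/

/-- All loops of the program make at most `(n |D|) ^ (20 n)` rounds: since `n ≥ 2`, the base of the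
state codes is at most `(n |D|) ^ 2`, and there are `8 n` digits. -/
theorem bounded_tables (hL : I.IsListing es ds) (hn : 2 ≤ n) {C : ℕ} (hC : 40 ≤ C) :
    (I.tables es ds).Bounded (3 ^ I.k * (n * I.D.card) ^ (C * n) * (I.lifetime + I.h + 1))
      ((n * I.D.card) ^ (20 * n)) ∧
    (I.tables es ds).d * (2 * (I.tables es ds).slots + 1) + 3 ≤ (n * I.D.card) ^ (20 * n) := by
  classical
  have hd : ds.length = I.D.card := by
    rw [← List.toFinset_card_of_nodup hL.nodup_demands]
    congr 1
    ext d
    rw [List.mem_toFinset, hL.mem_demands]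
  have hd1 : 1 ≤ I.D.card := I.demands_nonempty.card_pos
  have hm : es.length ≤ n * n := by
    have := hL.nodup_edges.length_le_card
    rwa [Fintype.card_prod, Fintype.card_fin] at this
  set d := I.D.card with hddef
  set X := n * d with hX
  have hnX : n ≤ X := Nat.le_mul_of_pos_right n hd1
  have hdX : d ≤ X := Nat.le_mul_of_pos_left d (by omega)
  have hX2 : 2 ≤ X := hn.trans hnX
  have hq : 2 * X ≤ X * X := Nat.mul_le_mul_right X hX2
  have hnn : n * n ≤ X * X := Nat.mul_le_mul hnX hnX
  have hpow : ∀ {a b}, a ≤ b → X ^ a ≤ X ^ b := fun h => Nat.pow_le_pow_right (by omega) h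
  have hK : 32 * (X * X) ≤ X ^ (20 * n) := by
    have h1 : X ^ 7 ≤ X ^ (20 * n) := hpow (by omega)
    have h2 : 2 ^ 5 ≤ X ^ 5 := Nat.pow_le_pow_left hX2 5
    have h3 : X ^ 7 = X ^ 5 * (X * X) := by ring
    rw [h3] at h1
    exact (Nat.mul_le_mul_right _ h2).trans h1
  have hbase : (I.tables es ds).base ≤ X * X := by
    simp only [Tables.base, tables, hd]
    obtain ⟨a, rfl⟩ : ∃ a, n = a + 1 := ⟨n - 1, by omega⟩
    obtain ⟨b, hb⟩ : ∃ b, d = b + 1 := ⟨d - 1, by omega⟩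
    have : X = a * b + a + b + 1 := by rw [hX, hb]; ring
    have h0 : 0 ≤ a * b := Nat.zero_le _
    omega
  have hcodes : (I.tables es ds).codes ≤ X ^ (20 * n) := by
    refine (Nat.pow_le_pow_left hbase _).trans ?_
    rw [← sq, ← pow_mul]
    refine hpow ?_
    simp only [Tables.slots, tables]
    omega
  have hW1 : 1 ≤ X ^ (C * n) := Nat.one_le_pow _ _ (by omega)
  have hW2 : 1 ≤ 3 ^ I.k := Nat.one_le_pow _ _ (by omega)
  have hdn : d * (2 * (4 * n) + 1) = 8 * X + d := by rw [hX]; ring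
  refine ⟨⟨by omega, ?_, ?_, ?_, hcodes, by omega, ?_, ?_⟩, ?_⟩
  · rw [← pow_add]
    calc X ^ (20 * n + 20 * n) ≤ X ^ (C * n) := hpow (by nlinarith)
      _ = 1 * X ^ (C * n) * 1 := by ring
      _ ≤ _ := Nat.mul_le_mul (Nat.mul_le_mul_right _ hW2) (by omega)
  · simp only [Tables.free, tables]
    omega
  · simp only [Tables.slots, tables]
    omega
  · have : ∀ j < (I.tables es ds).d, (I.tables es ds).dt j ≤ I.lifetime :=
      (forall_demand_iff hL fun _ _ t => t ≤ I.lifetime).2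
        fun d hd => Finset.le_sup (f := Prod.snd) hd
    intro j hj
    have h1 := this j hj
    calc _ ≤ 1 * 1 * (I.lifetime + I.h + 1) := by simp only [tables] at h1 ⊢; omega
      _ ≤ _ := Nat.mul_le_mul_right _ (Nat.mul_le_mul hW2 hW1)
  · have : I.k < 3 ^ I.k := Nat.lt_pow_self (by omega)
    calc I.k + 1 ≤ 3 ^ I.k * 1 * 1 := by omega
      _ ≤ _ := Nat.mul_le_mul (Nat.mul_le_mul_left _ hW1) (by omega)
  · change ds.length * (2 * (4 * n) + 1) + 3 ≤ _
    rw [hd, hdn]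
    omega

end LifeTEDSC

theorem mainTheorem11 :
    ∃ (P : RamProg) (C : ℕ), ∀ (n : ℕ) (I : LifeTEDSC (Fin n)), IsBidirectedStar I.G →
      P.Decides I
        (3 ^ I.k * (n * I.D.card) ^ (C * n) * (I.lifetime + I.h + 1))
        (3 ^ I.k * (n * I.D.card) ^ (C * n)) := by
  -- The steps are `K ^ deg` for `K = (n |D|) ^ (20 n)`, and the words have to hold `K * K`.
  refine ⟨decision, 20 * decision.deg + 40, fun n I hstar w hw => ?_⟩
  obtain ⟨es, ds, h1, h2, h3, h4, rfl⟩ := hw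
  have hL : I.IsListing es ds := ⟨h1, h2, h3, h4⟩
  obtain ⟨d, hd, hdL⟩ := I.exists_demand_eq_lifetime
  -- A star with an edge has two vertices, so the base `n |D|` of the bound is at least `2`.
  have hn : 2 ≤ n := by
    obtain ⟨c, hc⟩ := hstar
    have hne : d.1.1 ≠ d.1.2 := by
      have := (hc _ _).1 (I.demand_edge d hd)
      rintro h
      rw [h] at this
      tauto
    by_contra hn
    exact hne (Fin.ext (by omega))
  obtain ⟨hB, hrounds⟩ := LifeTEDSC.bounded_tables hL hn
    (show 40 ≤ 20 * decision.deg + 40 by omega)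
  obtain ⟨hst, hfree⟩ := LifeTEDSC.stored_init I es ds rfl
  obtain ⟨s, ⟨t, ht, hexec⟩, hans⟩ := Tables.runs_decision_reach (L := I.lifetime) hB hrounds
    ((LifeTEDSC.forall_demand_iff hL fun _ _ t => t ≤ I.lifetime).2
      fun d hd => Finset.le_sup (f := Prod.snd) hd)
    ((LifeTEDSC.exists_demand_iff hL fun _ _ _ t => t = I.lifetime).2 ⟨d, hd, hdL⟩)
    hst (fun _ => rfl) hfree
  refine ⟨t, s, hexec, ht.trans ?_, fun hf => ?_, fun hf => ?_⟩
  · have hX : 0 < n * I.D.card := Nat.mul_pos (by omega) I.demands_nonempty.card_pos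
    rw [← pow_mul]
    calc (n * I.D.card) ^ (20 * n * decision.deg)
        ≤ 1 * (n * I.D.card) ^ ((20 * decision.deg + 40) * n) := by
          rw [one_mul]
          exact Nat.pow_le_pow_right hX (by nlinarith)
      _ ≤ _ := Nat.mul_le_mul_right _ (Nat.one_le_pow _ _ (by omega))
  · rw [hans, truth_of ((LifeTEDSC.isFeasible_iff_tables hL hstar).1 hf)]
  · rw [hans, truth_of_not fun h => hf ((LifeTEDSC.isFeasible_iff_tables hL hstar).2 h)]
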